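/- **Theorem (quaternionic Kähler manifolds are Einstein).** Let $M$ be a quaternionic Kähler $4n$-manifold, $n>1$: a smooth Riemannian manifold $(M,g=\langle\cdot,\cdot\rangle)$ with a rank-three bundle $\mathcal G\subset\operatorname{End}TM$ which near each point has a smooth *adapted basis* $I,J,K$ (that is, $I^2=J^2=-1$, $K=IJ=-JI$, $\langle AX,AY\rangle=\langle X,Y\rangle$ for $A=I,J,K$), such that near each point there are an adapted basis and one-forms $\mu_I,\mu_J,\mu_K$ with $\nabla_XI=\mu_K(X)J-\mu_J(X)K$, and cyclically, where $\nabla$ is the Levi-Civita connection. *Notation.* Put $\omega_A(X,Y)=\langle X,AY\rangle$. For a local adapted basis let $\lambda_I(X)=\frac1{2n}\langle\nabla_X\omega_J,\omega_K\rangle$ and $\gamma_I=d\lambda_I+\lambda_J\wedge\lambda_K$, and cyclically; here $\langle a,b\rangle=\frac12a(e_i,e_j)b(e_i,e_j)$ for two-forms, with $\{e_i\}$ an orthonormal basis and summation over repeated indices. Let $R(X,Y,Z,W)=\langle\nabla_{[X,Y]}Z-\nabla_X\nabla_YZ+\nabla_Y\nabla_XZ,W\rangle$, and $$\mathrm{Ric}(X,Y)=R(X,e_i,Y,e_i),\quad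 \mathrm{Ric}^*_A(X,Y)=R(X,e_i,AY,Ae_i),\quad \mathrm{Ric}^q=\sum_{A=I,J,K}\mathrm{Ric}^*_A .$$ At a point put $\pi_1(x,y,z,u)=\langle x,z\rangle\langle y,u\rangle-\langle x,u\rangle\langle y,z\rangle$ and $\pi_2=\sum_{A}(6\,\omega_A\odot\omega_A-\omega_A\wedge\omega_A)$, where $b\odot c=\frac12(b\otimes c+c\otimes b)$, $\mathbb R_a=\mathbb R(\pi_2+6\pi_1)$, $\mathbb R_b=\mathbb R(\pi_2-6\pi_1)$. Let $\mathcal R$ be the space of algebraic curvature tensors on $T_xM$, and let $\mathcal{QK}\subset\mathcal R$ consist of those $T$ such that each two-form $T(x,y,\cdot,\cdot)$ has no component in $\Lambda^2_0E\,S^2H$, i.e. $$\tfrac14\Bigl(3T(x,y,z,u)-\sum_AT(x,y,Az,Au)\Bigr)=\tfrac1{2n}\sum_A\langle T(x,y,\cdot,\cdot),\omega_A\rangle\,\omega_A(z,u).$$ Finally, $S^4E\subset\mathcal R$ consists of the tensors $$s(x,Jy,z,Ju)-s(x,Jy,Jz,u)-s(Jx,y,z,Ju)+s(Jx,y,Jz,u),$$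 where $s$ is a $\mathbb C$-valued symmetric form in four variables on $T_xM$, complex linear with respect to $I$, with $s(Jx,Jy,Jz,Ju)=\overline{s(x,y,z,u)}$. *Conclusion.* $M$ is Einstein, $q$-Einstein and locally $\mathrm{Ric}^*_A$-Einstein for $A=I,J,K$: $\mathrm{Ric}$, $\mathrm{Ric}^q$ and, locally, $\mathrm{Ric}^*_A$ are locally constant multiples of $g$ (constant multiples on connected sets). More precisely, there is a locally constant function $c$ on $M$ (a constant if $M$ is connected) such that 1. $\mathrm{Ric}=(n+2)c\,g$, $\mathrm{Ric}^*_A=nc\,g$ and $\mathrm{Ric}^q=3nc\,g$, and $2nc=\langle\gamma_I,\omega_I\rangle=\langle\gamma_J,\omega_J\rangle=\langle\gamma_K,\omega_K\rangle$ for every local adapted basis; 2. the orthogonal projection of $R$ to $\mathbb R_a+\mathbb R_b$ is $\frac c8(\pi_2+2\pi_1)$; 3. $R\in S^4E+\mathbb R(\pi_2+2\pi_1)=\mathcal{QK}$, the sum being direct. -/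

import Mathlib

open Bundle VectorField
open scoped Manifold ContDiff Topology ComplexConjugate

set_option linter.unusedSectionVars false
set_option linter.unusedVariables false

namespace AQH

noncomputable section

/-! ### Linear algebra of a quaternion-Hermitian vector space

A triple `(I, J, K)` of endomorphisms is written as a family `A : Fin 3 → V →L[ℝ] V`, with
`A 0 = I`, `A 1 = J`, `A 2 = K`; cyclic permutations of `I, J, K` are shifts of the index. -/

section Algebra

variable {V : Type*} [NormedAddCommGroup V] [InnerProductSpace ℝ V]

/-- Functions of four vectors; `(0,4)`-tensors are the multilinear ones. -/
abbrev Tensor4 (V : Type*) := V → V → V → V → ℝ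

/-- `A = (I, J, K)` is an adapted basis of the space `G` of endomorphisms of `V`: it spans `G`,
satisfies the quaternion identities, and consists of isometries. -/
structure IsAdaptedBasis (G : Submodule ℝ (V →L[ℝ] V)) (A : Fin 3 → V →L[ℝ] V) : Prop where
  sq_I : A 0 ∘L A 0 = -ContinuousLinearMap.id ℝ V
  sq_J : A 1 ∘L A 1 = -ContinuousLinearMap.id ℝ V
  mul_IJ : A 0 ∘L A 1 = A 2
  mul_JI : A 1 ∘L A 0 = -A 2
  isometry : ∀ a x y, inner ℝ (A a x) (A a y) = inner ℝ x y
  span_eq : Submodule.span ℝ (Set.range A) = G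

/-- The Kähler form `ω_A(x, y) = ⟨x, A y⟩`. -/
def kahlerForm (A : V →L[ℝ] V) (x y : V) : ℝ := inner ℝ x (A y)

/-- Wedge product of two two-forms. -/
def wedge (b c : V → V → ℝ) : Tensor4 V := fun x y z u ↦
  b x y * c z u - b x z * c y u + b x u * c y z
    + b y z * c x u - b y u * c x z + b z u * c x y

/-- `b ⊙ c = (b ⊗ c + c ⊗ b) / 2`. -/
def symProd (b c : V → V → ℝ) : Tensor4 V := fun x y z u ↦
  (1 / 2 : ℝ) * (b x y * c z u + c x y * b z u)

/-- `π₁(x,y,z,u) = ⟨x,z⟩⟨y,u⟩ - ⟨x,u⟩⟨y,z⟩`. -/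
def pi₁ (V : Type*) [NormedAddCommGroup V] [InnerProductSpace ℝ V] : Tensor4 V := fun x y z u ↦
  inner ℝ x z * inner ℝ y u - inner ℝ x u * inner ℝ y z

/-- `π₂ = ∑_A (6 ω_A ⊙ ω_A - ω_A ∧ ω_A)`. -/
def pi₂ (A : Fin 3 → V →L[ℝ] V) : Tensor4 V :=
  ∑ a, ((6 : ℝ) • symProd (kahlerForm (A a)) (kahlerForm (A a))
    - wedge (kahlerForm (A a)) (kahlerForm (A a)))

/-- The space `𝓡` of algebraic Riemannian curvature tensors: symmetric elements of `Λ² ⊗ Λ²`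
satisfying the first Bianchi identity. (Linearity in the other three slots follows.) -/
def curvatureTensors (V : Type*) [NormedAddCommGroup V] [InnerProductSpace ℝ V] :
    Submodule ℝ (Tensor4 V) where
  carrier := {R | (∀ x x' y z u, R (x + x') y z u = R x y z u + R x' y z u) ∧
    (∀ (t : ℝ) x y z u, R (t • x) y z u = t * R x y z u) ∧
    (∀ x y z u, R x y z u = -R y x z u) ∧
    (∀ x y z u, R x y z u = R z u x y) ∧
    (∀ x y z u, R x y z u + R y z x u + R z x y u = 0)}
  add_mem' := by
    rintro R S ⟨h1, h2, h3, h4, h5⟩ ⟨k1, k2, k3, k4, k5⟩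
    refine ⟨fun x x' y z u ↦ ?_, fun t x y z u ↦ ?_, fun x y z u ↦ ?_, fun x y z u ↦ ?_,
      fun x y z u ↦ ?_⟩ <;> simp only [Pi.add_apply]
    · rw [h1, k1]; ring
    · rw [h2, k2]; ring
    · rw [h3, k3]; ring
    · rw [h4, k4]
    · linear_combination h5 x y z u + k5 x y z u
  zero_mem' := by simp
  smul_mem' := by
    rintro s R ⟨h1, h2, h3, h4, h5⟩
    refine ⟨fun x x' y z u ↦ ?_, fun t x y z u ↦ ?_, fun x y z u ↦ ?_, fun x y z u ↦ ?_,
      fun x y z u ↦ ?_⟩ <;> simp only [Pi.smul_apply, smul_eq_mul]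
    · rw [h1]; ring
    · rw [h2]; ring
    · rw [h3]; ring
    · rw [h4]
    · linear_combination s * h5 x y z u

/-- The real module `[S⁴E]` inside the four-tensors on `V`, under `V ⊗ ℂ = E ⊗ H`, where `E` is
`V` with the complex structure `I = A 0` and quaternionic structure map `J = A 1`: a symmetric
complex quadrilinear form `s` on `E` that is real with respect to the structure map is embedded as
`s ⊗ ω_H ⊗ ω_H`, the two factors `ω_H` pairing the slots `1,2` and `3,4`; a vector `x` of `V`
corresponds to `x ⊗ h + J x ⊗ h'` for a basis `h, h'` of `H` with `ω_H(h, h') = 1`. -/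
def S4E (A : Fin 3 → V →L[ℝ] V) : Submodule ℝ (Tensor4 V) where
  carrier := {R | ∃ s : MultilinearMap ℝ (fun _ : Fin 4 ↦ V) ℂ,
    (∀ (σ : Equiv.Perm (Fin 4)) (v : Fin 4 → V), s (fun i ↦ v (σ i)) = s v) ∧
    (∀ x y z u, s ![A 0 x, y, z, u] = Complex.I * s ![x, y, z, u]) ∧
    (∀ x y z u, s ![A 1 x, A 1 y, A 1 z, A 1 u] = conj (s ![x, y, z, u])) ∧
    ∀ x y z u, (R x y z u : ℂ) =
      s ![x, A 1 y, z, A 1 u] - s ![x, A 1 y, A 1 z, u]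
        - s ![A 1 x, y, z, A 1 u] + s ![A 1 x, y, A 1 z, u]}
  add_mem' := by
    rintro R R' ⟨s, h1, h2, h3, h4⟩ ⟨s', k1, k2, k3, k4⟩
    refine ⟨s + s', fun σ v ↦ ?_, fun x y z u ↦ ?_, fun x y z u ↦ ?_, fun x y z u ↦ ?_⟩ <;>
      simp only [add_apply]
    · rw [h1, k1]
    · rw [h2, k2]; ring
    · rw [h3, k3, map_add]
    · rw [Pi.add_apply, Pi.add_apply, Pi.add_apply, Pi.add_apply, Complex.ofReal_add, h4, k4]
      ring
  zero_mem' := ⟨0, by simp, by simp, by simp, by simp⟩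
  smul_mem' := by
    rintro t R ⟨s, h1, h2, h3, h4⟩
    refine ⟨t • s, fun σ v ↦ ?_, fun x y z u ↦ ?_, fun x y z u ↦ ?_, fun x y z u ↦ ?_⟩ <;>
      simp only [smul_apply, Complex.real_smul]
    · rw [h1]
    · rw [h2]; ring
    · rw [h3, map_mul, Complex.conj_ofReal]
    · simp only [Pi.smul_apply, smul_eq_mul, Complex.ofReal_mul, h4]
      ring

/-- The trivial summand `ℝ_a = ℝ (π₂ + 6 π₁)` of `𝓡`. -/
def Ra (A : Fin 3 → V →L[ℝ] V) : Submodule ℝ (Tensor4 V) :=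
  Submodule.span ℝ {pi₂ A + (6 : ℝ) • pi₁ V}

/-- The trivial summand `ℝ_b = ℝ (π₂ - 6 π₁)` of `𝓡`. -/
def Rb (A : Fin 3 → V →L[ℝ] V) : Submodule ℝ (Tensor4 V) :=
  Submodule.span ℝ {pi₂ A - (6 : ℝ) • pi₁ V}

/-- The projection `4 π_{1es}(a) = 3 a - ∑_A A₍₃₎A₍₄₎ a` of `Λ² ⊗ Λ²` onto `Λ² ⊗ Λ²E S²H`. -/
def pi1es (A : Fin 3 → V →L[ℝ] V) : Tensor4 V →ₗ[ℝ] Tensor4 V where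
  toFun T := fun x y z u ↦ (1 / 4 : ℝ) * (3 * T x y z u - ∑ a, T x y (A a z) (A a u))
  map_add' T S := by
    ext x y z u
    simp only [Pi.add_apply, Finset.sum_add_distrib]
    ring
  map_smul' t T := by
    ext x y z u
    simp only [Pi.smul_apply, smul_eq_mul, ← Finset.mul_sum, RingHom.id_apply]
    ring

variable [FiniteDimensional ℝ V]

/-- Inner product of two-forms, `⟨b, c⟩ = (1/2!) b(e_i, e_j) c(e_i, e_j)`. -/
def formInner (b c : V → V → ℝ) : ℝ :=
  (1 / 2 : ℝ) * ∑ i, ∑ j, b (stdOrthonormalBasis ℝ V i) (stdOrthonormalBasis ℝ V j)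
    * c (stdOrthonormalBasis ℝ V i) (stdOrthonormalBasis ℝ V j)

/-- The projection `π_{1s}` of `Λ² ⊗ Λ²` onto `Λ² ⊗ S²H`, where `S²H = span {ω_I, ω_J, ω_K}` and
`⟨ω_A, ω_A⟩ = 2n` in the inner product of two-forms. -/
def pi1s (n : ℕ) (A : Fin 3 → V →L[ℝ] V) : Tensor4 V →ₗ[ℝ] Tensor4 V where
  toFun T := fun x y z u ↦
    (1 / (2 * n) : ℝ) * ∑ a, formInner (T x y) (kahlerForm (A a)) * kahlerForm (A a) z u
  map_add' T S := by
    ext x y z u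
    simp only [Pi.add_apply, formInner, add_mul, Finset.sum_add_distrib, mul_add]
  map_smul' t T := by
    ext x y z u
    simp only [Pi.smul_apply, smul_eq_mul, formInner, RingHom.id_apply, Finset.mul_sum,
      Finset.sum_mul]
    refine Finset.sum_congr rfl fun a _ ↦ Finset.sum_congr rfl fun i _ ↦
      Finset.sum_congr rfl fun j _ ↦ by ring

/-- `𝓠𝓚 = 𝓡 ∩ ker (π_{1es} - π_{1s})`, the space of curvature tensors `R` in `𝓡` with all
`R(x, y, ·, ·)` having zero component in `Λ₀²E S²H`. -/
def QK (n : ℕ) (A : Fin 3 → V →L[ℝ] V) : Submodule ℝ (Tensor4 V) :=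
  curvatureTensors V ⊓ LinearMap.ker (pi1es A - pi1s n A)

/-- Inner product of four-tensors (full contraction). -/
def tensorInner (T S : Tensor4 V) : ℝ :=
  ∑ i, ∑ j, ∑ k, ∑ l,
    T (stdOrthonormalBasis ℝ V i) (stdOrthonormalBasis ℝ V j) (stdOrthonormalBasis ℝ V k)
        (stdOrthonormalBasis ℝ V l)
      * S (stdOrthonormalBasis ℝ V i) (stdOrthonormalBasis ℝ V j) (stdOrthonormalBasis ℝ V k)
        (stdOrthonormalBasis ℝ V l)

/-- `P` is the orthogonal projection of `R` on `W`. -/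
def IsOrthogonalProjection (W : Submodule ℝ (Tensor4 V)) (R P : Tensor4 V) : Prop :=
  P ∈ W ∧ ∀ T ∈ W, tensorInner (R - P) T = 0

/-- Ricci tensor `Ric(x, y) = R(x, e_i, y, e_i)`. -/
def ricci (R : Tensor4 V) (x y : V) : ℝ :=
  ∑ i, R x (stdOrthonormalBasis ℝ V i) y (stdOrthonormalBasis ℝ V i)

/-- `Ric*_A(x, y) = R(x, e_i, A y, A e_i)`. -/
def starRicci (A : V →L[ℝ] V) (R : Tensor4 V) (x y : V) : ℝ :=
  ∑ i, R x (stdOrthonormalBasis ℝ V i) (A y) (A (stdOrthonormalBasis ℝ V i))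

/-- The q-Ricci tensor `Ric^q = ∑_A Ric*_A`. -/
def qRicci (A : Fin 3 → V →L[ℝ] V) (R : Tensor4 V) (x y : V) : ℝ :=
  ∑ a, starRicci (A a) R x y

end Algebra

/-! ### The Levi-Civita connection -/

section LeviCivita

variable {E : Type*} [NormedAddCommGroup E] [NormedSpace ℝ E] [FiniteDimensional ℝ E]
  {H : Type*} [TopologicalSpace H] (I : ModelWithCorners ℝ E H)
  {M : Type*} [TopologicalSpace M] [ChartedSpace H M] [IsManifold I 2 M]
  [RiemannianBundle (fun x : M ↦ TangentSpace I x)]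

/-- Half the right-hand side of the Koszul formula for `⟨∇_X Y, Z⟩` at `x`. -/
def koszul (X Y Z : Π x : M, TangentSpace I x) (x : M) : ℝ :=
  (1 / 2 : ℝ) * (mvfderiv I (fun y ↦ inner ℝ (Y y) (Z y)) x (X x)
    + mvfderiv I (fun y ↦ inner ℝ (X y) (Z y)) x (Y x)
    - mvfderiv I (fun y ↦ inner ℝ (X y) (Y y)) x (Z x)
    + inner ℝ (mlieBracket I X Y x) (Z x)
    - inner ℝ (mlieBracket I X Z x) (Y x)
    - inner ℝ (mlieBracket I Y Z x) (X x))

variable [IsContMDiffRiemannianBundle I 1 E (fun x : M ↦ TangentSpace I x)]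

theorem mdiffAt_inner {X Y : Π x : M, TangentSpace I x} {x : M}
    (hX : MDiffAt (T% X) x) (hY : MDiffAt (T% Y) x) :
    MDiffAt (fun y ↦ inner ℝ (X y) (Y y)) x :=
  MDifferentiableAt.inner_bundle (F := E) (E := fun x : M ↦ TangentSpace I x)
    (IB := I) (b := fun y ↦ y) hX hY

theorem koszul_tensorial₁ {Y Z : Π x : M, TangentSpace I x} {x : M}
    (hY : MDiffAt (T% Y) x) (hZ : MDiffAt (T% Z) x) :
    TensorialAt I E (fun X ↦ koszul I X Y Z x) x where
  smul {f X} hf hX := by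
    have e1 : (fun y ↦ inner ℝ ((f • X) y) (Z y)) = f * fun y ↦ inner ℝ (X y) (Z y) := by
      ext y; simp [inner_smul_left]
    have e2 : (fun y ↦ inner ℝ ((f • X) y) (Y y)) = f * fun y ↦ inner ℝ (X y) (Y y) := by
      ext y; simp [inner_smul_left]
    simp only [koszul, e1, e2]
    rw [mvfderiv_mul hf (mdiffAt_inner I hX hZ), mvfderiv_mul hf (mdiffAt_inner I hX hY),
      mlieBracket_smul_left hf hX, mlieBracket_smul_left hf hX]
    simp [inner_add_left, inner_smul_left, inner_smul_right, real_inner_comm]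
    ring
  add {X X'} hX hX' := by
    have e1 (Z : Π x : M, TangentSpace I x) : (fun y ↦ inner ℝ ((X + X') y) (Z y)) =
      (fun y ↦ inner ℝ (X y) (Z y)) + fun y ↦ inner ℝ (X' y) (Z y) := by
      ext y; simp [inner_add_left]
    simp only [koszul, e1]
    rw [mvfderiv_add (mdiffAt_inner I hX hZ) (mdiffAt_inner I hX' hZ),
      mvfderiv_add (mdiffAt_inner I hX hY) (mdiffAt_inner I hX' hY),
      mlieBracket_add_left hX hX', mlieBracket_add_left hX hX']
    simp [inner_add_left, inner_add_right]
    ring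

theorem koszul_tensorial₃ {X Y : Π x : M, TangentSpace I x} {x : M}
    (hX : MDiffAt (T% X) x) (hY : MDiffAt (T% Y) x) :
    TensorialAt I E (fun Z ↦ koszul I X Y Z x) x where
  smul {f Z} hf hZ := by
    have e1 (X : Π x : M, TangentSpace I x) :
        (fun y ↦ inner ℝ (X y) ((f • Z) y)) = f * fun y ↦ inner ℝ (X y) (Z y) := by
      ext y; simp [inner_smul_right]
    simp only [koszul, e1]
    rw [mvfderiv_mul hf (mdiffAt_inner I hX hZ), mvfderiv_mul hf (mdiffAt_inner I hY hZ),
      mlieBracket_smul_right hf hZ, mlieBracket_smul_right hf hZ]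
    simp [inner_add_left, inner_smul_left, inner_smul_right, real_inner_comm]
    ring
  add {Z Z'} hZ hZ' := by
    have e1 (X : Π x : M, TangentSpace I x) : (fun y ↦ inner ℝ (X y) ((Z + Z') y)) =
      (fun y ↦ inner ℝ (X y) (Z y)) + fun y ↦ inner ℝ (X y) (Z' y) := by
      ext y; simp [inner_add_right]
    simp only [koszul, e1]
    rw [mvfderiv_add (mdiffAt_inner I hX hZ) (mdiffAt_inner I hX hZ'),
      mvfderiv_add (mdiffAt_inner I hY hZ) (mdiffAt_inner I hY hZ'),
      mlieBracket_add_right hZ hZ', mlieBracket_add_right hZ hZ']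
    simp [inner_add_left, inner_add_right]
    ring

theorem koszul_add₂ {X Y Y' Z : Π x : M, TangentSpace I x} {x : M}
    (hX : MDiffAt (T% X) x) (hY : MDiffAt (T% Y) x) (hY' : MDiffAt (T% Y') x)
    (hZ : MDiffAt (T% Z) x) :
    koszul I X (Y + Y') Z x = koszul I X Y Z x + koszul I X Y' Z x := by
  have e1 (Z : Π x : M, TangentSpace I x) : (fun y ↦ inner ℝ ((Y + Y') y) (Z y)) =
      (fun y ↦ inner ℝ (Y y) (Z y)) + fun y ↦ inner ℝ (Y' y) (Z y) := by
    ext y; simp [inner_add_left]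
  have e2 (Z : Π x : M, TangentSpace I x) : (fun y ↦ inner ℝ (Z y) ((Y + Y') y)) =
      (fun y ↦ inner ℝ (Z y) (Y y)) + fun y ↦ inner ℝ (Z y) (Y' y) := by
    ext y; simp [inner_add_right]
  simp only [koszul, e1, e2]
  rw [mvfderiv_add (mdiffAt_inner I hY hZ) (mdiffAt_inner I hY' hZ),
    mvfderiv_add (mdiffAt_inner I hX hY) (mdiffAt_inner I hX hY'),
    mlieBracket_add_left hY hY', mlieBracket_add_right hY hY']
  simp [inner_add_left, inner_add_right]
  ring

theorem koszul_smul₂ {X Y Z : Π x : M, TangentSpace I x} {f : M → ℝ} {x : M}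
    (hX : MDiffAt (T% X) x) (hY : MDiffAt (T% Y) x) (hZ : MDiffAt (T% Z) x) (hf : MDiffAt f x) :
    koszul I X (f • Y) Z x =
      f x * koszul I X Y Z x + mvfderiv I f x (X x) * inner ℝ (Y x) (Z x) := by
  have e1 (Z : Π x : M, TangentSpace I x) : (fun y ↦ inner ℝ ((f • Y) y) (Z y)) =
      f * fun y ↦ inner ℝ (Y y) (Z y) := by
    ext y; simp [inner_smul_left]
  have e2 (Z : Π x : M, TangentSpace I x) : (fun y ↦ inner ℝ (Z y) ((f • Y) y)) =
      f * fun y ↦ inner ℝ (Z y) (Y y) := by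
    ext y; simp [inner_smul_right]
  simp only [koszul, e1, e2]
  rw [mvfderiv_mul hf (mdiffAt_inner I hY hZ), mvfderiv_mul hf (mdiffAt_inner I hX hY),
    mlieBracket_smul_left hf hY, mlieBracket_smul_right hf hY]
  simp [inner_add_left, inner_smul_left, inner_smul_right, real_inner_comm]
  ring

open Classical in
/-- The Levi-Civita connection, defined by the Koszul formula. (On vector fields that are not
differentiable at `x` it takes the junk value `0`.) -/
def leviCivitaFun (Y : Π x : M, TangentSpace I x) (x : M) :
    TangentSpace I x →L[ℝ] TangentSpace I x :=
  haveI : FiniteDimensional ℝ (TangentSpace I x) := inferInstanceAs (FiniteDimensional ℝ E)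
  haveI : CompleteSpace (TangentSpace I x) := FiniteDimensional.complete ℝ _
  if hY : MDiffAt (T% Y) x then
    LinearMap.toContinuousLinearMap
      { toFun := fun v ↦ (InnerProductSpace.toDual ℝ (TangentSpace I x)).symm
          (TensorialAt.mkHom₂ (fun X Z ↦ koszul I X Y Z x) x
            (fun _ hZ ↦ koszul_tensorial₁ I hY hZ) (fun _ hX ↦ koszul_tensorial₃ I hX hY) v)
        map_add' := fun v w ↦ by simp
        map_smul' := fun a v ↦ by simp }
  else 0

theorem inner_leviCivitaFun {X Y Z : Π x : M, TangentSpace I x} {x : M}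
    (hX : MDiffAt (T% X) x) (hY : MDiffAt (T% Y) x) (hZ : MDiffAt (T% Z) x) :
    inner ℝ (leviCivitaFun I Y x (X x)) (Z x) = koszul I X Y Z x := by
  have : FiniteDimensional ℝ (TangentSpace I x) := inferInstanceAs (FiniteDimensional ℝ E)
  have : CompleteSpace (TangentSpace I x) := FiniteDimensional.complete ℝ _
  rw [leviCivitaFun, dif_pos hY]
  have h := TensorialAt.mkHom₂_apply (Φ := fun X Z ↦ koszul I X Y Z x) (x := x)
    (fun _ hZ ↦ koszul_tensorial₁ I hY hZ) (fun _ hX ↦ koszul_tensorial₃ I hX hY) hX hZ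
  simpa using h

/-- The Levi-Civita connection of a Riemannian manifold. -/
def leviCivita : CovariantDerivative I E (fun x : M ↦ TangentSpace I x) where
  toFun := leviCivitaFun I
  isCovariantDerivativeOnUniv :=
    { add := by
        intro Y Y' x hY hY' _
        ext v
        refine ext_inner_right ℝ fun w ↦ ?_
        have hX := FiberBundle.mdifferentiableAt_extend I E (V := fun x : M ↦ TangentSpace I x) v
        have hZ := FiberBundle.mdifferentiableAt_extend I E (V := fun x : M ↦ TangentSpace I x) w
        have h := koszul_add₂ I hX hY hY' hZ
        rw [← inner_leviCivitaFun I hX hY hZ, ← inner_leviCivitaFun I hX hY' hZ,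
          ← inner_leviCivitaFun I hX (mdifferentiableAt_add_section hY hY') hZ] at h
        simpa [inner_add_left] using h
      leibniz := by
        intro Y f x hY hf _
        ext v
        refine ext_inner_right ℝ fun w ↦ ?_
        have hX := FiberBundle.mdifferentiableAt_extend I E (V := fun x : M ↦ TangentSpace I x) v
        have hZ := FiberBundle.mdifferentiableAt_extend I E (V := fun x : M ↦ TangentSpace I x) w
        have h := koszul_smul₂ I hX hY hZ hf
        rw [← inner_leviCivitaFun I hX hY hZ,
          ← inner_leviCivitaFun I hX (hf.smul_section hY) hZ] at h
        simpa [inner_add_left, inner_smul_left] using h }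

theorem leviCivita_torsion : (leviCivita I (M := M)).torsion = 0 := by
  rw [CovariantDerivative.torsion_eq_zero_iff]
  intro X Y x hX hY
  refine ext_inner_right ℝ fun w ↦ ?_
  have hZ := FiberBundle.mdifferentiableAt_extend I E (V := fun x : M ↦ TangentSpace I x) w
  have h1 := inner_leviCivitaFun I hX hY hZ
  have h2 := inner_leviCivitaFun I hY hX hZ
  simp only [koszul, FiberBundle.extend_apply_self] at h1 h2
  change inner ℝ (leviCivitaFun I Y x (X x) - leviCivitaFun I X x (Y x)) w = _
  rw [inner_sub_left, h1, h2, mlieBracket_swap_apply (V := Y) (W := X)]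
  simp only [real_inner_comm, inner_neg_left]
  ring

theorem leviCivita_metric {X Y Z : Π x : M, TangentSpace I x} {x : M}
    (hX : MDiffAt (T% X) x) (hY : MDiffAt (T% Y) x) (hZ : MDiffAt (T% Z) x) :
    mvfderiv I (fun y ↦ inner ℝ (Y y) (Z y)) x (X x) =
      inner ℝ (leviCivita I Y x (X x)) (Z x) + inner ℝ (Y x) (leviCivita I Z x (X x)) := by
  have h1 := inner_leviCivitaFun I hX hY hZ
  have h2 := inner_leviCivitaFun I hX hZ hY
  change _ = inner ℝ (leviCivitaFun I Y x (X x)) (Z x) + inner ℝ (Y x) (leviCivitaFun I Z x (X x))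
  rw [h1, real_inner_comm, h2]
  simp only [koszul]
  rw [mlieBracket_swap_apply (V := Z) (W := Y)]
  rw [show (fun y ↦ inner ℝ (Z y) (Y y)) = (fun y ↦ inner ℝ (Y y) (Z y)) from
    funext fun y ↦ real_inner_comm _ _]
  simp only [inner_neg_left]
  ring

end LeviCivita

/-! ### Curvature and quaternionic Kähler manifolds -/

section Geometry

variable {E : Type*} [NormedAddCommGroup E] [NormedSpace ℝ E] [FiniteDimensional ℝ E]
  {H : Type*} [TopologicalSpace H] (I : ModelWithCorners ℝ E H)
  {M : Type*} [TopologicalSpace M] [ChartedSpace H M] [IsManifold I ∞ M]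
  [RiemannianBundle (fun x : M ↦ TangentSpace I x)]
  [IsContMDiffRiemannianBundle I ∞ E (fun x : M ↦ TangentSpace I x)]

instance instFiniteDimensionalTangent (x : M) : FiniteDimensional ℝ (TangentSpace I x) :=
  inferInstanceAs (FiniteDimensional ℝ E)

/-- The Riemannian curvature `(0,4)`-tensor
`R(X,Y,Z,W) = ⟨∇_[X,Y] Z - ∇_X ∇_Y Z + ∇_Y ∇_X Z, W⟩`, computed on local smooth extensions of the
given tangent vectors. The sign is the one for which `R(X,Y,X,Y)` is a positive multiple of the
sectional curvature. -/
def curvature (x : M) : Tensor4 (TangentSpace I x) := fun X Y Z W ↦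
  let X' : Π y : M, TangentSpace I y := FiberBundle.extend E X
  let Y' : Π y : M, TangentSpace I y := FiberBundle.extend E Y
  let Z' : Π y : M, TangentSpace I y := FiberBundle.extend E Z
  inner ℝ (leviCivita I Z' x (mlieBracket I X' Y' x)
    - leviCivita I (fun y ↦ leviCivita I Z' y (Y' y)) x X
    + leviCivita I (fun y ↦ leviCivita I Z' y (X' y)) x Y) W

/-- The covariant derivative `(∇_X A) Y = ∇_X (A Y) - A ∇_X Y` of a field of endomorphisms. -/
def covDerivEnd (A : Π x : M, TangentSpace I x →L[ℝ] TangentSpace I x) (x : M)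
    (X Y : TangentSpace I x) : TangentSpace I x :=
  let Y' : Π y : M, TangentSpace I y := FiberBundle.extend E Y
  leviCivita I (fun y ↦ A y (Y' y)) x X - A x (leviCivita I Y' x X)

/-- The covariant derivative `(∇_X b)(Y, Z) = X (b(Y, Z)) - b(∇_X Y, Z) - b(Y, ∇_X Z)`. -/
def covDerivForm (b : Π x : M, TangentSpace I x → TangentSpace I x → ℝ) (x : M)
    (X Y Z : TangentSpace I x) : ℝ :=
  let Y' : Π y : M, TangentSpace I y := FiberBundle.extend E Y
  let Z' : Π y : M, TangentSpace I y := FiberBundle.extend E Z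
  mvfderiv I (fun y ↦ b y (Y' y) (Z' y)) x X
    - b x (leviCivita I Y' x X) Z - b x Y (leviCivita I Z' x X)

/-- The exterior derivative `dμ(X, Y) = X (μ(Y)) - Y (μ(X)) - μ([X, Y])` of a one-form. -/
def extDeriv₁ (μ : Π x : M, TangentSpace I x → ℝ) (x : M) (X Y : TangentSpace I x) : ℝ :=
  let X' : Π y : M, TangentSpace I y := FiberBundle.extend E X
  let Y' : Π y : M, TangentSpace I y := FiberBundle.extend E Y
  mvfderiv I (fun y ↦ μ y (Y' y)) x X - mvfderiv I (fun y ↦ μ y (X' y)) x Y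
    - μ x (mlieBracket I X' Y' x)

/-- The one-forms `λ_I(X) = (1/2n) ⟨∇_X ω_J, ω_K⟩`, and cyclically. -/
def lam (n : ℕ) (A : Fin 3 → Π x : M, TangentSpace I x →L[ℝ] TangentSpace I x) (a : Fin 3) (x : M)
    (X : TangentSpace I x) : ℝ :=
  (1 / (2 * n) : ℝ) *
    formInner (covDerivForm I (fun y ↦ kahlerForm (A (a + 1) y)) x X) (kahlerForm (A (a + 2) x))

/-- The two-forms `γ_I = dλ_I + λ_J ∧ λ_K`, and cyclically. -/
def gam (n : ℕ) (A : Fin 3 → Π x : M, TangentSpace I x →L[ℝ] TangentSpace I x) (a : Fin 3) (x : M)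
    (X Y : TangentSpace I x) : ℝ :=
  extDeriv₁ I (lam I n A a) x X Y
    + (lam I n A (a + 1) x X * lam I n A (a + 2) x Y
      - lam I n A (a + 1) x Y * lam I n A (a + 2) x X)

/-- `A = (I, J, K)` is a smooth local adapted basis on the open set `U` for the family `G` of
subspaces of the endomorphism bundle. -/
structure IsLocalAdaptedBasis
    (G : Π x : M, Submodule ℝ (TangentSpace I x →L[ℝ] TangentSpace I x)) (U : Set M)
    (A : Fin 3 → Π x : M, TangentSpace I x →L[ℝ] TangentSpace I x) : Prop where
  isOpen : IsOpen U
  smooth : ∀ a, ContMDiffOn I (I.prod 𝓘(ℝ, E →L[ℝ] E)) ∞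
    (fun x ↦ TotalSpace.mk' (E →L[ℝ] E)
      (E := fun x : M ↦ TangentSpace I x →L[ℝ] TangentSpace I x) x (A a x)) U
  adapted : ∀ x ∈ U, IsAdaptedBasis (G x) (fun a ↦ A a x)

/-- `G` is (the rank-three bundle of) an almost quaternion-Hermitian structure: it has a smooth
local adapted basis near each point. -/
def IsAlmostQuaternionHermitian
    (G : Π x : M, Submodule ℝ (TangentSpace I x →L[ℝ] TangentSpace I x)) : Prop :=
  ∀ x : M, ∃ U A, x ∈ U ∧ IsLocalAdaptedBasis I G U A

/-- `G` is a quaternionic Kähler structure: an almost quaternion-Hermitian structure for which the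
Levi-Civita connection is an `Sp(n)Sp(1)`-connection, that is, near each point there are a local
adapted basis and one-forms `μ` with `∇_X I = μ_K(X) J - μ_J(X) K`, and cyclically. -/
def IsQuaternionicKahler
    (G : Π x : M, Submodule ℝ (TangentSpace I x →L[ℝ] TangentSpace I x)) : Prop :=
  IsAlmostQuaternionHermitian I G ∧
  ∀ x : M, ∃ U A, x ∈ U ∧ IsLocalAdaptedBasis I G U A ∧
    ∃ μ : Fin 3 → Π y : M, TangentSpace I y →L[ℝ] ℝ, ∀ y ∈ U, ∀ a X Y,
      covDerivEnd I (A a) y X Y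
        = μ (a + 2) y X • A (a + 1) y Y - μ (a + 1) y X • A (a + 2) y Y

/-- The field `T` of bilinear forms is an Einstein tensor on `U`: it is a locally constant multiple
of the metric (a constant multiple, on a connected set `U`). -/
def IsEinsteinOn (T : Π x : M, TangentSpace I x → TangentSpace I x → ℝ) (U : Set M) : Prop :=
  ∃ μ : M → ℝ, IsLocallyConstant (U.domRestrict μ) ∧
    ∀ x ∈ U, ∀ X Y : TangentSpace I x, T x X Y = μ x * inner ℝ X Y

end Geometry

end

end AQH

open AQH

/-!
Write `A 0, A 1, A 2 = I, J, K` for an adapted basis and read indices cyclically, modulo three.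

*The connection.* The Levi-Civita connection preserves the bundle `G`, and differentiating
`A_a A_b + A_b A_a = -2 δ_ab` shows that `∇_X` acts on `G` as a derivation of the quaternions. Hence
for *every* local adapted basis `∇I = λ_K J - λ_J K`, and cyclically, with the one-forms `λ` of the
statement (`IsQuaternionicKahler.covDerivEnd_eq`). A second derivative gives
`[R(X, Y), I] = -γ_K(X, Y) J + γ_J(X, Y) K`, that is,
`R(X, Y, IZ, IW) = R(X, Y, Z, W) - γ_J(X, Y) ω_J(Z, W) - γ_K(X, Y) ω_K(Z, W)`
(`IsQuaternionicKahler.isQKType`). Everything about Ricci tensors is linear algebra from here on,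
for algebraic curvature tensors `T` of this shape (`IsQKType`).

*Einstein.* Contracting this identity, and then using the first Bianchi identity, expresses the
Ricci tensor through the three forms,
`Ric(x, y) = -n γ_I(x, Iy) - γ_J(x, Jy) - γ_K(x, Ky)`, and cyclically (`IsQKType.ricci_eq`). For
`n > 1` the three equations force `γ_I(x, Iy) = γ_J(x, Jy) = γ_K(x, Ky)`, so
`(n + 2) γ_A(x, y) = Ric(x, Ay)` (`IsQKType.eq_ricci`). Comparing `T(Ix, Iy, z, w)` with
`T(x, y, Iz, Iw)` by the pair symmetry yields `γ_A = c ω_A` with one constant `c`, whence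
`Ric = (n + 2) c g` (`IsQKType.exists_const`) and `Ric*_A = n c g` (`IsQKType.starRicci_eq`).

*Local constancy.* The forms `γ_I = dλ_I + λ_J ∧ λ_K` satisfy
`dγ_I = γ_J ∧ λ_K - λ_J ∧ γ_K`, while the formula for `∇I` gives
`dω_I = ω_J ∧ λ_K - λ_J ∧ ω_K`. With `γ_A = c ω_A` this leaves `dc ∧ ω_A = 0`
(`IsQuaternionicKahler.cyclic_mvfderiv_eq_zero`), hence `dc = 0`.

*The decomposition.* The tensor `π₂ + 2 π₁` has the same shape, with `γ_A = 8 ω_A`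
(`model_isQKType`). So `T - (c / 8) (π₂ + 2 π₁)` has `γ = 0`: as an endomorphism-valued two-form it
commutes with `I, J, K`, and it is Ricci flat, which makes it orthogonal to `π₁` and `π₂`
(`tensorInner_eq_zero`). Such a tensor is the image of an explicit quartic form `quartic A T`, total
symmetry of which is the first Bianchi identity; this is membership in `S⁴E` (`mem_S4E`).
Conversely the elements of `S⁴E` are curvature tensors with `γ = 0`, and the condition defining
`𝓠𝓚` is the shape above. Thus `𝓠𝓚 = S⁴E ⊕ ℝ (π₂ + 2 π₁)` (`S4E_sup_model_eq_QK`).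

*Analytic preliminaries.* Curvature is defined on particular extensions of tangent vectors. That
any smooth extensions may be used (`curvature_apply`) follows from its symmetries alone: being
skew in its last two slots makes it tensorial in the third, and the pair symmetry moves every slot
there. Smoothness of `∇_X Y` comes from the Koszul formula and Cramer's rule for the Gram matrix of
a local frame (`contMDiffAt_section_of_inner`).
-/

namespace AQH

/-! ### Adapted bases and contractions -/

section Algebra

variable {V : Type*} [NormedAddCommGroup V] [InnerProductSpace ℝ V]

namespace IsAdaptedBasis

variable {G : Submodule ℝ (V →L[ℝ] V)} {A : Fin 3 → V →L[ℝ] V}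

theorem sq_aux (h : IsAdaptedBasis G A) (x : V) :
    A 0 (A 0 x) = -x ∧ A 1 (A 1 x) = -x ∧ A 0 (A 1 x) = A 2 x ∧ A 1 (A 0 x) = -A 2 x :=
  ⟨DFunLike.congr_fun h.sq_I x, DFunLike.congr_fun h.sq_J x, DFunLike.congr_fun h.mul_IJ x,
    DFunLike.congr_fun h.mul_JI x⟩

theorem apply_self (h : IsAdaptedBasis G A) (a : Fin 3) (x : V) : A a (A a x) = -x := by
  have h0 (x) := (h.sq_aux x).1
  have h1 (x) := (h.sq_aux x).2.1
  have h2 (x) := (h.sq_aux x).2.2.1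
  have h3 (x) := (h.sq_aux x).2.2.2
  fin_cases a
  · exact h0 x
  · exact h1 x
  · change A 2 (A 2 x) = -x
    have e : A 1 (A 2 x) = A 0 x := by
      rw [← h2 x, h3, ← h2, h1]
      simp
    rw [← h2 (A 2 x), e, h0]

theorem apply_succ (h : IsAdaptedBasis G A) (a : Fin 3) (x : V) :
    A a (A (a + 1) x) = A (a + 2) x := by
  have h0 (x) := (h.sq_aux x).1
  have h1 (x) := (h.sq_aux x).2.1
  have h2 (x) := (h.sq_aux x).2.2.1
  have h3 (x) := (h.sq_aux x).2.2.2
  fin_cases a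
  · exact h2 x
  · change A 1 (A 2 x) = A 0 x
    rw [← h2, ← neg_neg (A 1 _), h3, ← h2, h1]
    simp
  · change A 2 (A 0 x) = A 1 x
    rw [← h2, h3, map_neg, ← h2, h0, neg_neg]

theorem succ_apply (h : IsAdaptedBasis G A) (a : Fin 3) (x : V) :
    A (a + 1) (A a x) = -A (a + 2) x := by
  rw [← h.apply_succ a, ← neg_neg (A a _), ← neg_neg (A (a + 1) _), neg_inj, neg_neg]
  have h0 (x) := (h.sq_aux x).1
  have h1 (x) := (h.sq_aux x).2.1
  have h2 (x) := (h.sq_aux x).2.2.1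
  have h3 (x) := (h.sq_aux x).2.2.2
  fin_cases a
  · change -A 1 (A 0 x) = A 0 (A 1 x)
    rw [h2, h3, neg_neg]
  · change -A 2 (A 1 x) = A 1 (A 2 x)
    rw [← h2, h1, ← h2, ← neg_neg (A 1 (A 0 _)), h3, ← h2, h1]
    simp
  · change -A 0 (A 2 x) = A 2 (A 0 x)
    rw [← h2, h0, ← h2, h3, map_neg, neg_neg, ← h2, h0, neg_neg]

theorem add_two_apply (h : IsAdaptedBasis G A) (a : Fin 3) (x : V) :
    A (a + 2) (A a x) = A (a + 1) x := by
  have := h.apply_succ (a + 2) x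
  rwa [show a + 2 + 1 = a by fin_cases a <;> rfl,
    show a + 2 + 2 = a + 1 by fin_cases a <;> rfl] at this

theorem apply_add_two (h : IsAdaptedBasis G A) (a : Fin 3) (x : V) :
    A a (A (a + 2) x) = -A (a + 1) x := by
  have := h.succ_apply (a + 2) x
  rwa [show a + 2 + 1 = a by fin_cases a <;> rfl,
    show a + 2 + 2 = a + 1 by fin_cases a <;> rfl] at this

theorem inner_left (h : IsAdaptedBasis G A) (a : Fin 3) (x y : V) :
    inner ℝ (A a x) y = -inner ℝ x (A a y) := by
  rw [← h.isometry a x (A a y), h.apply_self, inner_neg_right, neg_neg]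

theorem inner_apply_self (h : IsAdaptedBasis G A) (a : Fin 3) (x : V) :
    inner ℝ x (A a x) = (0 : ℝ) := by
  have := h.inner_left a x x
  rw [real_inner_comm] at this
  linarith

theorem inner_add_one_add_two (h : IsAdaptedBasis G A) (a : Fin 3) (x : V) :
    inner ℝ (A (a + 1) x) (A (a + 2) x) = (0 : ℝ) := by
  have := h.inner_apply_self a (A (a + 1) x)
  rwa [h.apply_succ] at this

theorem inner_apply_apply (h : IsAdaptedBasis G A) (a b : Fin 3) (x : V) :
    inner ℝ (A a x) (A b x) = if a = b then inner ℝ x x else (0 : ℝ) := by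
  split_ifs with hab
  · rw [hab, h.isometry]
  · have h0 := h.inner_add_one_add_two 0 x
    have h1 := h.inner_add_one_add_two 1 x
    have h2 := h.inner_add_one_add_two 2 x
    change inner ℝ (A 1 x) (A 2 x) = (0 : ℝ) at h0
    change inner ℝ (A 2 x) (A 0 x) = (0 : ℝ) at h1
    change inner ℝ (A 0 x) (A 1 x) = (0 : ℝ) at h2
    fin_cases a <;> fin_cases b <;>
      first | exact absurd rfl hab | assumption | (rw [real_inner_comm]; assumption)

theorem mem (h : IsAdaptedBasis G A) (a : Fin 3) : A a ∈ G := by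
  rw [← h.span_eq]
  exact Submodule.subset_span ⟨a, rfl⟩

theorem mem_iff (h : IsAdaptedBasis G A) {C : V →L[ℝ] V} :
    C ∈ G ↔ ∃ m : Fin 3 → ℝ, C = ∑ b, m b • A b := by
  rw [← h.span_eq, Submodule.mem_span_range_iff_exists_fun]
  exact exists_congr fun m ↦ eq_comm

/-- The coordinates of an element of `G` in the basis `A`, read off from its value on one
vector. -/
theorem inner_sum_apply (h : IsAdaptedBasis G A) (m : Fin 3 → ℝ) (a : Fin 3) (x : V) :
    inner ℝ ((∑ b, m b • A b) x) (A a x) = m a * inner ℝ x x := by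
  simp [sum_inner, inner_smul_left, h.inner_apply_apply]

/-- A derivation of the quaternions maps `I, J, K` to
`g_K J - g_J K, g_I K - g_K I, g_J I - g_I J`. Of the derivation property only the derivative of
`A_a A_b + A_b A_a = -2 δ_ab` is required, and only its quadratic form. -/
theorem exists_of_derivation (h : IsAdaptedBasis G A) (D : Fin 3 → V →L[ℝ] V)
    (hD : ∀ a, D a ∈ G)
    (hder : ∀ a b x, inner ℝ (D a (A b x)) x + inner ℝ (A a (D b x)) x
      + (inner ℝ (D b (A a x)) x + inner ℝ (A b (D a x)) x) = (0 : ℝ)) :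
    ∃ g : Fin 3 → ℝ, ∀ a, D a = g (a + 2) • A (a + 1) - g (a + 1) • A (a + 2) := by
  by_cases hV : ∃ x : V, x ≠ 0
  swap
  · push Not at hV
    exact ⟨0, fun a ↦ by ext x; rw [hV (D a x)]; exact (hV _).symm⟩
  obtain ⟨x, hx⟩ := hV
  choose m hm using fun a ↦ h.mem_iff.1 (hD a)
  have hxx : inner ℝ x x ≠ (0 : ℝ) := inner_self_ne_zero.2 hx
  have key (a b : Fin 3) : m a b + m b a = 0 := by
    have h1 (a b : Fin 3) : inner ℝ (A b (D a x)) x = -(m a b * inner ℝ x x) := by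
      rw [h.inner_left, hm, h.inner_sum_apply]
    have h2 (a b : Fin 3) : inner ℝ (D a (A b x)) x = -(m a b * inner ℝ x x) := by
      have := h.inner_sum_apply (m a) b (A b x)
      rw [← hm, h.apply_self, inner_neg_right, h.isometry] at this
      linarith
    have := hder a b x
    rw [h1, h1, h2, h2] at this
    have h3 : (m a b + m b a) * inner ℝ x x = 0 := by linarith
    exact (mul_eq_zero.1 h3).resolve_right hxx
  refine ⟨fun a ↦ m (a + 1) (a + 2), fun a ↦ ?_⟩
  rw [hm a]
  have k (a) : m a a = 0 := by linarith [key a a]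
  fin_cases a
  · change ∑ b, m 0 b • A b = m 0 1 • A 1 - m 2 0 • A 2
    rw [Fin.sum_univ_three, k 0, show m 2 0 = -m 0 2 by linarith [key 0 2]]
    module
  · change ∑ b, m 1 b • A b = m 1 2 • A 2 - m 0 1 • A 0
    rw [Fin.sum_univ_three, k 1, show m 0 1 = -m 1 0 by linarith [key 0 1]]
    module
  · change ∑ b, m 2 b • A b = m 2 0 • A 0 - m 1 2 • A 1
    rw [Fin.sum_univ_three, k 2, show m 1 2 = -m 2 1 by linarith [key 1 2]]
    module

end IsAdaptedBasis

/-! ### Symmetries and multilinearity of curvature tensors -/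

section Linear

variable {T : Tensor4 V}

theorem curv_antisymm (hT : T ∈ curvatureTensors V) (x y z u : V) : T x y z u = -T y x z u :=
  hT.2.2.1 x y z u

theorem curv_symm (hT : T ∈ curvatureTensors V) (x y z u : V) : T x y z u = T z u x y :=
  hT.2.2.2.1 x y z u

theorem curv_bianchi (hT : T ∈ curvatureTensors V) (x y z u : V) :
    T x y z u + T y z x u + T z x y u = 0 :=
  hT.2.2.2.2 x y z u

theorem curv_antisymm' (hT : T ∈ curvatureTensors V) (x y z u : V) :
    T x y z u = -T x y u z := by
  rw [curv_symm hT, curv_antisymm hT, curv_symm hT u z]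

theorem curv_add₁ (hT : T ∈ curvatureTensors V) (x x' y z u : V) :
    T (x + x') y z u = T x y z u + T x' y z u := hT.1 x x' y z u

theorem curv_smul₁ (hT : T ∈ curvatureTensors V) (t : ℝ) (x y z u : V) :
    T (t • x) y z u = t * T x y z u := hT.2.1 t x y z u

theorem curv_add₂ (hT : T ∈ curvatureTensors V) (x y y' z u : V) :
    T x (y + y') z u = T x y z u + T x y' z u := by
  rw [curv_antisymm hT, curv_add₁ hT, curv_antisymm hT x y, curv_antisymm hT x y']; ring

theorem curv_smul₂ (hT : T ∈ curvatureTensors V) (t : ℝ) (x y z u : V) :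
    T x (t • y) z u = t * T x y z u := by
  rw [curv_antisymm hT, curv_smul₁ hT, curv_antisymm hT x y]; ring

theorem curv_add₃ (hT : T ∈ curvatureTensors V) (x y z z' u : V) :
    T x y (z + z') u = T x y z u + T x y z' u := by
  rw [curv_symm hT, curv_add₁ hT, curv_symm hT x y, curv_symm hT x y]

theorem curv_smul₃ (hT : T ∈ curvatureTensors V) (t : ℝ) (x y z u : V) :
    T x y (t • z) u = t * T x y z u := by
  rw [curv_symm hT, curv_smul₁ hT, curv_symm hT x y]

theorem curv_add₄ (hT : T ∈ curvatureTensors V) (x y z u u' : V) :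
    T x y z (u + u') = T x y z u + T x y z u' := by
  rw [curv_symm hT, curv_add₂ hT, curv_symm hT x y, curv_symm hT x y]

theorem curv_smul₄ (hT : T ∈ curvatureTensors V) (t : ℝ) (x y z u : V) :
    T x y z (t • u) = t * T x y z u := by
  rw [curv_symm hT, curv_smul₂ hT, curv_symm hT x y]

theorem curv_neg₁ (hT : T ∈ curvatureTensors V) (x y z u : V) : T (-x) y z u = -T x y z u := by
  simpa using curv_smul₁ hT (-1) x y z u

theorem curv_neg₂ (hT : T ∈ curvatureTensors V) (x y z u : V) : T x (-y) z u = -T x y z u := by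
  simpa using curv_smul₂ hT (-1) x y z u

theorem curv_neg₃ (hT : T ∈ curvatureTensors V) (x y z u : V) : T x y (-z) u = -T x y z u := by
  simpa using curv_smul₃ hT (-1) x y z u

theorem curv_neg₄ (hT : T ∈ curvatureTensors V) (x y z u : V) : T x y z (-u) = -T x y z u := by
  simpa using curv_smul₄ hT (-1) x y z u

theorem curv_self₁ (hT : T ∈ curvatureTensors V) (x z u : V) : T x x z u = 0 := by
  linarith [curv_antisymm hT x x z u]

end Linear

section Trace

variable [FiniteDimensional ℝ V]

/-- Notation for the orthonormal basis used in the contractions. -/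
local notation "𝐞" => stdOrthonormalBasis ℝ V

theorem sum_mul_inner {f : V → ℝ} (hf : IsLinearMap ℝ f) (v : V) :
    ∑ i, f (𝐞 i) * inner ℝ (𝐞 i) v = f v := by
  conv_rhs => rw [← (𝐞).sum_repr' v]
  have := map_sum hf.mk' (fun i ↦ inner ℝ (𝐞 i) v • 𝐞 i) Finset.univ
  simp only [IsLinearMap.mk'_apply, hf.map_smul, smul_eq_mul] at this
  rw [this]
  exact Finset.sum_congr rfl fun i _ ↦ mul_comm _ _

theorem sum_inner_mul_inner (v w : V) :
    ∑ i, inner ℝ v (𝐞 i) * inner ℝ w (𝐞 i) = (inner ℝ v w : ℝ) := by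
  simp_rw [real_inner_comm (𝐞 _) w]
  exact sum_mul_inner (f := fun x ↦ inner ℝ v x)
    ⟨fun x y ↦ inner_add_right _ _ _, fun c x ↦ real_inner_smul_right _ _ _⟩ w

theorem sum_inner_self : ∑ i, inner ℝ (𝐞 i) (𝐞 i) = (Module.finrank ℝ V : ℝ) := by
  simp

/-- Traces are invariant under an orthogonal complex structure `B`. -/
theorem sum_comp_isometry {f : V → V → ℝ} (hf : ∀ y, IsLinearMap ℝ fun x ↦ f x y)
    (hf' : ∀ x, IsLinearMap ℝ fun y ↦ f x y) {B : V → V}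
    (hB : ∀ x y, inner ℝ (B x) (B y) = (inner ℝ x y : ℝ)) (hBB : ∀ x, B (B x) = -x) :
    ∑ i, f (B (𝐞 i)) (B (𝐞 i)) = ∑ i, f (𝐞 i) (𝐞 i) := by
  have hskew (x y : V) : inner ℝ x (B y) = (-inner ℝ (B x) y : ℝ) := by
    rw [← hB x, hBB, inner_neg_right]
  have h1 (i) : f (B (𝐞 i)) (B (𝐞 i)) =
      ∑ j, ∑ k, f (𝐞 j) (𝐞 k) * (inner ℝ (B (𝐞 j)) (𝐞 i) * inner ℝ (B (𝐞 k)) (𝐞 i)) := by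
    rw [← sum_mul_inner (hf _) (B (𝐞 i))]
    refine Finset.sum_congr rfl fun j _ ↦ ?_
    rw [← sum_mul_inner (hf' _) (B (𝐞 i)), Finset.sum_mul]
    refine Finset.sum_congr rfl fun k _ ↦ ?_
    rw [hskew, hskew]
    ring
  simp_rw [h1]
  rw [Finset.sum_comm]
  refine Finset.sum_congr rfl fun j _ ↦ ?_
  rw [Finset.sum_comm]
  simp_rw [← Finset.mul_sum, sum_inner_mul_inner, hB]
  exact sum_mul_inner (hf' _) (𝐞 j) ▸ Finset.sum_congr rfl fun k _ ↦ by rw [real_inner_comm]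

end Trace

end Algebra

end AQH

namespace AQH

/-! ### Curvature tensors of quaternionic Kähler type are Einstein -/

section Core

variable {V : Type*} [NormedAddCommGroup V] [InnerProductSpace ℝ V]

/-- The tensor `T` is of quaternionic Kähler type with two-forms `γ`: the commutator of the
endomorphism `T(x, y)` with `I` is a combination of `J` and `K` with coefficients
`-γ_K(x, y)` and `γ_J(x, y)`, and cyclically. The identity is expressed through
`T(x, y, I z, I w)`. -/
def IsQKType (A : Fin 3 → V →L[ℝ] V) (T : Tensor4 V) (γ : Fin 3 → V → V → ℝ) : Prop :=
  ∀ a x y z w, T x y (A a z) (A a w) = T x y z w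
    - γ (a + 1) x y * kahlerForm (A (a + 1)) z w - γ (a + 2) x y * kahlerForm (A (a + 2)) z w

theorem fin3_add_one_add_one (a : Fin 3) : a + 1 + 1 = a + 2 := by fin_cases a <;> rfl

theorem fin3_add_one_add_two (a : Fin 3) : a + 1 + 2 = a := by fin_cases a <;> rfl

theorem fin3_add_two_add_one (a : Fin 3) : a + 2 + 1 = a := by fin_cases a <;> rfl

theorem fin3_add_two_add_two (a : Fin 3) : a + 2 + 2 = a + 1 := by fin_cases a <;> rfl

/-- A sum over `I, J, K` may be taken in cyclic order from any of the three. -/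
theorem sum_fin3_cyclic {W : Type*} [AddCommMonoid W] (f : Fin 3 → W) (a : Fin 3) :
    ∑ b, f b = f a + f (a + 1) + f (a + 2) := by
  rw [Fin.sum_univ_three]
  fin_cases a
  · rfl
  · change _ = f 1 + f 2 + f 0
    abel
  · change _ = f 2 + f 0 + f 1
    abel

section Lin

variable {T : Tensor4 V}

theorem curv_isLinearMap₂ (hT : T ∈ curvatureTensors V) (x z u : V) :
    IsLinearMap ℝ fun y ↦ T x y z u :=
  ⟨fun _ _ ↦ curv_add₂ hT _ _ _ _ _, fun _ _ ↦ curv_smul₂ hT _ _ _ _ _⟩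

theorem curv_isLinearMap₃ (hT : T ∈ curvatureTensors V) (x y u : V) :
    IsLinearMap ℝ fun z ↦ T x y z u :=
  ⟨fun _ _ ↦ curv_add₃ hT _ _ _ _ _, fun _ _ ↦ curv_smul₃ hT _ _ _ _ _⟩

theorem curv_isLinearMap₄ (hT : T ∈ curvatureTensors V) (x y z : V) :
    IsLinearMap ℝ fun u ↦ T x y z u :=
  ⟨fun _ _ ↦ curv_add₄ hT _ _ _ _ _, fun _ _ ↦ curv_smul₄ hT _ _ _ _ _⟩

end Lin

variable [FiniteDimensional ℝ V] {G : Submodule ℝ (V →L[ℝ] V)} {A : Fin 3 → V →L[ℝ] V}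
  {T : Tensor4 V} {γ : Fin 3 → V → V → ℝ} {n : ℕ}

local notation "𝐞" => stdOrthonormalBasis ℝ V

theorem ricci_symm (hT : T ∈ curvatureTensors V) (x y : V) : ricci T x y = ricci T y x :=
  Finset.sum_congr rfl fun i _ ↦ curv_symm hT _ _ _ _

theorem ricci_isLinearMap (hT : T ∈ curvatureTensors V) (x : V) :
    IsLinearMap ℝ fun y ↦ ricci T x y := by
  constructor
  · intro y z
    simp [ricci, curv_add₃ hT, Finset.sum_add_distrib]
  · intro c y
    simp [ricci, curv_smul₃ hT, Finset.mul_sum]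

namespace IsQKType

/-- The forms `γ_A` are, up to a factor, the contractions of `T(x, y, ·, ·)` with `ω_A`. -/
theorem sum_apply (hA : IsAdaptedBasis G A) (hT : T ∈ curvatureTensors V) (h : IsQKType A T γ)
    (hV : Module.finrank ℝ V = 4 * n) (a : Fin 3) (x y : V) :
    ∑ i, T x y (𝐞 i) (A a (𝐞 i)) = -(2 * n) * γ a x y := by
  have h1 (e : V) : T x y (A (a + 1) e) (A a (A (a + 1) e)) =
      -T x y e (A a e) - γ a x y * inner ℝ e e := by
    have := h (a + 1) x y e (A a e)
    rw [hA.succ_apply, fin3_add_one_add_one, fin3_add_one_add_two, curv_neg₄ hT] at this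
    rw [hA.apply_succ, ← neg_inj, this, kahlerForm, kahlerForm, hA.add_two_apply,
      hA.inner_apply_self, hA.apply_self, inner_neg_right]
    ring
  have h2 := sum_comp_isometry (f := fun z w ↦ T x y z (A a w))
    (fun w ↦ curv_isLinearMap₃ hT x y _)
    (fun z ↦ ⟨fun _ _ ↦ by rw [map_add, curv_add₄ hT],
      fun _ _ ↦ by rw [map_smul, curv_smul₄ hT, smul_eq_mul]⟩)
    (hA.isometry (a + 1)) (hA.apply_self (a + 1))
  simp only [h1, Finset.sum_sub_distrib, Finset.sum_neg_distrib, ← Finset.mul_sum,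
    sum_inner_self, hV] at h2
  push_cast at h2
  linarith

/-- By the first Bianchi identity the other contraction of `T` with `ω_A` is half of the one in
`IsQKType.sum_apply`. -/
theorem sum_apply' (hA : IsAdaptedBasis G A) (hT : T ∈ curvatureTensors V) (h : IsQKType A T γ)
    (hV : Module.finrank ℝ V = 4 * n) (a : Fin 3) (x y : V) :
    ∑ i, T x (𝐞 i) y (A a (𝐞 i)) = -n * γ a x y := by
  have h1 : ∑ i, T y (𝐞 i) x (A a (𝐞 i)) = -∑ i, T x (𝐞 i) y (A a (𝐞 i)) := by
    rw [← sum_comp_isometry (f := fun z w ↦ T y z x (A a w))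
      (fun w ↦ curv_isLinearMap₂ hT y _ _)
      (fun z ↦ ⟨fun _ _ ↦ by rw [map_add, curv_add₄ hT],
        fun _ _ ↦ by rw [map_smul, curv_smul₄ hT, smul_eq_mul]⟩)
      (hA.isometry a) (hA.apply_self a), ← Finset.sum_neg_distrib]
    refine Finset.sum_congr rfl fun i _ ↦ ?_
    rw [hA.apply_self, curv_neg₄ hT, curv_symm hT]
  have h2 := h.sum_apply hA hT hV a x y
  have h3 : ∑ i, T x y (𝐞 i) (A a (𝐞 i)) =
      ∑ i, T x (𝐞 i) y (A a (𝐞 i)) - ∑ i, T y (𝐞 i) x (A a (𝐞 i)) := by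
    rw [← Finset.sum_sub_distrib]
    refine Finset.sum_congr rfl fun i _ ↦ ?_
    linarith [curv_bianchi hT x y (𝐞 i) (A a (𝐞 i)), curv_antisymm hT x (𝐞 i) y (A a (𝐞 i))]
  linarith

theorem isLinearMap (hA : IsAdaptedBasis G A) (hT : T ∈ curvatureTensors V) (h : IsQKType A T γ)
    (hV : Module.finrank ℝ V = 4 * n) (hn : n ≠ 0) (a : Fin 3) (x : V) :
    IsLinearMap ℝ fun y ↦ γ a x y := by
  have hn' : (-(2 * n) : ℝ) ≠ 0 := by simpa using hn
  constructor
  · intro y z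
    refine mul_left_cancel₀ hn' ?_
    simp_rw [mul_add, ← h.sum_apply hA hT hV, curv_add₂ hT, Finset.sum_add_distrib]
  · intro c y
    refine mul_left_cancel₀ hn' ?_
    rw [smul_eq_mul, mul_left_comm, ← h.sum_apply hA hT hV, ← h.sum_apply hA hT hV,
      Finset.mul_sum]
    exact Finset.sum_congr rfl fun i _ ↦ curv_smul₂ hT _ _ _ _ _

theorem antisymm (hA : IsAdaptedBasis G A) (hT : T ∈ curvatureTensors V) (h : IsQKType A T γ)
    (hV : Module.finrank ℝ V = 4 * n) (hn : n ≠ 0) (a : Fin 3) (x y : V) :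
    γ a x y = -γ a y x := by
  have hn' : (-(2 * n) : ℝ) ≠ 0 := by simpa using hn
  refine mul_left_cancel₀ hn' ?_
  rw [mul_neg, ← h.sum_apply hA hT hV, ← h.sum_apply hA hT hV, ← Finset.sum_neg_distrib]
  exact Finset.sum_congr rfl fun i _ ↦ curv_antisymm hT _ _ _ _

/-- The Ricci tensor through the three forms `γ_A`: contracting the identity of `IsQKType` turns
one side into the Ricci tensor and `T` on the other side into the contraction of
`IsQKType.sum_apply'`. -/
theorem ricci_eq (hA : IsAdaptedBasis G A) (hT : T ∈ curvatureTensors V) (h : IsQKType A T γ)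
    (hV : Module.finrank ℝ V = 4 * n) (hn : n ≠ 0) (a : Fin 3) (x y : V) :
    ricci T x y = -n * γ a x (A a y) - γ (a + 1) x (A (a + 1) y) - γ (a + 2) x (A (a + 2) y) := by
  have key (y : V) : ricci T x (A a y) =
      n * γ a x y + γ (a + 1) x (A (a + 2) y) - γ (a + 2) x (A (a + 1) y) := by
    have h1 (i) : T x (𝐞 i) (A a y) (𝐞 i) = -T x (𝐞 i) y (A a (𝐞 i))
        + γ (a + 1) x (𝐞 i) * inner ℝ (𝐞 i) (A (a + 2) y)
        - γ (a + 2) x (𝐞 i) * inner ℝ (𝐞 i) (A (a + 1) y) := by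
      have := h a x (𝐞 i) y (A a (𝐞 i))
      rw [hA.apply_self, curv_neg₄ hT, kahlerForm, kahlerForm, hA.succ_apply,
        hA.add_two_apply, inner_neg_right] at this
      have e1 := hA.inner_left (a + 2) y (𝐞 i)
      have e2 := hA.inner_left (a + 1) y (𝐞 i)
      rw [real_inner_comm] at e1 e2
      rw [e1, e2]
      linarith
    simp only [ricci, h1, Finset.sum_sub_distrib, Finset.sum_add_distrib,
      Finset.sum_neg_distrib]
    rw [h.sum_apply' hA hT hV, sum_mul_inner (h.isLinearMap hA hT hV hn _ x),
      sum_mul_inner (h.isLinearMap hA hT hV hn _ x)]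
    ring
  have h2 := key (-A a y)
  rw [map_neg, hA.apply_self, neg_neg, map_neg, map_neg, hA.add_two_apply, hA.succ_apply, neg_neg,
    (h.isLinearMap hA hT hV hn _ x).map_neg, (h.isLinearMap hA hT hV hn _ x).map_neg] at h2
  linarith

/-- Here `n > 1` is used: the three forms `γ_A` are determined by the Ricci tensor. -/
theorem eq_ricci (hA : IsAdaptedBasis G A) (hT : T ∈ curvatureTensors V) (h : IsQKType A T γ)
    (hV : Module.finrank ℝ V = 4 * n) (hn : 1 < n) (a : Fin 3) (x y : V) :
    (n + 2) * γ a x y = ricci T x (A a y) := by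
  have hn0 : n ≠ 0 := by omega
  have hn1 : (n : ℝ) - 1 ≠ 0 := sub_ne_zero.2 (by exact_mod_cast hn.ne')
  have key (y : V) : (n + 2) * γ a x (A a y) = -ricci T x y := by
    have e0 := h.ricci_eq hA hT hV hn0 a x y
    have e1 := h.ricci_eq hA hT hV hn0 (a + 1) x y
    have e2 := h.ricci_eq hA hT hV hn0 (a + 2) x y
    rw [fin3_add_one_add_one, fin3_add_one_add_two] at e1
    rw [fin3_add_two_add_one, fin3_add_two_add_two] at e2
    have k1 : γ (a + 1) x (A (a + 1) y) = γ a x (A a y) :=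
      mul_left_cancel₀ hn1 (by linarith)
    have k2 : γ (a + 2) x (A (a + 2) y) = γ a x (A a y) :=
      mul_left_cancel₀ hn1 (by linarith)
    rw [e0, k1, k2]
    ring
  have := key (A a y)
  rw [hA.apply_self, (h.isLinearMap hA hT hV hn0 a x).map_neg] at this
  linarith

/-- A curvature tensor of quaternionic Kähler type is Einstein, and its two-forms `γ_A` are
multiples of the Kähler forms with the same constant: the Ricci tensor is invariant under `I, J, K`,
and the pair symmetry makes the forms `γ_A` proportional to the `ω_A`. -/
theorem exists_const (hA : IsAdaptedBasis G A) (hT : T ∈ curvatureTensors V)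
    (h : IsQKType A T γ) (hV : Module.finrank ℝ V = 4 * n) (hn : 1 < n) :
    ∃ c : ℝ, (∀ a x y, γ a x y = c * kahlerForm (A a) x y) ∧
      ∀ x y, ricci T x y = (n + 2) * c * inner ℝ x y := by
  have hn0 : n ≠ 0 := by omega
  have hn2 : (n + 2 : ℝ) ≠ 0 := by positivity
  have : Nontrivial V := Module.nontrivial_of_finrank_pos (R := ℝ) (by omega)
  obtain ⟨z, hz⟩ := exists_ne (0 : V)
  have hzz : inner ℝ z z ≠ (0 : ℝ) := inner_self_ne_zero.2 hz
  set β : V → V → ℝ := fun x y ↦ ricci T x y / (n + 2) with hβ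
  have hγ (a x y) : γ a x y = β x (A a y) := by
    rw [hβ, eq_div_iff hn2, mul_comm]
    exact h.eq_ricci hA hT hV hn a x y
  have βsymm (x y) : β x y = β y x := by simp only [hβ, ricci_symm hT x y]
  have βneg (x y) : β x (-y) = -β x y := by
    simp only [hβ, (ricci_isLinearMap hT x).map_neg, neg_div]
  have βskew (a x y) : β (A a x) y = -β x (A a y) := by
    rw [βsymm, ← hγ, ← hγ, h.antisymm hA hT hV hn0]
  have βself (a x) : β x (A a x) = 0 := by
    have := βskew a x x
    rw [βsymm] at this
    linarith
  -- Both `T(I x, I y, z, w)` and `T(x, y, I z, I w)` differ from `T(x, y, z, w)` by known terms.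
  -- Evaluating `T(I x, I y, I z, I w)` through either pair relates these terms.
  have key (a : Fin 3) (x y z w : V) :
      γ (a + 1) x y * kahlerForm (A (a + 1)) z w + γ (a + 2) x y * kahlerForm (A (a + 2)) z w =
      γ (a + 1) z w * kahlerForm (A (a + 1)) x y + γ (a + 2) z w * kahlerForm (A (a + 2)) x y := by
    have g1 (x y) : γ (a + 1) (A a x) (A a y) = -γ (a + 1) x y := by
      rw [hγ, hγ, hA.succ_apply, βskew, map_neg, hA.apply_add_two, neg_neg]
    have g2 (x y) : γ (a + 2) (A a x) (A a y) = -γ (a + 2) x y := by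
      rw [hγ, hγ, hA.add_two_apply, βskew, hA.apply_succ]
    have e1 := h a (A a x) (A a y) z w
    have e2 := h a (A a z) (A a w) x y
    have e3 := h a x y z w
    have e4 := h a z w x y
    rw [g1, g2] at e1 e2
    rw [curv_symm hT (A a x) (A a y) z w] at e1
    rw [curv_symm hT (A a z) (A a w) x y] at e2
    rw [curv_symm hT (A a z)] at e2
    rw [curv_symm hT z w x y] at e4
    linarith
  -- Put `w = A_a z`, so that on each side only the component along `ω_a` survives.
  have main (a x y) : γ a x y = β z z / inner ℝ z z * kahlerForm (A a) x y := by
    have h1 := key (a + 2) x y z (A a z)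
    rw [fin3_add_two_add_one, fin3_add_two_add_two] at h1
    have k1 : kahlerForm (A a) z (A a z) = -inner ℝ z z := by
      rw [kahlerForm, hA.apply_self, inner_neg_right]
    have k2 : kahlerForm (A (a + 1)) z (A a z) = 0 := by
      rw [kahlerForm, hA.succ_apply, inner_neg_right, hA.inner_apply_self, neg_zero]
    have k3 : γ a z (A a z) = -β z z := by rw [hγ, hA.apply_self, βneg]
    have k4 : γ (a + 1) z (A a z) = 0 := by rw [hγ, hA.succ_apply, βneg, βself, neg_zero]
    rw [k1, k2, k3, k4] at h1
    field_simp
    linarith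
  refine ⟨β z z / inner ℝ z z, main, fun x y ↦ ?_⟩
  have h1 := main 0 x (A 0 y)
  rw [hγ, kahlerForm, hA.apply_self, βneg, inner_neg_right] at h1
  have h2 : β x y = β z z / inner ℝ z z * inner ℝ x y := by linarith
  have h3 : ricci T x y = (n + 2) * β x y := by
    simp only [hβ]
    field_simp
  rw [h3, h2]
  ring

theorem starRicci_eq (hA : IsAdaptedBasis G A) {c : ℝ} (h : IsQKType A T γ)
    (hγ : ∀ a x y, γ a x y = c * kahlerForm (A a) x y)
    (hRic : ∀ x y, ricci T x y = (n + 2) * c * inner ℝ x y) (a : Fin 3) (x y : V) :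
    starRicci (A a) T x y = n * c * inner ℝ x y := by
  have h1 (b : Fin 3) : ∑ i, kahlerForm (A b) x (𝐞 i) * kahlerForm (A b) y (𝐞 i) =
      inner ℝ x y := by
    rw [← hA.isometry b x y, ← sum_inner_mul_inner (A b x) (A b y)]
    refine Finset.sum_congr rfl fun i _ ↦ ?_
    rw [hA.inner_left, hA.inner_left, neg_mul_neg]
    rfl
  have h2 := hRic x y
  simp only [ricci] at h2
  simp only [starRicci, h a, Finset.sum_sub_distrib, hγ, mul_assoc, ← Finset.mul_sum, h1, h2]
  ring

end IsQKType

end Core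

end AQH

namespace AQH

/-! ### Change of adapted basis -/

section Preserves

variable {V : Type*} [NormedAddCommGroup V] [InnerProductSpace ℝ V]
  {G : Submodule ℝ (V →L[ℝ] V)} {A : Fin 3 → V →L[ℝ] V} {T : Tensor4 V} {γ : Fin 3 → V → V → ℝ}

/-- The commutators of the endomorphisms `T(x, y)` with elements of `G` lie in `G`. In contrast to
`IsQKType` this does not refer to a basis of `G`. -/
def PreservesEnd (G : Submodule ℝ (V →L[ℝ] V)) (T : Tensor4 V) : Prop :=
  ∀ C ∈ G, ∀ x y, ∃ D ∈ G, ∀ z w, T x y (C z) w + T x y z (C w) = inner ℝ (D z) w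

theorem IsAdaptedBasis.anticomm (hA : IsAdaptedBasis G A) (a b : Fin 3) (x : V) :
    A a (A b x) + A b (A a x) = (if a = b then (-2 : ℝ) else 0) • x := by
  obtain rfl | rfl | rfl : b = a ∨ b = a + 1 ∨ b = a + 2 := by
    fin_cases a <;> fin_cases b <;> simp
  · rw [hA.apply_self, if_pos rfl]
    module
  · rw [hA.apply_succ, hA.succ_apply, if_neg (by fin_cases a <;> simp)]
    module
  · rw [hA.apply_add_two, hA.add_two_apply, if_neg (by fin_cases a <;> simp)]
    module

theorem preservesEnd_of_basis (hA : IsAdaptedBasis G A) (hT : T ∈ curvatureTensors V)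
    (h : ∀ a x y, ∃ D ∈ G, ∀ z w, T x y (A a z) w + T x y z (A a w) = inner ℝ (D z) w) :
    PreservesEnd G T := by
  intro C hC x y
  rw [← hA.span_eq] at hC
  induction hC using Submodule.span_induction with
  | mem C hC =>
    obtain ⟨a, rfl⟩ := hC
    exact h a x y
  | zero =>
    refine ⟨0, G.zero_mem, fun z w ↦ ?_⟩
    simpa using congrArg₂ (· + ·) (curv_smul₃ hT 0 x y 0 w) (curv_smul₄ hT 0 x y z 0)
  | add C C' _ _ hC hC' =>
    obtain ⟨D, hD, hD'⟩ := hC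
    obtain ⟨D₁, hD₁, hD₁'⟩ := hC'
    refine ⟨D + D₁, G.add_mem hD hD₁, fun z w ↦ ?_⟩
    rw [add_apply, add_apply, add_apply, inner_add_left, ← hD', ← hD₁', curv_add₃ hT, curv_add₄ hT]
    ring
  | smul t C _ hC =>
    obtain ⟨D, hD, hD'⟩ := hC
    refine ⟨t • D, G.smul_mem t hD, fun z w ↦ ?_⟩
    rw [smul_apply, smul_apply, smul_apply, real_inner_smul_left, ← hD',
      curv_smul₃ hT, curv_smul₄ hT]
    ring

theorem PreservesEnd.exists_isQKType (hA : IsAdaptedBasis G A) (hT : T ∈ curvatureTensors V)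
    (h : PreservesEnd G T) : ∃ γ, IsQKType A T γ := by
  have key (x y : V) : ∃ g : Fin 3 → ℝ, ∀ a z w, T x y (A a z) (A a w) = T x y z w
      - g (a + 1) * kahlerForm (A (a + 1)) z w - g (a + 2) * kahlerForm (A (a + 2)) z w := by
    choose D hD hD' using fun a ↦ h (A a) (hA.mem a) x y
    obtain ⟨g, hg⟩ := hA.exists_of_derivation D hD fun a b v ↦ by
      rw [hA.inner_left, hA.inner_left, ← hD', ← hD', ← hD', ← hD']
      have h1 := curv_add₄ hT x y v (A a (A b v)) (A b (A a v))
      rw [hA.anticomm, curv_smul₄ hT, curv_symm hT, curv_self₁ hT] at h1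
      have h2 := curv_antisymm' hT x y (A a (A b v)) v
      have h3 := curv_antisymm' hT x y (A b (A a v)) v
      linarith
    refine ⟨fun a ↦ -g a, fun a z w ↦ ?_⟩
    have h1 := hD' a z (A a w)
    rw [hA.apply_self, curv_neg₄ hT, hg, sub_apply, smul_apply,
      smul_apply, inner_sub_left, real_inner_smul_left, real_inner_smul_left,
      hA.inner_left, hA.inner_left, hA.succ_apply, hA.add_two_apply, inner_neg_right] at h1
    simp only [kahlerForm]
    linarith
  choose g hg using key
  exact ⟨fun a x y ↦ g x y a, fun a x y ↦ hg x y a⟩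

end Preserves

/-! ### The model tensor, `𝓠𝓚` and the projection on the trivial summands -/

section Model

variable {V : Type*} [NormedAddCommGroup V] [InnerProductSpace ℝ V]
  {G : Submodule ℝ (V →L[ℝ] V)} {A : Fin 3 → V →L[ℝ] V} {T : Tensor4 V} {γ : Fin 3 → V → V → ℝ}
  {n : ℕ}

theorem pi₂_apply (A : Fin 3 → V →L[ℝ] V) (x y z u : V) : pi₂ A x y z u =
    ∑ b, (4 * (kahlerForm (A b) x y * kahlerForm (A b) z u)
      + 2 * (kahlerForm (A b) x z * kahlerForm (A b) y u)
      - 2 * (kahlerForm (A b) x u * kahlerForm (A b) y z)) := by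
  simp only [pi₂, Finset.sum_apply, Pi.sub_apply, Pi.smul_apply, smul_eq_mul, symProd, wedge]
  exact Finset.sum_congr rfl fun b _ ↦ by ring

theorem kahlerForm_antisymm (hA : IsAdaptedBasis G A) (a : Fin 3) (x y : V) :
    kahlerForm (A a) x y = -kahlerForm (A a) y x := by
  rw [kahlerForm, kahlerForm, ← hA.inner_left, real_inner_comm]

theorem model_mem (hA : IsAdaptedBasis G A) :
    pi₂ A + (2 : ℝ) • pi₁ V ∈ curvatureTensors V := by
  have hω := kahlerForm_antisymm hA
  refine ⟨fun x x' y z u ↦ ?_, fun t x y z u ↦ ?_, fun x y z u ↦ ?_, fun x y z u ↦ ?_,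
    fun x y z u ↦ ?_⟩ <;>
    simp only [Pi.add_apply, Pi.smul_apply, pi₂_apply, Fin.sum_univ_three, pi₁, smul_eq_mul]
  · simp only [kahlerForm, inner_add_left]
    ring
  · simp only [kahlerForm, real_inner_smul_left]
    ring
  · rw [hω 0 y x, hω 1 y x, hω 2 y x]
    ring
  · rw [hω 0 z x, hω 1 z x, hω 2 z x, hω 0 u y, hω 1 u y, hω 2 u y, hω 0 z y, hω 1 z y, hω 2 z y,
      hω 0 u x, hω 1 u x, hω 2 u x, real_inner_comm z x, real_inner_comm u y, real_inner_comm z y,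
      real_inner_comm u x]
    ring
  · rw [hω 0 y x, hω 1 y x, hω 2 y x, hω 0 z x, hω 1 z x, hω 2 z x, hω 0 z y, hω 1 z y, hω 2 z y,
      real_inner_comm y x, real_inner_comm z x, real_inner_comm z y]
    ring

theorem model_isQKType (hA : IsAdaptedBasis G A) :
    IsQKType A (pi₂ A + (2 : ℝ) • pi₁ V) fun a x y ↦ 8 * kahlerForm (A a) x y := by
  intro a x y z w
  simp only [Pi.add_apply, Pi.smul_apply, pi₂_apply, sum_fin3_cyclic _ a, pi₁, smul_eq_mul,
    kahlerForm, hA.apply_self, hA.succ_apply, hA.add_two_apply, hA.inner_left, inner_neg_right,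
    map_neg, hA.apply_succ, hA.apply_add_two]
  ring

theorem IsQKType.sub_smul {γ' : Fin 3 → V → V → ℝ} {T' : Tensor4 V} (h : IsQKType A T γ)
    (h' : IsQKType A T' γ') (t : ℝ) :
    IsQKType A (T - t • T') fun a x y ↦ γ a x y - t * γ' a x y := by
  intro a x y z w
  simp only [Pi.sub_apply, Pi.smul_apply, smul_eq_mul, h a, h' a]
  ring

theorem IsQKType.smul (h : IsQKType A T γ) (t : ℝ) :
    IsQKType A (t • T) fun a x y ↦ t * γ a x y := by
  intro a x y z w
  simp only [Pi.smul_apply, smul_eq_mul, h a]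
  ring

variable [FiniteDimensional ℝ V]

local notation "𝐞" => stdOrthonormalBasis ℝ V

theorem formInner_kahlerForm (hA : IsAdaptedBasis G A) {F : V → V → ℝ}
    (hF : ∀ y, IsLinearMap ℝ fun x ↦ F x y) (a : Fin 3) :
    formInner F (kahlerForm (A a)) = 1 / 2 * ∑ j, F (A a (𝐞 j)) (𝐞 j) := by
  rw [formInner, Finset.sum_comm]
  congr 1
  exact Finset.sum_congr rfl fun j _ ↦ sum_mul_inner (hF _) _

theorem formInner_smul_kahlerForm (hA : IsAdaptedBasis G A)
    (hV : Module.finrank ℝ V = 4 * n) (c : ℝ) (a : Fin 3) :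
    formInner (fun x y ↦ c * kahlerForm (A a) x y) (kahlerForm (A a)) = 2 * n * c := by
  rw [formInner_kahlerForm hA fun y ↦ ⟨fun _ _ ↦ by rw [kahlerForm, inner_add_left, mul_add]; rfl,
    fun _ _ ↦ by rw [kahlerForm, real_inner_smul_left, mul_left_comm]; rfl⟩]
  simp only [kahlerForm, hA.isometry, ← Finset.mul_sum, sum_inner_self, hV]
  push_cast
  ring

theorem IsQKType.formInner_eq (hA : IsAdaptedBasis G A) (hT : T ∈ curvatureTensors V)
    (h : IsQKType A T γ) (hV : Module.finrank ℝ V = 4 * n) (a : Fin 3) (x y : V) :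
    formInner (T x y) (kahlerForm (A a)) = n * γ a x y := by
  rw [formInner_kahlerForm hA fun y ↦ curv_isLinearMap₃ hT _ _ _]
  have := h.sum_apply hA hT hV a x y
  simp only [curv_antisymm' hT x y (A a _), Finset.sum_neg_distrib, this]
  ring

theorem isQKType_of_mem_QK (hA : IsAdaptedBasis G A) (hT : T ∈ QK n A) :
    IsQKType A T fun b x y ↦ 2 * (1 / (2 * n) * formInner (T x y) (kahlerForm (A b))) := by
  obtain ⟨hT, hker⟩ := Submodule.mem_inf.1 hT
  rw [LinearMap.mem_ker, LinearMap.sub_apply, sub_eq_zero] at hker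
  intro a x y z w
  have key (z w : V) := congrFun (congrFun (congrFun (congrFun hker x) y) z) w
  simp only [pi1es, pi1s, LinearMap.coe_mk, AddHom.coe_mk, sum_fin3_cyclic _ a] at key
  have e1 := key z w
  have e2 := key (A a z) (A a w)
  simp only [hA.apply_self, hA.succ_apply, hA.add_two_apply, curv_neg₃ hT, curv_neg₄ hT,
    neg_neg] at e2
  have w1 : kahlerForm (A a) (A a z) (A a w) = kahlerForm (A a) z w := by
    simp only [kahlerForm, hA.isometry]
  have w2 : kahlerForm (A (a + 1)) (A a z) (A a w) = -kahlerForm (A (a + 1)) z w := by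
    simp only [kahlerForm, hA.succ_apply, hA.inner_left, map_neg, hA.apply_add_two,
      neg_neg]
  have w3 : kahlerForm (A (a + 2)) (A a z) (A a w) = -kahlerForm (A (a + 2)) z w := by
    simp only [kahlerForm, hA.add_two_apply, hA.inner_left, hA.apply_succ]
  rw [w1, w2, w3] at e2
  linarith

theorem IsQKType.mem_QK (hA : IsAdaptedBasis G A) (hT : T ∈ curvatureTensors V)
    (h : IsQKType A T γ) (hV : Module.finrank ℝ V = 4 * n) (hn : n ≠ 0) : T ∈ QK n A := by
  refine Submodule.mem_inf.2 ⟨hT, ?_⟩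
  rw [LinearMap.mem_ker, LinearMap.sub_apply, sub_eq_zero]
  ext x y z w
  simp only [pi1es, pi1s, LinearMap.coe_mk, AddHom.coe_mk, h.formInner_eq hA hT hV,
    h _ x y z w, Fin.sum_univ_three]
  have hn' : (n : ℝ) ≠ 0 := by exact_mod_cast hn
  field_simp
  simp only [zero_add, show (1 + 1 : Fin 3) = 2 from rfl, show (1 + 2 : Fin 3) = 0 from rfl,
    show (2 + 1 : Fin 3) = 0 from rfl, show (2 + 2 : Fin 3) = 1 from rfl]
  ring

theorem tensorInner_add_right (T S S' : Tensor4 V) :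
    tensorInner T (S + S') = tensorInner T S + tensorInner T S' := by
  simp only [tensorInner, Pi.add_apply, mul_add, Finset.sum_add_distrib]

theorem tensorInner_smul_right (T S : Tensor4 V) (t : ℝ) :
    tensorInner T (t • S) = t * tensorInner T S := by
  simp only [tensorInner, Pi.smul_apply, smul_eq_mul, mul_left_comm _ t, Finset.mul_sum]

theorem sum_sum_mul_inner (hT : T ∈ curvatureTensors V) (x y p q : V) :
    ∑ k, ∑ l, T x y (𝐞 k) (𝐞 l) * (inner ℝ p (𝐞 k) * inner ℝ q (𝐞 l)) = T x y p q := by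
  simp_rw [real_inner_comm (𝐞 _)]
  rw [← sum_mul_inner (curv_isLinearMap₃ hT x y q)]
  refine Finset.sum_congr rfl fun k _ ↦ ?_
  rw [← sum_mul_inner (curv_isLinearMap₄ hT x y _) q, Finset.sum_mul]
  exact Finset.sum_congr rfl fun l _ ↦ by ring

/-- A curvature tensor of hyperkähler type is orthogonal to both trivial summands: its contractions
with `π₁` and `π₂` are multiples of its scalar curvature. -/
theorem tensorInner_eq_zero (hA : IsAdaptedBasis G A) (hT : T ∈ curvatureTensors V)
    (h : IsQKType A T 0) (hV : Module.finrank ℝ V = 4 * n) (hRic : ∀ x y, ricci T x y = 0)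
    (s t : ℝ) : tensorInner T (s • pi₂ A + t • pi₁ V) = 0 := by
  have hs : ∑ i, ∑ j, T (𝐞 i) (𝐞 j) (𝐞 i) (𝐞 j) = 0 :=
    Finset.sum_eq_zero fun i _ ↦ hRic _ _
  have h1 (x y : V) : ∑ k, ∑ l, T x y (𝐞 k) (𝐞 l) * pi₁ V x y (𝐞 k) (𝐞 l) = 2 * T x y x y := by
    have e (k l) : T x y (𝐞 k) (𝐞 l) * pi₁ V x y (𝐞 k) (𝐞 l) =
        T x y (𝐞 k) (𝐞 l) * (inner ℝ x (𝐞 k) * inner ℝ y (𝐞 l))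
          - T x y (𝐞 k) (𝐞 l) * (inner ℝ y (𝐞 k) * inner ℝ x (𝐞 l)) := by
      rw [pi₁]
      ring
    simp_rw [e, Finset.sum_sub_distrib]
    rw [sum_sum_mul_inner hT, sum_sum_mul_inner hT, curv_antisymm' hT x y y]
    ring
  have h2 (b : Fin 3) (x y : V) :
      ∑ k, ∑ l, T x y (𝐞 k) (𝐞 l) * (4 * (kahlerForm (A b) x y * kahlerForm (A b) (𝐞 k) (𝐞 l))
        + 2 * (kahlerForm (A b) x (𝐞 k) * kahlerForm (A b) y (𝐞 l))
        - 2 * (kahlerForm (A b) x (𝐞 l) * kahlerForm (A b) y (𝐞 k))) = 4 * T x y x y := by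
    have h0 := h.formInner_eq hA hT hV b x y
    have e (k l) : T x y (𝐞 k) (𝐞 l) *
        (4 * (kahlerForm (A b) x y * kahlerForm (A b) (𝐞 k) (𝐞 l))
        + 2 * (kahlerForm (A b) x (𝐞 k) * kahlerForm (A b) y (𝐞 l))
        - 2 * (kahlerForm (A b) x (𝐞 l) * kahlerForm (A b) y (𝐞 k))) =
        4 * kahlerForm (A b) x y * (T x y (𝐞 k) (𝐞 l) * kahlerForm (A b) (𝐞 k) (𝐞 l))
        + 2 * (T x y (𝐞 k) (𝐞 l) * (inner ℝ (A b x) (𝐞 k) * inner ℝ (A b y) (𝐞 l)))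
        - 2 * (T x y (𝐞 k) (𝐞 l) * (inner ℝ (A b y) (𝐞 k) * inner ℝ (A b x) (𝐞 l))) := by
      simp only [hA.inner_left, kahlerForm]
      ring
    simp_rw [e, Finset.sum_sub_distrib, Finset.sum_add_distrib, ← Finset.mul_sum]
    rw [sum_sum_mul_inner hT, sum_sum_mul_inner hT, curv_antisymm' hT x y (A b y), h b]
    simp only [formInner, Pi.zero_apply, mul_zero] at h0
    have h3 : ∑ i, ∑ j, T x y (𝐞 i) (𝐞 j) * kahlerForm (A b) (𝐞 i) (𝐞 j) = 0 := by linarith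
    rw [h3]
    simp only [Pi.zero_apply]
    ring
  have h3 (x y : V) : ∑ k, ∑ l, T x y (𝐞 k) (𝐞 l) * pi₂ A x y (𝐞 k) (𝐞 l) =
      12 * T x y x y := by
    simp_rw [pi₂_apply, Finset.mul_sum]
    simp_rw [Finset.sum_comm (t := (Finset.univ : Finset (Fin 3)))]
    rw [Finset.sum_congr rfl fun b _ ↦ h2 b x y]
    rw [Finset.sum_const, Finset.card_univ, Fintype.card_fin]
    ring
  rw [tensorInner_add_right, tensorInner_smul_right, tensorInner_smul_right]
  simp only [tensorInner, h1, h3, ← Finset.mul_sum, hs]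
  ring

end Model

end AQH

namespace AQH

/-! ### The module `S⁴E` -/

section S4E

variable {V : Type*} [NormedAddCommGroup V] [InnerProductSpace ℝ V]
  {G : Submodule ℝ (V →L[ℝ] V)} {A : Fin 3 → V →L[ℝ] V} {T : Tensor4 V} {γ : Fin 3 → V → V → ℝ}
  {n : ℕ}

theorem mem_curvatureTensors_of_mem_S4E (hA : IsAdaptedBasis G A) (hT : T ∈ S4E A) :
    T ∈ curvatureTensors V ∧ IsQKType A T 0 := by
  obtain ⟨s, hs, hI, hJ, hTs⟩ := hT
  obtain ⟨f, hf⟩ : ∃ f : V → V → V → V → ℂ, ∀ x y z u, s ![x, y, z, u] = f x y z u :=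
    ⟨fun x y z u ↦ s ![x, y, z, u], fun _ _ _ _ ↦ rfl⟩
  simp only [hf] at hI hJ hTs
  have s12 (x y z u) : f x y z u = f y x z u := by
    rw [← hf, ← hf, ← hs (Equiv.swap 0 1) ![x, y, z, u]]
    congr 1
    ext i
    fin_cases i <;> rfl
  have s23 (x y z u) : f x y z u = f x z y u := by
    rw [← hf, ← hf, ← hs (Equiv.swap 1 2) ![x, y, z, u]]
    congr 1
    ext i
    fin_cases i <;> rfl
  have s34 (x y z u) : f x y z u = f x y u z := by
    rw [← hf, ← hf, ← hs (Equiv.swap 2 3) ![x, y, z, u]]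
    congr 1
    ext i
    fin_cases i <;> rfl
  have add1 (x x' y z u) : f (x + x') y z u = f x y z u + f x' y z u := by
    simp only [← hf]
    exact s.cons_add ![y, z, u] x x'
  have smul1 (t : ℝ) (x y z u) : f (t • x) y z u = t * f x y z u := by
    simp only [← hf]
    exact s.cons_smul ![y, z, u] t x
  have neg1 (x y z u) : f (-x) y z u = -f x y z u := by
    simpa using smul1 (-1) x y z u
  have neg3 (x y z u) : f x y (-z) u = -f x y z u := by
    rw [s23, s12, neg1, s12, s23]
  have neg4 (x y z u) : f x y z (-u) = -f x y z u := by
    rw [s34, neg3, s34]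
  have I3 (x y z u) : f x y (A 0 z) u = Complex.I * f x y z u := by
    rw [s23, s12, hI, s12, s23]
  have I4 (x y z u) : f x y z (A 0 u) = Complex.I * f x y z u := by
    rw [s34, I3, s34]
  have JI (x) : A 1 (A 0 x) = -A 0 (A 1 x) := by rw [(hA.sq_aux x).2.2.2, (hA.sq_aux x).2.2.1]
  have JJ (x) : A 1 (A 1 x) = -x := (hA.sq_aux x).2.1
  have inv0 (x y z u) : T x y (A 0 z) (A 0 u) = T x y z u := by
    rw [← Complex.ofReal_inj, hTs, hTs]
    simp only [JI, neg3, neg4, I3, I4]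
    linear_combination (-(f x (A 1 y) z (A 1 u)) + f x (A 1 y) (A 1 z) u + f (A 1 x) y z (A 1 u)
      - f (A 1 x) y (A 1 z) u) * Complex.I_mul_I
  have inv1 (x y z u) : T x y (A 1 z) (A 1 u) = T x y z u := by
    rw [← Complex.ofReal_inj, hTs, hTs]
    simp only [JJ, neg3, neg4]
    ring
  refine ⟨⟨fun x x' y z u ↦ ?_, fun t x y z u ↦ ?_, fun x y z u ↦ ?_, fun x y z u ↦ ?_,
    fun x y z u ↦ ?_⟩, fun a x y z w ↦ ?_⟩
  · rw [← Complex.ofReal_inj]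
    push_cast
    simp only [hTs, map_add, add1]
    ring
  · rw [← Complex.ofReal_inj]
    push_cast
    simp only [hTs, map_smul, smul1]
    ring
  · rw [← Complex.ofReal_inj]
    push_cast
    simp only [hTs]
    rw [s12 x (A 1 y), s12 x (A 1 y), s12 (A 1 x), s12 (A 1 x)]
    ring
  · have pair (x y z u) : f x y z u = f z u x y := by
      rw [s23, s12, s34, s23]
    rw [← Complex.ofReal_inj, hTs, hTs, pair x, pair x, pair (A 1 x), pair (A 1 x)]
    ring
  · have cyc (x y z u) : f x y z u = f z x y u := by rw [s23, s12]
    rw [← Complex.ofReal_inj]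
    push_cast
    simp only [hTs]
    rw [cyc y, cyc y, cyc (A 1 y), cyc (A 1 y), ← cyc x, ← cyc (A 1 x), ← cyc x, ← cyc (A 1 x)]
    ring
  · simp only [Pi.zero_apply, zero_mul, sub_zero]
    fin_cases a
    · exact inv0 x y z w
    · exact inv1 x y z w
    · change T x y (A 2 z) (A 2 w) = _
      rw [← (hA.sq_aux z).2.2.1, ← (hA.sq_aux w).2.2.1, inv0, inv1]

theorem IsQKType.apply_apply₃₄ (h : IsQKType A T 0) (a : Fin 3) (x y z u : V) :
    T x y (A a z) (A a u) = T x y z u := by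
  simpa using h a x y z u

theorem IsQKType.apply_apply₁₂ (hT : T ∈ curvatureTensors V) (h : IsQKType A T 0) (a : Fin 3)
    (x y z u : V) : T (A a x) (A a y) z u = T x y z u := by
  rw [curv_symm hT, h.apply_apply₃₄, curv_symm hT]

/-- A curvature tensor of hyperkähler type, evaluated on the components of the complexified vectors
in `E ⊗ h` (first and third slot) and `E ⊗ h'` (second and fourth slot). It is the symmetric form
that exhibits `T` as an element of `S⁴E`. -/
noncomputable def quartic (A : Fin 3 → V →L[ℝ] V) (T : Tensor4 V) (x y z u : V) : ℂ :=
  ((1 / 4 * (T x (A 1 y) z (A 1 u) - T (A 0 x) (A 1 y) (A 0 z) (A 1 u)) : ℝ) : ℂ)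
    - ((1 / 4 * (T (A 0 x) (A 1 y) z (A 1 u) + T x (A 1 y) (A 0 z) (A 1 u)) : ℝ) : ℂ) * Complex.I

theorem quartic_swap₁₂ (hA : IsAdaptedBasis G A) (hT : T ∈ curvatureTensors V)
    (h : IsQKType A T 0) (x y z u : V) : quartic A T x y z u = quartic A T y x z u := by
  have e1 (x y z u) : T x (A 1 y) z u = T y (A 1 x) z u := by
    rw [← h.apply_apply₁₂ hT 1, hA.apply_self, curv_neg₂ hT, curv_antisymm hT, neg_neg]
  have e2 (x y z u) : T (A 0 x) (A 1 y) z u = T (A 0 y) (A 1 x) z u := by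
    rw [e1, ← h.apply_apply₁₂ hT 0, (hA.sq_aux x).2.2.2]
    have := hA.apply_add_two 0 x
    change A 0 (A 2 x) = -A 1 x at this
    rw [map_neg, this, neg_neg]
  rw [quartic, quartic, e1 x, e1 x, e2 x, e2 x]

theorem quartic_pair (hT : T ∈ curvatureTensors V) (x y z u : V) :
    quartic A T x y z u = quartic A T z u x y := by
  rw [quartic, quartic, curv_symm hT x, curv_symm hT (A 0 x), curv_symm hT (A 0 x),
    curv_symm hT x]
  congr 4
  ring

/-- This is where the first Bianchi identity enters the symmetry of `quartic`. -/
theorem quartic_swap₁₃ (hA : IsAdaptedBasis G A) (hT : T ∈ curvatureTensors V)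
    (h : IsQKType A T 0) (x y z u : V) : quartic A T x y z u = quartic A T z y x u := by
  have e (x y z w) : T x y z w - T z y x w = -T z x y w := by
    linarith [curv_bianchi hT x y z w, curv_antisymm hT y z x w]
  have e1 := e x (A 1 y) z (A 1 u)
  have e2 := e (A 0 x) (A 1 y) (A 0 z) (A 1 u)
  have e3 := e (A 0 x) (A 1 y) z (A 1 u)
  have e4 := e x (A 1 y) (A 0 z) (A 1 u)
  rw [h.apply_apply₁₂ hT] at e2
  rw [← h.apply_apply₁₂ hT 0 (A 0 z) x, hA.apply_self, curv_neg₁ hT] at e4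
  rw [quartic, quartic]
  congr 3 <;> linarith

theorem quartic_I (hA : IsAdaptedBasis G A) (hT : T ∈ curvatureTensors V) (x y z u : V) :
    quartic A T (A 0 x) y z u = Complex.I * quartic A T x y z u := by
  simp only [quartic, hA.apply_self, curv_neg₁ hT]
  push_cast
  linear_combination (1 / 4 * ((T (A 0 x) (A 1 y) z (A 1 u) : ℂ) + T x (A 1 y) (A 0 z) (A 1 u)))
    * Complex.I_mul_I

theorem quartic_J (hA : IsAdaptedBasis G A) (hT : T ∈ curvatureTensors V)
    (h : IsQKType A T 0) (x y z u : V) :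
    quartic A T (A 1 x) (A 1 y) (A 1 z) (A 1 u) = conj (quartic A T x y z u) := by
  have e (x : V) : A 0 (A 1 x) = A 1 (A 0 (-x)) := by
    rw [map_neg, map_neg, (hA.sq_aux x).2.2.1, (hA.sq_aux x).2.2.2, neg_neg]
  simp only [quartic, e, h.apply_apply₁₂ hT, h.apply_apply₃₄, map_neg, curv_neg₁ hT, curv_neg₃ hT,
    map_sub, map_mul, Complex.conj_ofReal, Complex.conj_I]
  push_cast
  ring

theorem quartic_spec (hA : IsAdaptedBasis G A) (hT : T ∈ curvatureTensors V)
    (h : IsQKType A T 0) (x y z u : V) :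
    (T x y z u : ℂ) = quartic A T x (A 1 y) z (A 1 u) - quartic A T x (A 1 y) (A 1 z) u
      - quartic A T (A 1 x) y z (A 1 u) + quartic A T (A 1 x) y (A 1 z) u := by
  have e (x : V) : A 0 (A 1 x) = A 1 (A 0 (-x)) := by
    rw [map_neg, map_neg, (hA.sq_aux x).2.2.1, (hA.sq_aux x).2.2.2, neg_neg]
  have i0 (x y z u) : T (A 0 x) (A 0 y) z u = T x y z u := h.apply_apply₁₂ hT 0 x y z u
  have i1 (x y z u) : T (A 0 x) y z u = -T x (A 0 y) z u := by
    rw [← i0, hA.apply_self, curv_neg₁ hT]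
  have i2 (x y z u) : T x y (A 0 z) u = -T x y z (A 0 u) := by
    rw [curv_symm hT, i1, curv_symm hT]
  simp only [quartic, e, h.apply_apply₁₂ hT, h.apply_apply₃₄, map_neg, curv_neg₁ hT, curv_neg₃ hT,
    hA.apply_self, curv_neg₂ hT, curv_neg₄ hT]
  push_cast
  ring

theorem mem_S4E (hA : IsAdaptedBasis G A) (hT : T ∈ curvatureTensors V) (h : IsQKType A T 0) :
    T ∈ S4E A := by
  have s12 := quartic_swap₁₂ hA hT h
  have s13 := quartic_swap₁₃ hA hT h
  have pair := quartic_pair (A := A) hT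
  have s23 (x y z u) : quartic A T x y z u = quartic A T x z y u := by
    rw [s12, s13, s12]
  have s34 (x y z u) : quartic A T x y z u = quartic A T x y u z := by
    rw [pair, s12, pair]
  have add1 (x x' y z u) :
      quartic A T (x + x') y z u = quartic A T x y z u + quartic A T x' y z u := by
    simp only [quartic, map_add, curv_add₁ hT]
    push_cast
    ring
  have smul1 (t : ℝ) (x y z u) : quartic A T (t • x) y z u = t • quartic A T x y z u := by
    simp only [quartic, map_smul, curv_smul₁ hT, Complex.real_smul]
    push_cast
    ring
  have s14 (x y z u) : quartic A T x y z u = quartic A T u y z x := by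
    rw [s34, s13, s34]
  let s : MultilinearMap ℝ (fun _ : Fin 4 ↦ V) ℂ :=
    { toFun v := quartic A T (v 0) (v 1) (v 2) (v 3)
      map_update_add' := by
        intro inst v i x y
        obtain rfl : inst = instDecidableEqFin 4 := Subsingleton.elim _ _
        fin_cases i
        · simp [add1]
        · simp [s12 (v 0), add1]
        · simp [s13 (v 0), add1]
        · simp [s14 (v 0), add1]
      map_update_smul' := by
        intro inst v i t x
        obtain rfl : inst = instDecidableEqFin 4 := Subsingleton.elim _ _
        fin_cases i
        · simp [smul1]
        · simp [s12 (v 0), smul1]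
        · simp [s13 (v 0), smul1]
        · simp [s14 (v 0), smul1] }
  refine ⟨s, fun σ v ↦ ?_, quartic_I hA hT, quartic_J hA hT h, quartic_spec hA hT h⟩
  have hσ : σ ∈ Submonoid.closure (Set.range fun i : Fin 3 ↦
      Equiv.swap i.castSucc i.succ) := by
    rw [Equiv.Perm.mclosure_swap_castSucc_succ]
    trivial
  -- adjacent transpositions generate the symmetric group
  induction hσ using Submonoid.closure_induction generalizing v with
  | mem σ hσ =>
    obtain ⟨i, rfl⟩ := hσ
    change quartic A T _ _ _ _ = quartic A T _ _ _ _
    fin_cases i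
    · exact s12 (v 1) (v 0) (v 2) (v 3)
    · exact s23 (v 0) (v 2) (v 1) (v 3)
    · exact s34 (v 0) (v 1) (v 3) (v 2)
  | one => rfl
  | mul σ τ _ _ hσ hτ => exact (hτ fun i ↦ v (σ i)).trans (hσ v)

end S4E

/-! ### The decomposition of `𝓠𝓚` -/

section Decomposition

variable {V : Type*} [NormedAddCommGroup V] [InnerProductSpace ℝ V] [FiniteDimensional ℝ V]
  {G : Submodule ℝ (V →L[ℝ] V)} {A : Fin 3 → V →L[ℝ] V} {T : Tensor4 V} {γ : Fin 3 → V → V → ℝ}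
  {n : ℕ} {c : ℝ}

/-- Subtracting the right multiple of the model tensor leaves a tensor of hyperkähler type. -/
theorem IsQKType.sub_model (hA : IsAdaptedBasis G A) (hT : T ∈ curvatureTensors V)
    (h : IsQKType A T γ) (hγ : ∀ a x y, γ a x y = c * kahlerForm (A a) x y) :
    T - (c / 8) • (pi₂ A + (2 : ℝ) • pi₁ V) ∈ curvatureTensors V ∧
      IsQKType A (T - (c / 8) • (pi₂ A + (2 : ℝ) • pi₁ V)) 0 := by
  refine ⟨Submodule.sub_mem _ hT (Submodule.smul_mem _ _ (model_mem hA)), ?_⟩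
  convert h.sub_smul (model_isQKType hA) (c / 8) using 1
  ext a x y
  rw [hγ, Pi.zero_apply, Pi.zero_apply, Pi.zero_apply]
  ring

/-- The last summand of the decomposition is the model tensor with the factor `c / 8`, the first is
of hyperkähler type. -/
theorem IsQKType.mem_sup (hA : IsAdaptedBasis G A) (hT : T ∈ curvatureTensors V)
    (h : IsQKType A T γ) (hγ : ∀ a x y, γ a x y = c * kahlerForm (A a) x y) :
    T ∈ S4E A ⊔ Submodule.span ℝ {pi₂ A + (2 : ℝ) • pi₁ V} := by
  obtain ⟨h1, h2⟩ := h.sub_model hA hT hγ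
  rw [← sub_add_cancel T ((c / 8) • (pi₂ A + (2 : ℝ) • pi₁ V))]
  exact Submodule.add_mem_sup (mem_S4E hA h1 h2)
    (Submodule.smul_mem _ _ (Submodule.mem_span_singleton_self _))

/-- The model tensor has nonzero forms `γ_A`, the elements of `S⁴E` have none. -/
theorem disjoint_S4E_model (hA : IsAdaptedBasis G A) (hV : Module.finrank ℝ V = 4 * n)
    (hn : 1 < n) :
    Disjoint (S4E A) (Submodule.span ℝ {pi₂ A + (2 : ℝ) • pi₁ V}) := by
  rw [Submodule.disjoint_def]
  intro S hS hS'
  obtain ⟨t, rfl⟩ := Submodule.mem_span_singleton.1 hS'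
  obtain ⟨h1, h2⟩ := mem_curvatureTensors_of_mem_S4E hA hS
  have h3 := (model_isQKType hA).smul t
  have : Nontrivial V := Module.nontrivial_of_finrank_pos (R := ℝ) (by omega)
  obtain ⟨z, hz⟩ := exists_ne (0 : V)
  have hzz : inner ℝ z z ≠ (0 : ℝ) := inner_self_ne_zero.2 hz
  have hn' : (-(2 * n) : ℝ) ≠ 0 := by simp; omega
  have h4 := (h2.sum_apply hA h1 hV 0 z (A 0 z)).symm.trans (h3.sum_apply hA h1 hV 0 z (A 0 z))
  have h5 := mul_left_cancel₀ hn' h4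
  rw [kahlerForm, hA.apply_self, inner_neg_right, Pi.zero_apply, Pi.zero_apply, Pi.zero_apply] at h5
  have h6 : t = 0 := by
    have : t * inner ℝ z z = 0 := by linarith
    exact (mul_eq_zero.1 this).resolve_right hzz
  rw [h6, zero_smul]

theorem S4E_sup_model_eq_QK (hA : IsAdaptedBasis G A) (hV : Module.finrank ℝ V = 4 * n)
    (hn : 1 < n) :
    S4E A ⊔ Submodule.span ℝ {pi₂ A + (2 : ℝ) • pi₁ V} = QK n A := by
  apply le_antisymm
  · refine sup_le (fun S hS ↦ ?_) ?_
    · obtain ⟨h1, h2⟩ := mem_curvatureTensors_of_mem_S4E hA hS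
      exact h2.mem_QK hA h1 hV (by omega)
    · rw [Submodule.span_singleton_le_iff_mem]
      exact (model_isQKType hA).mem_QK hA (model_mem hA) hV (by omega)
  · intro S hS
    have h1 := (Submodule.mem_inf.1 hS).1
    have h2 := isQKType_of_mem_QK hA hS
    obtain ⟨c, hc, -⟩ := h2.exists_const hA h1 hV hn
    exact h2.mem_sup hA h1 hc

/-- The remainder after subtracting the model tensor is Ricci flat, hence orthogonal to both trivial
summands. -/
theorem IsQKType.isOrthogonalProjection (hA : IsAdaptedBasis G A) (hT : T ∈ curvatureTensors V)
    (h : IsQKType A T γ) (hV : Module.finrank ℝ V = 4 * n) (hn : 1 < n)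
    (hγ : ∀ a x y, γ a x y = c * kahlerForm (A a) x y) :
    IsOrthogonalProjection (Ra A ⊔ Rb A) T ((c / 8) • (pi₂ A + (2 : ℝ) • pi₁ V)) := by
  obtain ⟨h1, h2⟩ := h.sub_model hA hT hγ
  constructor
  · refine Submodule.smul_mem _ _ ?_
    have e : pi₂ A + (2 : ℝ) • pi₁ V = (2 / 3 : ℝ) • (pi₂ A + (6 : ℝ) • pi₁ V)
        + (1 / 3 : ℝ) • (pi₂ A - (6 : ℝ) • pi₁ V) := by
      module
    rw [e]
    exact Submodule.add_mem_sup (Submodule.smul_mem _ _ (Submodule.mem_span_singleton_self _))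
      (Submodule.smul_mem _ _ (Submodule.mem_span_singleton_self _))
  · intro S hS
    obtain ⟨S₁, h₁, S₂, h₂, rfl⟩ := Submodule.mem_sup.1 hS
    obtain ⟨s, rfl⟩ := Submodule.mem_span_singleton.1 h₁
    obtain ⟨t, rfl⟩ := Submodule.mem_span_singleton.1 h₂
    have e : s • (pi₂ A + (6 : ℝ) • pi₁ V) + t • (pi₂ A - (6 : ℝ) • pi₁ V) =
        (s + t) • pi₂ A + (6 * s - 6 * t) • pi₁ V := by
      module
    rw [e]
    have hRic (x y : V) :
        ricci (T - (c / 8) • (pi₂ A + (2 : ℝ) • pi₁ V)) x y = 0 := by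
      have := h2.eq_ricci hA h1 hV hn 0 x (-A 0 y)
      rw [map_neg, hA.apply_self, neg_neg] at this
      simpa using this.symm
    exact tensorInner_eq_zero hA h1 h2 hV hRic _ _

end Decomposition

end AQH

namespace AQH

/-! ### Derivatives along vector fields -/

section VectorFields

variable {E : Type*} [NormedAddCommGroup E] [NormedSpace ℝ E] [FiniteDimensional ℝ E]
  {H : Type*} [TopologicalSpace H] {I : ModelWithCorners ℝ E H}
  {M : Type*} [TopologicalSpace M] [ChartedSpace H M] [IsManifold I ∞ M]

theorem contMDiffAt_mvfderiv_apply {f : M → ℝ} {X : Π y : M, TangentSpace I y} {x : M}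
    (hf : CMDiffAt ∞ f x) (hX : CMDiffAt ∞ (T% X) x) :
    CMDiffAt ∞ (fun y ↦ mvfderiv I f y (X y)) x := by
  rw [contMDiffAt_infty] at hf hX ⊢
  intro m
  have h1 : CMDiffAt m (inTangentCoordinates I 𝓘(ℝ, ℝ) id f (mfderiv I 𝓘(ℝ, ℝ) f) x) x :=
    (hf (m + 1)).mfderiv_const (by norm_cast)
  have h2 := ContMDiffAt.clm_apply_of_inCoordinates (b₂ := f) h1 (hX m) (hf m)
  exact (contMDiff_snd_tangentBundle_modelSpace ℝ 𝓘(ℝ, ℝ)).contMDiffAt.comp x h2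

theorem contMDiffAt_mlieBracket {X Y : Π y : M, TangentSpace I y} {x : M}
    (hX : CMDiffAt ∞ (T% X) x) (hY : CMDiffAt ∞ (T% Y) x) :
    CMDiffAt ∞ (T% (mlieBracket I X Y)) x := by
  rw [contMDiffAt_infty] at hX hY ⊢
  intro m
  have : IsManifold I (minSmoothness ℝ 2) M := by
    rw [minSmoothness_of_isRCLikeNormedField]; infer_instance
  have : IsManifold I (((m + 1 : ℕ) : ℕ∞) + 1) M :=
    IsManifold.of_le (n := ∞) (by exact_mod_cast le_top)
  exact ContMDiffAt.mlieBracket_vectorField (m := m) (n := (m + 1 : ℕ)) (hX (m + 1)) (hY (m + 1))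
    (by simp)

theorem mdifferentiableAt_of_smooth {f : M → ℝ} {x : M} (hf : CMDiffAt ∞ f x) :
    ∀ᶠ y in 𝓝 x, MDiffAt f y := by
  filter_upwards [(contMDiffAt_iff_contMDiffAt_nhds (n := 1) (by simp)).1
    (hf.of_le (by norm_cast))] with y hy
  exact hy.mdifferentiableAt one_ne_zero

theorem mdifferentiableAt_section_of_smooth {X : Π y : M, TangentSpace I y} {x : M}
    (hX : CMDiffAt ∞ (T% X) x) : ∀ᶠ y in 𝓝 x, MDiffAt (T% X) y := by
  filter_upwards [(contMDiffAt_iff_contMDiffAt_nhds (n := 1) (by simp)).1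
    (hX.of_le (by norm_cast))] with y hy
  exact hy.mdifferentiableAt one_ne_zero

variable [I.Boundaryless]

/-- A derivative along a vector field, computed in a chart. -/
theorem fderiv_comp_extChartAt_symm {f : M → ℝ} (X : Π y : M, TangentSpace I y) (x : M) {u : E}
    (hu : u ∈ (extChartAt I x).target) (hf : MDiffAt f ((extChartAt I x).symm u)) :
    fderiv ℝ (f ∘ (extChartAt I x).symm) u
      (mpullbackWithin 𝓘(ℝ, E) I (extChartAt I x).symm X (Set.range I) u) =
      mvfderiv I f ((extChartAt I x).symm u) (X ((extChartAt I x).symm u)) := by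
  have h1 : MDiffAt (extChartAt I x).symm u := by
    have := mdifferentiableWithinAt_extChartAt_symm hu
    rwa [I.range_eq_univ, mdifferentiableWithinAt_univ] at this
  have h2 := isInvertible_mfderivWithin_extChartAt_symm (I := I) hu
  rw [← mfderiv_eq_fderiv, mfderiv_comp u hf h1, mpullbackWithin_apply, I.range_eq_univ,
    mfderivWithin_univ]
  rw [I.range_eq_univ, mfderivWithin_univ] at h2
  change mfderiv I 𝓘(ℝ, ℝ) f _ (mfderiv 𝓘(ℝ, E) I (extChartAt I x).symm u
    ((mfderiv 𝓘(ℝ, E) I (extChartAt I x).symm u).inverse _)) = _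
  rw [h2.self_apply_inverse]
  rfl

/-- A vector field read in the chart at `x`. -/
noncomputable def chartField (I : ModelWithCorners ℝ E H) {M : Type*} [TopologicalSpace M]
    [ChartedSpace H M] (X : Π y : M, TangentSpace I y) (x : M) : E → E :=
  mpullbackWithin 𝓘(ℝ, E) I (extChartAt I x).symm X (Set.range I)

/-- The Lie bracket of vector fields is the commutator of the derivatives along them. -/
theorem mvfderiv_mlieBracket {f : M → ℝ} {X Y : Π y : M, TangentSpace I y} {x : M}
    (hf : CMDiffAt ∞ f x) (hX : CMDiffAt ∞ (T% X) x) (hY : CMDiffAt ∞ (T% Y) x) :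
    mvfderiv I f x (mlieBracket I X Y x) =
      mvfderiv I (fun y ↦ mvfderiv I f y (Y y)) x (X x)
        - mvfderiv I (fun y ↦ mvfderiv I f y (X y)) x (Y x) := by
  set φ := extChartAt I x with hφ
  have hx : φ x ∈ φ.target := mem_extChartAt_target x
  have hφx : φ.symm (φ x) = x := extChartAt_to_inv x
  have hφc : Filter.Tendsto φ.symm (𝓝 (φ x)) (𝓝 x) := by
    have := continuousAt_extChartAt_symm (I := I) x
    rwa [ContinuousAt, extChartAt_to_inv] at this
  have htarget : ∀ᶠ u in 𝓝 (φ x), u ∈ φ.target := extChartAt_target_mem_nhds x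
  have hfd : ∀ᶠ u in 𝓝 (φ x), MDiffAt f (φ.symm u) := hφc (mdifferentiableAt_of_smooth hf)
  set f' : E → ℝ := f ∘ φ.symm with hf'
  have hsmooth : ContDiffAt ℝ ∞ f' (φ x) := by
    have := (contMDiffAt_iff.1 hf).2
    rw [I.range_eq_univ, contDiffWithinAt_univ] at this
    exact this
  have hfield {X : Π y : M, TangentSpace I y} (hX : CMDiffAt ∞ (T% X) x) :
      DifferentiableAt ℝ (chartField I X x) (φ x) := by
    have h := (mdifferentiableAt_section_of_smooth hX).self_of_nhds
    have := (mdifferentiableWithinAt_univ.2 h).differentiableWithinAt_mpullbackWithin_vectorField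
    rw [Set.preimage_univ, Set.univ_inter] at this
    have h' : DifferentiableWithinAt ℝ (chartField I X x) (Set.range I) (φ x) := this
    rwa [I.range_eq_univ, differentiableWithinAt_univ] at h'
  have key {X Y : Π y : M, TangentSpace I y} (hX : CMDiffAt ∞ (T% X) x)
      (hY : CMDiffAt ∞ (T% Y) x) : mvfderiv I (fun y ↦ mvfderiv I f y (Y y)) x (X x) =
      fderiv ℝ (fderiv ℝ f') (φ x) (chartField I X x (φ x)) (chartField I Y x (φ x))
      + fderiv ℝ f' (φ x) (fderiv ℝ (chartField I Y x) (φ x) (chartField I X x (φ x))) := by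
    have h1 := fderiv_comp_extChartAt_symm X x hx (f := fun y ↦ mvfderiv I f y (Y y))
      (by
        rw [← hφ, hφx]
        exact (mdifferentiableAt_of_smooth (contMDiffAt_mvfderiv_apply hf hY)).self_of_nhds)
    rw [← hφ, hφx] at h1
    rw [← h1]
    have h2 : (fun y ↦ mvfderiv I f y (Y y)) ∘ φ.symm =ᶠ[𝓝 (φ x)]
        fun u ↦ fderiv ℝ f' u (chartField I Y x u) := by
      filter_upwards [htarget, hfd] with u hu hfu
      exact (fderiv_comp_extChartAt_symm Y x hu hfu).symm
    rw [h2.fderiv_eq]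
    have h3 : DifferentiableAt ℝ (fderiv ℝ f') (φ x) :=
      (hsmooth.fderiv_right (m := 1) (by norm_cast)).differentiableAt one_ne_zero
    rw [fderiv_clm_apply h3 (hfield hY)]
    exact add_comm _ _
  rw [key hX hY, key hY hX]
  have hsym : IsSymmSndFDerivAt ℝ f' (φ x) :=
    hsmooth.isSymmSndFDerivAt (by rw [minSmoothness_of_isRCLikeNormedField]; norm_cast)
  rw [hsym.eq (chartField I X x (φ x)) (chartField I Y x (φ x))]
  have h0 : mvfderiv I f x (mlieBracket I X Y x) = fderiv ℝ f' (φ x)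
      (lieBracket ℝ (chartField I X x) (chartField I Y x) (φ x)) := by
    have h := fderiv_comp_extChartAt_symm (mlieBracket I X Y) x hx (f := f)
      (by rw [← hφ, hφx]; exact (mdifferentiableAt_of_smooth hf).self_of_nhds)
    rw [← hφ, hφx] at h
    rw [← h]
    have h2 : CMDiffAt 2 φ.symm (φ x) := by
      have := contMDiffWithinAt_extChartAt_symm_range (I := I) (n := 2) x hx
      rwa [I.range_eq_univ, contMDiffWithinAt_univ] at this
    have hpb (Z : Π y : M, TangentSpace I y) :
        mpullbackWithin 𝓘(ℝ, E) I φ.symm Z (Set.range I) = mpullback 𝓘(ℝ, E) I φ.symm Z := by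
      rw [I.range_eq_univ, mpullbackWithin_univ]
    have h3 : mpullbackWithin 𝓘(ℝ, E) I φ.symm (mlieBracket I X Y) (Set.range I) (φ x) =
        (lieBracket ℝ (chartField I X x) (chartField I Y x) (φ x) : E) := by
      have : IsManifold I (minSmoothness ℝ 3) M := by
        rw [minSmoothness_of_isRCLikeNormedField]
        exact IsManifold.of_le (n := ∞) (by norm_cast)
      rw [hpb, mpullback_mlieBracket (n := 2)
        (by rw [hφx]; exact (mdifferentiableAt_section_of_smooth hX).self_of_nhds)
        (by rw [hφx]; exact (mdifferentiableAt_section_of_smooth hY).self_of_nhds) h2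
        (by rw [minSmoothness_of_isRCLikeNormedField]), ← hpb, ← hpb, ← mlieBracketWithin_univ,
        mlieBracketWithin_eq_lieBracketWithin]
      exact congrFun lieBracketWithin_univ (φ x)
    exact congrArg _ h3
  rw [h0, lieBracket, map_sub]
  ring

end VectorFields

end AQH

namespace AQH

/-! ### Smooth vector fields on a Riemannian manifold -/

section SmoothFields

variable {E : Type*} [NormedAddCommGroup E] [NormedSpace ℝ E] [FiniteDimensional ℝ E]
  {H : Type*} [TopologicalSpace H] {I : ModelWithCorners ℝ E H}
  {M : Type*} [TopologicalSpace M] [ChartedSpace H M] [IsManifold I ∞ M]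

/-- The constant vector field with value `u` on the model space. -/
def constField (u : E) : Π y : E, TangentSpace 𝓘(ℝ, E) y := fun _ ↦ u

/-- Near its base point, the extension of a tangent vector is a constant field in the chart. -/
theorem extend_eventuallyEq_mpullback {x : M} (v : TangentSpace I x) :
    (FiberBundle.extend E v : Π y : M, TangentSpace I y) =ᶠ[𝓝 x]
      mpullback I 𝓘(ℝ, E) (extChartAt I x)
        (constField ((trivializationAt E (TangentSpace I) x) ⟨x, v⟩).2) := by
  filter_upwards [chart_source_mem_nhds H x] with y hy
  have h := TangentBundle.continuousLinearMapAt_trivializationAt (I := I) (𝕜 := ℝ) hy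
  have hy' : y ∈ (trivializationAt E (TangentSpace I) x).baseSet := by simpa using hy
  have hinv := isInvertible_mfderiv_extChartAt (I := I) (x := x) (y := y)
    (by rwa [extChartAt_source])
  refine hinv.injective ?_
  change _ = mfderiv I 𝓘(ℝ, E) (extChartAt I x) y
    ((mfderiv I 𝓘(ℝ, E) (extChartAt I x) y).inverse _)
  rw [hinv.self_apply_inverse, ← h]
  have hs := (trivializationAt E (TangentSpace I) x).continuousLinearMapAt_symmL (R := ℝ) hy'
    ((trivializationAt E (TangentSpace I) x) ⟨x, v⟩).2
  have he : FiberBundle.extend E v y = (trivializationAt E (TangentSpace I) x).symmL ℝ y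
      ((trivializationAt E (TangentSpace I) x) ⟨x, v⟩).2 :=
    ((trivializationAt E (TangentSpace I) x).symmL_apply hy' _).symm
  exact (congrArg _ he).trans hs

/-- The extensions of two tangent vectors commute near the base point. -/
theorem mlieBracket_extend {x : M} (v w : TangentSpace I x) :
    ∀ᶠ y in 𝓝 x, mlieBracket I (FiberBundle.extend E v : Π y : M, TangentSpace I y)
      (FiberBundle.extend E w) y = 0 := by
  have h := (extend_eventuallyEq_mpullback v).mlieBracket_vectorField
    (extend_eventuallyEq_mpullback w)
  filter_upwards [h, chart_source_mem_nhds H x] with y hy hys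
  have : IsManifold I (minSmoothness ℝ 3) M := by
    rw [minSmoothness_of_isRCLikeNormedField]
    exact IsManifold.of_le (n := ∞) (by norm_cast)
  have hc (u : E) (p : E) : MDiffAt (T% (constField u)) p :=
    ((contMDiffAt_vectorSpace_iff_contDiffAt (n := 1)).2 contDiffAt_const).mdifferentiableAt
      one_ne_zero
  have h0 (u u' : E) : mlieBracket 𝓘(ℝ, E) (constField u) (constField u') = 0 := by
    rw [← mlieBracketWithin_univ, mlieBracketWithin_eq_lieBracketWithin]
    ext p
    change lieBracketWithin ℝ (fun _ : E ↦ u) (fun _ : E ↦ u') Set.univ p = (0 : E)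
    simp [lieBracketWithin]
  rw [hy, ← mpullback_mlieBracket (n := 2) (hc _ _) (hc _ _) (contMDiffAt_extChartAt' hys)
    (by rw [minSmoothness_of_isRCLikeNormedField]), h0, mpullback_zero]
  rfl

variable [RiemannianBundle (fun x : M ↦ TangentSpace I x)]
  [IsContMDiffRiemannianBundle I ∞ E (fun x : M ↦ TangentSpace I x)]

theorem contMDiffAt_inner {X Y : Π y : M, TangentSpace I y} {x : M}
    (hX : CMDiffAt ∞ (T% X) x) (hY : CMDiffAt ∞ (T% Y) x) :
    CMDiffAt ∞ (fun y ↦ inner ℝ (X y) (Y y)) x :=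
  ContMDiffAt.inner_bundle (F := E) (E := fun x : M ↦ TangentSpace I x)
    (IB := I) (b := fun y ↦ y) hX hY

theorem contMDiffAt_det {ι : Type*} [Fintype ι] [DecidableEq ι] {B : M → Matrix ι ι ℝ} {x : M}
    (hB : ∀ i j, CMDiffAt ∞ (fun y ↦ B y i j) x) : CMDiffAt ∞ (fun y ↦ (B y).det) x := by
  simp only [Matrix.det_apply']
  refine contMDiffAt_finsetSum fun σ _ ↦ contMDiffAt_const.mul ?_
  exact contMDiffAt_finsetProd fun i _ ↦ hB _ _

/-- A vector field is smooth as soon as its inner products with smooth vector fields are: its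
coefficients in a frame are found from those by Cramer's rule for the Gram matrix. -/
theorem contMDiffAt_section_of_inner {S : Π y : M, TangentSpace I y} {x : M}
    (hS : ∀ Z : Π y : M, TangentSpace I y, CMDiffAt ∞ (T% Z) x →
      CMDiffAt ∞ (fun y ↦ inner ℝ (S y) (Z y)) x) : CMDiffAt ∞ (T% S) x := by
  let t := trivializationAt E (fun x : M ↦ TangentSpace I x) x
  let b := Module.finBasis ℝ E
  have hx : x ∈ t.baseSet := FiberBundle.mem_baseSet_trivializationAt' x
  have he i : CMDiffAt ∞ (T% (t.localFrame b i)) x := contMDiffAt_localFrame_of_mem _ _ _ i hx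
  let B (y : M) : Matrix (Fin (Module.finrank ℝ E)) (Fin (Module.finrank ℝ E)) ℝ :=
    Matrix.of fun i j ↦ inner ℝ (t.localFrame b i y) (t.localFrame b j y)
  have hB i j : CMDiffAt ∞ (fun y ↦ B y i j) x := contMDiffAt_inner (he i) (he j)
  have hadj i j : CMDiffAt ∞ (fun y ↦ (B y).adjugate i j) x := by
    simp only [Matrix.adjugate_apply]
    refine contMDiffAt_det fun k l ↦ ?_
    simp only [Matrix.updateRow_apply]
    split_ifs
    · exact contMDiffAt_const
    · exact hB _ _
  have hdet : ∀ y ∈ t.baseSet, (B y).det ≠ 0 := by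
    intro y hy
    refine Matrix.det_gram_ne_zero_iff_linearIndependent (𝕜 := ℝ)
      (v := fun i ↦ t.localFrame b i y) |>.2 ?_
    exact (t.isLocalFrameOn_localFrame_baseSet I 1 b).linearIndependent hy
  have hcoeff (i) : ∀ᶠ y in 𝓝 x, t.localFrameCoeff I b i y (S y) =
      (B y).det⁻¹ * ∑ j, (B y).adjugate i j * inner ℝ (S y) (t.localFrame b j y) := by
    filter_upwards [t.open_baseSet.mem_nhds hx] with y hy
    set c : Fin (Module.finrank ℝ E) → ℝ := fun k ↦ t.localFrameCoeff I b k y (S y) with hc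
    have h1 (j) : inner ℝ (S y) (t.localFrame b j y) = (Matrix.mulVec (B y) c) j := by
      conv_lhs => rw [t.eq_sum_localFrameCoeff_smul (I := I) (b := b) (s := S) hy]
      simp only [sum_inner, inner_smul_left, Matrix.mulVec, dotProduct]
      refine Finset.sum_congr rfl fun k _ ↦ ?_
      simp [B, c, mul_comm, real_inner_comm]
    have h2 : ∑ j, (B y).adjugate i j * inner ℝ (S y) (t.localFrame b j y) =
        (B y).det * c i := by
      simp only [h1]
      change (Matrix.mulVec (B y).adjugate (Matrix.mulVec (B y) c)) i = _
      rw [Matrix.mulVec_mulVec, Matrix.adjugate_mul, Matrix.smul_mulVec, Matrix.one_mulVec]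
      rfl
    rw [h2, inv_mul_cancel_left₀ (hdet y hy)]
  rw [contMDiffAt_iff_localFrameCoeff (e := t) b hx]
  intro i
  refine ContMDiffAt.congr_of_eventuallyEq ?_ (hcoeff i)
  refine ContMDiffAt.mul ((contMDiffAt_det hB).inv₀ (hdet x hx)) ?_
  exact contMDiffAt_finsetSum fun j _ ↦ (hadj i j).mul (hS _ (he j))

/-- By the Koszul formula the inner products of `∇_X Y` with smooth fields are smooth. -/
theorem contMDiffAt_leviCivita {X Y : Π y : M, TangentSpace I y} {x : M}
    (hX : CMDiffAt ∞ (T% X) x) (hY : CMDiffAt ∞ (T% Y) x) :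
    CMDiffAt ∞ (T% (fun y ↦ leviCivita I Y y (X y))) x := by
  refine contMDiffAt_section_of_inner fun Z hZ ↦ ?_
  have h : (fun y ↦ inner ℝ (leviCivita I Y y (X y)) (Z y)) =ᶠ[𝓝 x] koszul I X Y Z := by
    filter_upwards [mdifferentiableAt_section_of_smooth hX, mdifferentiableAt_section_of_smooth hY,
      mdifferentiableAt_section_of_smooth hZ] with y h1 h2 h3
    exact inner_leviCivitaFun I h1 h2 h3
  refine ContMDiffAt.congr_of_eventuallyEq ?_ h
  have d {X Y Z : Π y : M, TangentSpace I y} (hX : CMDiffAt ∞ (T% X) x)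
    (hY : CMDiffAt ∞ (T% Y) x) (hZ : CMDiffAt ∞ (T% Z) x) :=
    contMDiffAt_mvfderiv_apply (contMDiffAt_inner hY hZ) hX
  have l {X Y Z : Π y : M, TangentSpace I y} (hX : CMDiffAt ∞ (T% X) x)
    (hY : CMDiffAt ∞ (T% Y) x) (hZ : CMDiffAt ∞ (T% Z) x) :=
    contMDiffAt_inner (contMDiffAt_mlieBracket hX hY) hZ
  exact contMDiffAt_const.mul ((((((d hX hY hZ).add (d hY hX hZ)).sub (d hZ hX hY)).add
    (l hX hY hZ)).sub (l hX hZ hY)).sub (l hY hZ hX))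

end SmoothFields

end AQH

namespace AQH

/-! ### The curvature tensor -/

section Curvature

variable {E : Type*} [NormedAddCommGroup E] [NormedSpace ℝ E] [FiniteDimensional ℝ E]
  {H : Type*} [TopologicalSpace H] {I : ModelWithCorners ℝ E H}
  {M : Type*} [TopologicalSpace M] [ChartedSpace H M] [IsManifold I ∞ M]
  [RiemannianBundle (fun x : M ↦ TangentSpace I x)]
  [IsContMDiffRiemannianBundle I ∞ E (fun x : M ↦ TangentSpace I x)]

theorem contMDiffAt_extend {x : M} (v : TangentSpace I x) :
    CMDiffAt ∞ (T% (FiberBundle.extend E v : Π y : M, TangentSpace I y)) x :=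
  FiberBundle.contMDiffAt_extend I E v

theorem mdiffAt_of_smooth {X : Π y : M, TangentSpace I y} {x : M}
    (hX : CMDiffAt ∞ (T% X) x) : MDiffAt (T% X) x :=
  (mdifferentiableAt_section_of_smooth hX).self_of_nhds

theorem mvfderiv_congr {f g : M → ℝ} {x : M} (h : f =ᶠ[𝓝 x] g) :
    mvfderiv I f x = mvfderiv I g x := by
  ext v
  change mfderiv I 𝓘(ℝ, ℝ) f x v = mfderiv I 𝓘(ℝ, ℝ) g x v
  rw [h.mfderiv_eq]
  rfl

theorem leviCivita_congr {Y Y' : Π y : M, TangentSpace I y} {x : M} (hY : CMDiffAt ∞ (T% Y) x)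
    (hY' : CMDiffAt ∞ (T% Y') x) (h : ∀ᶠ y in 𝓝 x, Y y = Y' y) :
    leviCivita I Y x = leviCivita I Y' x :=
  (leviCivita I).isCovariantDerivativeOnUniv.congr_of_eventuallyEq (mdiffAt_of_smooth hY)
    (mdiffAt_of_smooth hY') Filter.univ_mem h

theorem leviCivita_add {Y Y' : Π y : M, TangentSpace I y} {x : M} (hY : MDiffAt (T% Y) x)
    (hY' : MDiffAt (T% Y') x) : leviCivita I (Y + Y') x = leviCivita I Y x + leviCivita I Y' x :=
  (leviCivita I).isCovariantDerivativeOnUniv.add hY hY'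

theorem leviCivita_sub {Y Y' : Π y : M, TangentSpace I y} {x : M} (hY : MDiffAt (T% Y) x)
    (hY' : MDiffAt (T% Y') x) : leviCivita I (Y - Y') x = leviCivita I Y x - leviCivita I Y' x := by
  have h := leviCivita_add (mdifferentiableAt_sub_section hY hY') hY'
  rw [sub_add_cancel] at h
  rw [h, add_sub_cancel_right]

theorem leviCivita_sub_comm {X Y : Π y : M, TangentSpace I y} {x : M} (hX : MDiffAt (T% X) x)
    (hY : MDiffAt (T% Y) x) :
    leviCivita I Y x (X x) - leviCivita I X x (Y x) = mlieBracket I X Y x :=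
  (leviCivita I).torsion_eq_zero_iff.1 (leviCivita_torsion I) hX hY

/-- `∇_[X,Y] Z - ∇_X ∇_Y Z + ∇_Y ∇_X Z`. -/
noncomputable def curvatureField (X Y Z : Π y : M, TangentSpace I y) (y : M) : TangentSpace I y :=
  leviCivita I Z y (mlieBracket I X Y y)
    - leviCivita I (fun y ↦ leviCivita I Z y (Y y)) y (X y)
    + leviCivita I (fun y ↦ leviCivita I Z y (X y)) y (Y y)

theorem curvature_eq_extend (x : M) (v w z u : TangentSpace I x) :
    curvature I x v w z u =
      inner ℝ (curvatureField (FiberBundle.extend E v : Π y : M, TangentSpace I y)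
        (FiberBundle.extend E w) (FiberBundle.extend E z) x) u := by
  simp [curvature, curvatureField]

theorem curvatureField_swap (X Y Z : Π y : M, TangentSpace I y) (x : M) :
    curvatureField X Y Z x = -curvatureField Y X Z x := by
  rw [curvatureField, curvatureField, mlieBracket_swap_apply, map_neg]
  abel

variable {X Y Z W : Π y : M, TangentSpace I y} {x : M}

theorem curvatureField_bianchi (hX : CMDiffAt ∞ (T% X) x) (hY : CMDiffAt ∞ (T% Y) x)
    (hZ : CMDiffAt ∞ (T% Z) x) :
    curvatureField X Y Z x + curvatureField Y Z X x + curvatureField Z X Y x = 0 := by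
  have key {X Y Z : Π y : M, TangentSpace I y} (hX : CMDiffAt ∞ (T% X) x)
      (hY : CMDiffAt ∞ (T% Y) x) (hZ : CMDiffAt ∞ (T% Z) x) :
      leviCivita I (fun y ↦ leviCivita I Z y (Y y)) x (X x)
        - leviCivita I (fun y ↦ leviCivita I Y y (Z y)) x (X x) =
      leviCivita I X x (mlieBracket I Y Z x) + mlieBracket I X (mlieBracket I Y Z) x := by
    have hYZ := contMDiffAt_mlieBracket hY hZ
    have h1 := leviCivita_sub (mdiffAt_of_smooth (contMDiffAt_leviCivita hY hZ))
      (mdiffAt_of_smooth (contMDiffAt_leviCivita hZ hY))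
    have h2 := leviCivita_congr (x := x)
      ((contMDiffAt_leviCivita hY hZ).sub_section (contMDiffAt_leviCivita hZ hY)) hYZ (by
        filter_upwards [mdifferentiableAt_section_of_smooth hY,
          mdifferentiableAt_section_of_smooth hZ] with y h1 h2
        exact leviCivita_sub_comm h1 h2)
    rw [h1] at h2
    rw [← leviCivita_sub_comm (mdiffAt_of_smooth hX) (mdiffAt_of_smooth hYZ), ← h2]
    simp
  have : IsManifold I (minSmoothness ℝ 3) M := by
    rw [minSmoothness_of_isRCLikeNormedField]
    exact IsManifold.of_le (n := ∞) (by norm_cast)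
  have h2 : minSmoothness ℝ 2 ≤ ∞ := by rw [minSmoothness_of_isRCLikeNormedField]; norm_cast
  have hJ := leibniz_identity_mlieBracket_apply (hX.of_le h2) (hY.of_le h2) (hZ.of_le h2)
  rw [mlieBracket_swap_apply (V := mlieBracket I X Y) (W := Z), mlieBracket_swap (V := X) (W := Z)]
    at hJ
  have hn : mlieBracket I Y (-mlieBracket I Z X) x = -mlieBracket I Y (mlieBracket I Z X) x := by
    have h := mlieBracket_const_smul_right (c := (-1 : ℝ)) (V := Y)
      (mdiffAt_of_smooth (contMDiffAt_mlieBracket hZ hX))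
    simpa using h
  rw [hn] at hJ
  have e1 := key hX hY hZ
  have e2 := key hY hZ hX
  have e3 := key hZ hX hY
  have hs : leviCivita I (fun y ↦ leviCivita I Z y (Y y)) x (X x)
        - leviCivita I (fun y ↦ leviCivita I Y y (Z y)) x (X x)
      + (leviCivita I (fun y ↦ leviCivita I X y (Z y)) x (Y x)
        - leviCivita I (fun y ↦ leviCivita I Z y (X y)) x (Y x))
      + (leviCivita I (fun y ↦ leviCivita I Y y (X y)) x (Z x)
        - leviCivita I (fun y ↦ leviCivita I X y (Y y)) x (Z x)) =
      leviCivita I X x (mlieBracket I Y Z x) + leviCivita I Y x (mlieBracket I Z X x)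
        + leviCivita I Z x (mlieBracket I X Y x) := by
    rw [e1, e2, e3, hJ]
    abel
  simp only [curvatureField]
  rw [← sub_eq_zero] at hs
  rw [← neg_eq_zero, ← hs]
  abel

variable [I.Boundaryless]

/-- Apply `[X, Y] - XY + YX = 0` to the function `⟨Z, W⟩` and use that `∇` is metric. -/
theorem inner_curvatureField_skew (hX : CMDiffAt ∞ (T% X) x) (hY : CMDiffAt ∞ (T% Y) x)
    (hZ : CMDiffAt ∞ (T% Z) x) (hW : CMDiffAt ∞ (T% W) x) :
    inner ℝ (curvatureField X Y Z x) (W x) = -inner ℝ (Z x) (curvatureField X Y W x) := by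
  have key {X Y : Π y : M, TangentSpace I y} (hX : CMDiffAt ∞ (T% X) x)
      (hY : CMDiffAt ∞ (T% Y) x) :
      mvfderiv I (fun y ↦ mvfderiv I (fun y ↦ inner ℝ (Z y) (W y)) y (Y y)) x (X x) =
        inner ℝ (leviCivita I (fun y ↦ leviCivita I Z y (Y y)) x (X x)) (W x)
        + inner ℝ (leviCivita I Z x (Y x)) (leviCivita I W x (X x))
        + (inner ℝ (leviCivita I Z x (X x)) (leviCivita I W x (Y x))
        + inner ℝ (Z x) (leviCivita I (fun y ↦ leviCivita I W y (Y y)) x (X x))) := by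
    have hYZ := contMDiffAt_leviCivita hY hZ
    have hYW := contMDiffAt_leviCivita hY hW
    have h1 : (fun y ↦ mvfderiv I (fun y ↦ inner ℝ (Z y) (W y)) y (Y y)) =ᶠ[𝓝 x]
        (fun y ↦ inner ℝ (leviCivita I Z y (Y y)) (W y))
          + fun y ↦ inner ℝ (Z y) (leviCivita I W y (Y y)) := by
      filter_upwards [mdifferentiableAt_section_of_smooth hY,
        mdifferentiableAt_section_of_smooth hZ, mdifferentiableAt_section_of_smooth hW]
        with y h1 h2 h3
      exact leviCivita_metric I h1 h2 h3
    rw [mvfderiv_congr h1, mvfderiv_add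
      (mdifferentiableAt_of_smooth (contMDiffAt_inner hYZ hW)).self_of_nhds
      (mdifferentiableAt_of_smooth (contMDiffAt_inner hZ hYW)).self_of_nhds, add_apply,
      leviCivita_metric I (mdiffAt_of_smooth hX) (mdiffAt_of_smooth hYZ) (mdiffAt_of_smooth hW),
      leviCivita_metric I (mdiffAt_of_smooth hX) (mdiffAt_of_smooth hZ) (mdiffAt_of_smooth hYW)]
  have h0 := mvfderiv_mlieBracket (contMDiffAt_inner hZ hW) hX hY
  rw [leviCivita_metric I (mdiffAt_of_smooth (contMDiffAt_mlieBracket hX hY))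
    (mdiffAt_of_smooth hZ) (mdiffAt_of_smooth hW), key hX hY, key hY hX] at h0
  simp only [curvatureField, inner_add_left, inner_sub_left, inner_add_right, inner_sub_right]
  linarith

theorem inner_curvatureField_pair_symm (hX : CMDiffAt ∞ (T% X) x) (hY : CMDiffAt ∞ (T% Y) x)
    (hZ : CMDiffAt ∞ (T% Z) x) (hW : CMDiffAt ∞ (T% W) x) :
    inner ℝ (curvatureField X Y Z x) (W x) = inner ℝ (curvatureField Z W X x) (Y x) := by
  -- the classical octahedron: four Bianchi identities, combined with the skew symmetries
  have b {X Y Z : Π y : M, TangentSpace I y} (W : Π y : M, TangentSpace I y)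
      (hX : CMDiffAt ∞ (T% X) x) (hY : CMDiffAt ∞ (T% Y) x) (hZ : CMDiffAt ∞ (T% Z) x) :
      inner ℝ (curvatureField X Y Z x) (W x) + inner ℝ (curvatureField Y Z X x) (W x)
        + inner ℝ (curvatureField Z X Y x) (W x) = 0 := by
    rw [← inner_add_left, ← inner_add_left, curvatureField_bianchi hX hY hZ, inner_zero_left]
  have s (X Y Z W : Π y : M, TangentSpace I y) :
      inner ℝ (curvatureField X Y Z x) (W x) = -inner ℝ (curvatureField Y X Z x) (W x) := by
    rw [curvatureField_swap, inner_neg_left]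
  have k {X Y Z W : Π y : M, TangentSpace I y} (hX : CMDiffAt ∞ (T% X) x)
      (hY : CMDiffAt ∞ (T% Y) x) (hZ : CMDiffAt ∞ (T% Z) x) (hW : CMDiffAt ∞ (T% W) x) :
      inner ℝ (curvatureField X Y Z x) (W x) = -inner ℝ (curvatureField X Y W x) (Z x) := by
    rw [inner_curvatureField_skew hX hY hZ hW, real_inner_comm]
  have b1 := b W hX hY hZ
  have b2 := b X hY hZ hW
  have b3 := b Y hZ hW hX
  have b4 := b Z hW hX hY
  have k1 := k hX hY hZ hW
  have k2 := k hY hZ hX hW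
  have k3 := k hZ hX hY hW
  have k4 := k hZ hW hY hX
  have k5 := k hW hY hZ hX
  have k6 := k hW hX hZ hY
  have s1 := s X Y Z W
  have s2 := s Z X Y W
  have s3 := s Z X W Y
  have s4 := s W Y X Z
  have s5 := s W Y Z X
  have s6 := s X W Y Z
  have s7 := s W Z X Y
  have s8 := s X Y W Z
  linarith

/-- The curvature tensor may be computed with any smooth extensions of the four vectors. Skewness in
the last two slots lets the extension of the vector in the third slot be changed, and the symmetries
bring the first two slots into that position. -/
theorem curvature_apply (hX : CMDiffAt ∞ (T% X) x) (hY : CMDiffAt ∞ (T% Y) x)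
    (hZ : CMDiffAt ∞ (T% Z) x) (w : TangentSpace I x) :
    curvature I x (X x) (Y x) (Z x) w = inner ℝ (curvatureField X Y Z x) w := by
  have k {X Y Z Z' W : Π y : M, TangentSpace I y} (hX : CMDiffAt ∞ (T% X) x)
      (hY : CMDiffAt ∞ (T% Y) x) (hZ : CMDiffAt ∞ (T% Z) x) (hZ' : CMDiffAt ∞ (T% Z') x)
      (hW : CMDiffAt ∞ (T% W) x) (h : Z x = Z' x) :
      inner ℝ (curvatureField X Y Z x) (W x) = inner ℝ (curvatureField X Y Z' x) (W x) := by
    rw [inner_curvatureField_skew hX hY hZ hW, inner_curvatureField_skew hX hY hZ' hW, h]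
  have ext (v : TangentSpace I x) := contMDiffAt_extend v
  rw [curvature_eq_extend]
  have hw : w = (FiberBundle.extend E w : Π y : M, TangentSpace I y) x := by simp
  conv_lhs => rw [hw]
  conv_rhs => rw [hw]
  rw [k (ext _) (ext _) (ext _) hZ (ext w) (by simp),
    inner_curvatureField_pair_symm (ext _) (ext _) hZ (ext w),
    k hZ (ext w) (ext _) hX (ext _) (by simp),
    inner_curvatureField_pair_symm hZ (ext w) hX (ext _), curvatureField_swap, inner_neg_left,
    inner_curvatureField_pair_symm (ext _) hX hZ (ext w),
    k hZ (ext w) (ext _) hY hX (by simp),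
    ← inner_curvatureField_pair_symm hY hX hZ (ext w), curvatureField_swap, inner_neg_left,
    neg_neg]

theorem curvature_mem (x : M) : curvature I x ∈ curvatureTensors (TangentSpace I x) := by
  have ext (v : TangentSpace I x) := contMDiffAt_extend v
  have h1 (v w z u : TangentSpace I x) : curvature I x v w z u = -curvature I x w v z u := by
    rw [curvature_eq_extend, curvatureField_swap, inner_neg_left, curvature_eq_extend]
  have h2 (v w z u : TangentSpace I x) : curvature I x v w z u = curvature I x z u v w := by
    have h := inner_curvatureField_pair_symm (ext v) (ext w) (ext z) (ext u)
    simpa [curvature_eq_extend] using h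
  have h3 (v w z u : TangentSpace I x) :
      curvature I x v w z u + curvature I x w z v u + curvature I x z v w u = 0 := by
    rw [curvature_eq_extend, curvature_eq_extend, curvature_eq_extend, ← inner_add_left,
      ← inner_add_left, curvatureField_bianchi (ext v) (ext w) (ext z), inner_zero_left]
  have h4 (v w z u : TangentSpace I x) : curvature I x v w z u = -curvature I x z u w v := by
    rw [h1, h2]
  refine ⟨fun v v' w z u ↦ ?_, fun t v w z u ↦ ?_, h1, h2, h3⟩
  · rw [h4, h4 v, h4 v', curvature_eq_extend, curvature_eq_extend, curvature_eq_extend,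
      inner_add_right, neg_add]
  · rw [h4, h4 v, curvature_eq_extend, curvature_eq_extend, inner_smul_right, mul_neg]

end Curvature

end AQH

namespace AQH

/-! ### The connection on a quaternionic Kähler structure -/

section EndomorphismFields

variable {E : Type*} [NormedAddCommGroup E] [NormedSpace ℝ E] [FiniteDimensional ℝ E]
  {H : Type*} [TopologicalSpace H] {I : ModelWithCorners ℝ E H}
  {M : Type*} [TopologicalSpace M] [ChartedSpace H M] [IsManifold I ∞ M]

/-- The field `A` of endomorphisms of the tangent spaces is smooth at `x`. -/
def SmoothEndAt (I : ModelWithCorners ℝ E H) {M : Type*} [TopologicalSpace M] [ChartedSpace H M]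
    [IsManifold I ∞ M] (A : Π x : M, TangentSpace I x →L[ℝ] TangentSpace I x) (x : M) : Prop :=
  ContMDiffAt I (I.prod 𝓘(ℝ, E →L[ℝ] E)) ∞
    (fun x ↦ TotalSpace.mk' (E →L[ℝ] E)
      (E := fun x : M ↦ TangentSpace I x →L[ℝ] TangentSpace I x) x (A x)) x

variable {A : Π x : M, TangentSpace I x →L[ℝ] TangentSpace I x} {x : M}

theorem SmoothEndAt.apply (hA : SmoothEndAt I A x) {Y : Π y : M, TangentSpace I y}
    (hY : CMDiffAt ∞ (T% Y) x) : CMDiffAt ∞ (T% (fun y ↦ A y (Y y))) x :=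
  ContMDiffAt.clm_bundle_apply (F₁ := E) (F₂ := E) (b := fun y ↦ y) hA hY

theorem SmoothEndAt.mdiffAt_apply (hA : SmoothEndAt I A x) {Y : Π y : M, TangentSpace I y}
    (hY : MDiffAt (T% Y) x) : MDiffAt (T% (fun y ↦ A y (Y y))) x :=
  MDifferentiableAt.clm_bundle_apply (F₁ := E) (F₂ := E) (b := fun y ↦ y)
    (ContMDiffAt.mdifferentiableAt hA (by simp)) hY

variable [RiemannianBundle (fun x : M ↦ TangentSpace I x)]
  [IsContMDiffRiemannianBundle I ∞ E (fun x : M ↦ TangentSpace I x)]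

theorem covDerivEnd_apply (hA : SmoothEndAt I A x) {Y : Π y : M, TangentSpace I y}
    (hY : MDiffAt (T% Y) x) (v : TangentSpace I x) :
    covDerivEnd I A x v (Y x) =
      leviCivita I (fun y ↦ A y (Y y)) x v - A x (leviCivita I Y x v) := by
  have ht : TensorialAt I E (fun Y : Π y : M, TangentSpace I y ↦
      leviCivita I (fun y ↦ A y (Y y)) x v - A x (leviCivita I Y x v)) x := by
    constructor
    · intro f Y hf hY
      have e : (fun y ↦ A y ((f • Y) y)) = f • fun y ↦ A y (Y y) := by
        ext y; simp
      rw [e, (leviCivita I).isCovariantDerivativeOnUniv.leibniz (hA.mdiffAt_apply hY) hf,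
        (leviCivita I).isCovariantDerivativeOnUniv.leibniz hY hf]
      simp
      module
    · intro Y Y' hY hY'
      have e : (fun y ↦ A y ((Y + Y') y)) = (fun y ↦ A y (Y y)) + fun y ↦ A y (Y' y) := by
        ext y; simp
      rw [e, leviCivita_add (hA.mdiffAt_apply hY) (hA.mdiffAt_apply hY'), leviCivita_add hY hY']
      simp
      abel
  exact ht.pointwise (mdiffAt_of_smooth (contMDiffAt_extend _)) hY (by simp)

theorem covDerivForm_kahlerForm (hA : SmoothEndAt I A x) (v y z : TangentSpace I x) :
    covDerivForm I (fun y ↦ kahlerForm (A y)) x v y z = inner ℝ y (covDerivEnd I A x v z) := by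
  have hy := mdiffAt_of_smooth (contMDiffAt_extend y)
  have hz := mdiffAt_of_smooth (contMDiffAt_extend z)
  have hv := mdiffAt_of_smooth (contMDiffAt_extend v)
  have h := leviCivita_metric I hv hy (hA.mdiffAt_apply hz)
  simp only [FiberBundle.extend_apply_self] at h
  simp only [covDerivForm, covDerivEnd, kahlerForm, h, inner_sub_right]
  ring

theorem IsLocalAdaptedBasis.smoothAt
    {G : Π x : M, Submodule ℝ (TangentSpace I x →L[ℝ] TangentSpace I x)} {U : Set M}
    {A : Fin 3 → Π x : M, TangentSpace I x →L[ℝ] TangentSpace I x}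
    (hA : IsLocalAdaptedBasis I G U A) (hx : x ∈ U) (a : Fin 3) : SmoothEndAt I (A a) x :=
  (hA.smooth a).contMDiffAt (hA.isOpen.mem_nhds hx)

theorem IsLocalAdaptedBasis.mem_nhds
    {G : Π x : M, Submodule ℝ (TangentSpace I x →L[ℝ] TangentSpace I x)} {U : Set M}
    {A : Fin 3 → Π x : M, TangentSpace I x →L[ℝ] TangentSpace I x}
    (hA : IsLocalAdaptedBasis I G U A) (hx : x ∈ U) : ∀ᶠ y in 𝓝 x, y ∈ U :=
  hA.isOpen.mem_nhds hx

end EndomorphismFields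

section Connection

variable {E : Type*} [NormedAddCommGroup E] [NormedSpace ℝ E] [FiniteDimensional ℝ E]
  {H : Type*} [TopologicalSpace H] {I : ModelWithCorners ℝ E H}
  {M : Type*} [TopologicalSpace M] [ChartedSpace H M] [IsManifold I ∞ M]
  [RiemannianBundle (fun x : M ↦ TangentSpace I x)]
  [IsContMDiffRiemannianBundle I ∞ E (fun x : M ↦ TangentSpace I x)]
  {G : Π x : M, Submodule ℝ (TangentSpace I x →L[ℝ] TangentSpace I x)}
  {U : Set M} {A : Fin 3 → Π x : M, TangentSpace I x →L[ℝ] TangentSpace I x} {x : M}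

/-- The connection preserves the bundle `G`: if this holds for one local adapted basis, then it
does for any other, the coefficients of the change of basis being smooth. -/
theorem IsQuaternionicKahler.exists_covDerivEnd_mem [Nontrivial E] (hG : IsQuaternionicKahler I G)
    (hA : IsLocalAdaptedBasis I G U A) (hx : x ∈ U) (a : Fin 3) (v : TangentSpace I x) :
    ∃ C ∈ G x, ∀ y, covDerivEnd I (A a) x v y = C y := by
  obtain ⟨U₀, B, hx₀, hB, μ, hμ⟩ := hG.2 x
  obtain ⟨z, hz⟩ : ∃ z : TangentSpace I x, z ≠ 0 := exists_ne (α := E) 0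
  let Z : Π y : M, TangentSpace I y := FiberBundle.extend E z
  have hZ : CMDiffAt ∞ (T% Z) x := contMDiffAt_extend z
  have hZx : inner ℝ (Z x) (Z x) ≠ (0 : ℝ) := by
    simp only [Z, FiberBundle.extend_apply_self]
    exact inner_self_ne_zero.2 hz
  -- the coefficients of `A a` in the basis `B`, read off from the values on `Z`
  let g (b : Fin 3) (y : M) : ℝ := inner ℝ (A a y (Z y)) (B b y (Z y)) / inner ℝ (Z y) (Z y)
  have hg (b) : MDiffAt (g b) x :=
    (mdifferentiableAt_of_smooth ((contMDiffAt_inner ((hA.smoothAt hx a).apply hZ)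
      ((hB.smoothAt hx₀ b).apply hZ)).div₀ (contMDiffAt_inner hZ hZ) hZx)).self_of_nhds
  have hgA : ∀ᶠ y in 𝓝 x, A a y = ∑ b, g b y • B b y := by
    filter_upwards [hA.mem_nhds hx, hB.mem_nhds hx₀,
      (contMDiffAt_inner hZ hZ).continuousAt.eventually_ne hZx] with y hy hy₀ hyZ
    obtain ⟨m, hm⟩ := (hB.adapted y hy₀).mem_iff.1 ((hA.adapted y hy).mem a)
    have : ∀ b, g b y = m b := by
      intro b
      have h := (hB.adapted y hy₀).inner_sum_apply m b (Z y)
      rw [← hm] at h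
      simp only [g, h]
      exact mul_div_cancel_right₀ _ hyZ
    simp only [this]
    exact hm
  refine ⟨∑ b, (mvfderiv I (g b) x v • B b x
      + g b x • (μ (b + 2) x v • B (b + 1) x - μ (b + 1) x v • B (b + 2) x)),
    Submodule.sum_mem _ fun b _ ↦ Submodule.add_mem _ (Submodule.smul_mem _ _
      ((hB.adapted x hx₀).mem _)) (Submodule.smul_mem _ _ (Submodule.sub_mem _
      (Submodule.smul_mem _ _ ((hB.adapted x hx₀).mem _))
      (Submodule.smul_mem _ _ ((hB.adapted x hx₀).mem _)))), fun y ↦ ?_⟩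
  let Y : Π y : M, TangentSpace I y := FiberBundle.extend E y
  have hY : CMDiffAt ∞ (T% Y) x := contMDiffAt_extend y
  have hYx : Y x = y := by simp [Y]
  have hBY (b) : MDiffAt (T% (fun p ↦ B b p (Y p))) x :=
    (hB.smoothAt hx₀ b).mdiffAt_apply (mdiffAt_of_smooth hY)
  have hgBY (b) : MDiffAt (T% (g b • fun p ↦ B b p (Y p))) x := (hg b).smul_section (hBY b)
  have h1 : leviCivita I (fun p ↦ A a p (Y p)) x = leviCivita I
      ((g 0 • fun p ↦ B 0 p (Y p)) + (g 1 • fun p ↦ B 1 p (Y p))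
        + g 2 • fun p ↦ B 2 p (Y p)) x := by
    refine (leviCivita I).isCovariantDerivativeOnUniv.congr_of_eventuallyEq
      (mdiffAt_of_smooth ((hA.smoothAt hx a).apply hY))
      (mdifferentiableAt_add_section (mdifferentiableAt_add_section (hgBY 0) (hgBY 1)) (hgBY 2))
      Filter.univ_mem ?_
    filter_upwards [hgA] with p hp
    rw [hp, Fin.sum_univ_three]
    rfl
  rw [leviCivita_add (mdifferentiableAt_add_section (hgBY 0) (hgBY 1)) (hgBY 2),
    leviCivita_add (hgBY 0) (hgBY 1)] at h1
  have h2 (b) : leviCivita I (g b • fun p ↦ B b p (Y p)) x v =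
      g b x • (covDerivEnd I (B b) x v y + B b x (leviCivita I Y x v))
        + mvfderiv I (g b) x v • B b x y := by
    rw [(leviCivita I).isCovariantDerivativeOnUniv.leibniz (hBY b) (hg b), ← hYx,
      covDerivEnd_apply (hB.smoothAt hx₀ b) (mdiffAt_of_smooth hY)]
    simp
  conv_lhs => rw [← hYx]
  rw [covDerivEnd_apply (hA.smoothAt hx a) (mdiffAt_of_smooth hY), h1, add_apply, add_apply,
    h2, h2, h2, hμ x hx₀, hμ x hx₀, hμ x hx₀, hgA.self_of_nhds]
  simp only [Fin.sum_univ_three, add_apply, sub_apply, smul_apply]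
  module

/-- The covariant derivative of an adapted basis is given by the one-forms `λ_I, λ_J, λ_K`. -/
theorem IsQuaternionicKahler.covDerivEnd_eq {n : ℕ} (hn : 0 < n)
    (hE : Module.finrank ℝ E = 4 * n) (hG : IsQuaternionicKahler I G)
    (hA : IsLocalAdaptedBasis I G U A) (hx : x ∈ U) (a : Fin 3) (v y : TangentSpace I x) :
    covDerivEnd I (A a) x v y =
      lam I n A (a + 2) x v • A (a + 1) x y - lam I n A (a + 1) x v • A (a + 2) x y := by
  have : Nontrivial E := Module.nontrivial_of_finrank_pos (R := ℝ) (by omega)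
  have hAx := hA.adapted x hx
  choose D hD hDv using fun a ↦ hG.exists_covDerivEnd_mem hA hx a v
  obtain ⟨g, hg⟩ := hAx.exists_of_derivation D hD (by
    intro a b y
    let Y : Π y : M, TangentSpace I y := FiberBundle.extend E y
    have hY : CMDiffAt ∞ (T% Y) x := contMDiffAt_extend y
    have hYx : Y x = y := by simp [Y]
    have h1 (a b) : D a (A b x y) + A a x (D b y) =
        leviCivita I (fun p ↦ A a p (A b p (Y p))) x v - A a x (A b x (leviCivita I Y x v)) := by
      rw [← hDv, ← hDv, ← hYx, covDerivEnd_apply (hA.smoothAt hx a)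
        (Y := fun p ↦ A b p (Y p)) (mdiffAt_of_smooth ((hA.smoothAt hx b).apply hY)),
        covDerivEnd_apply (hA.smoothAt hx b) (mdiffAt_of_smooth hY), map_sub]
      abel
    have hs (a b) := mdiffAt_of_smooth ((hA.smoothAt hx a).apply ((hA.smoothAt hx b).apply hY))
    have h2 := leviCivita_add (hs a b) (hs b a)
    have h3 := (leviCivita I).isCovariantDerivativeOnUniv.congr_of_eventuallyEq
      (mdifferentiableAt_add_section (hs a b) (hs b a))
      (mdiffAt_of_smooth (hY.const_smul_section (a := if a = b then (-2 : ℝ) else 0)))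
      Filter.univ_mem (by
        filter_upwards [hA.mem_nhds hx] with p hp
        exact (hA.adapted p hp).anticomm a b (Y p))
    have h4 := (leviCivita I).isCovariantDerivativeOnUniv.smul_const
      (if a = b then (-2 : ℝ) else 0) (mdiffAt_of_smooth hY)
    have h5 := DFunLike.congr_fun (h2.symm.trans (h3.trans h4)) v
    have h6 := hAx.anticomm a b (leviCivita I Y x v)
    rw [← inner_add_left, ← inner_add_left, ← inner_add_left, h1, h1]
    have h7 : leviCivita I (fun p ↦ A a p (A b p (Y p))) x v - A a x (A b x (leviCivita I Y x v))
        + (leviCivita I (fun p ↦ A b p (A a p (Y p))) x v - A b x (A a x (leviCivita I Y x v)))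
        = 0 := by
      rw [add_apply, smul_apply, ← h6] at h5
      rw [sub_add_sub_comm, h5, sub_self]
    rw [h7, inner_zero_left])
  have hlam (a) : lam I n A a x v = g a := by
    have h : (covDerivForm I (fun y ↦ kahlerForm (A (a + 1) y)) x v) = fun y z ↦
        inner ℝ y (g a • A (a + 2) x z - g (a + 2) • A a x z) := by
      ext y z
      rw [covDerivForm_kahlerForm (hA.smoothAt hx _), hDv, hg]
      simp only [sub_apply, smul_apply]
      rw [fin3_add_one_add_two, fin3_add_one_add_one]
    have hf := formInner_kahlerForm hAx
      (F := fun y z ↦ inner ℝ y (g a • A (a + 2) x z - g (a + 2) • A a x z))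
      (fun y ↦ ⟨fun _ _ ↦ inner_add_left _ _ _, fun _ _ ↦ real_inner_smul_left _ _ _⟩) (a + 2)
    rw [lam, h, hf]
    have hne : a + 2 ≠ a := by fin_cases a <;> simp
    simp only [inner_sub_right, inner_smul_right, hAx.inner_apply_apply, if_true, if_neg hne,
      mul_zero, sub_zero, ← Finset.mul_sum, sum_inner_self]
    rw [show Module.finrank ℝ (TangentSpace I x) = 4 * n from hE]
    have : (n : ℝ) ≠ 0 := by exact_mod_cast hn.ne'
    push_cast
    field_simp
    ring
  rw [hDv, hg, hlam, hlam]
  rfl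

theorem IsQuaternionicKahler.leviCivita_apply {n : ℕ} (hn : 0 < n)
    (hE : Module.finrank ℝ E = 4 * n) (hG : IsQuaternionicKahler I G)
    (hA : IsLocalAdaptedBasis I G U A) (hx : x ∈ U) (a : Fin 3) {Y : Π y : M, TangentSpace I y}
    (hY : MDiffAt (T% Y) x) (v : TangentSpace I x) :
    leviCivita I (fun y ↦ A a y (Y y)) x v = A a x (leviCivita I Y x v)
      + (lam I n A (a + 2) x v • A (a + 1) x (Y x)
        - lam I n A (a + 1) x v • A (a + 2) x (Y x)) := by
  rw [← hG.covDerivEnd_eq hn hE hA hx, covDerivEnd_apply (hA.smoothAt hx a) hY]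
  abel

theorem IsQuaternionicKahler.lam_mul_inner {n : ℕ} (hn : 0 < n)
    (hE : Module.finrank ℝ E = 4 * n) (hG : IsQuaternionicKahler I G)
    (hA : IsLocalAdaptedBasis I G U A) (hx : x ∈ U) (a : Fin 3) {Y : Π y : M, TangentSpace I y}
    (hY : MDiffAt (T% Y) x) (v : TangentSpace I x) :
    lam I n A a x v * inner ℝ (Y x) (Y x) = inner ℝ (leviCivita I (fun y ↦ A (a + 1) y (Y y)) x v
      - A (a + 1) x (leviCivita I Y x v)) (A (a + 2) x (Y x)) := by
  have hne : a ≠ a + 2 := by fin_cases a <;> simp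
  rw [hG.leviCivita_apply hn hE hA hx _ hY, add_sub_cancel_left, fin3_add_one_add_two,
    fin3_add_one_add_one, inner_sub_left, real_inner_smul_left, real_inner_smul_left,
    (hA.adapted x hx).inner_apply_apply, (hA.adapted x hx).inner_apply_apply, if_pos rfl,
    if_neg hne]
  ring

theorem IsQuaternionicKahler.isLinearMap_lam {n : ℕ} (hn : 0 < n)
    (hE : Module.finrank ℝ E = 4 * n) (hG : IsQuaternionicKahler I G)
    (hA : IsLocalAdaptedBasis I G U A) (hx : x ∈ U) (a : Fin 3) :
    IsLinearMap ℝ (lam I n A a x) := by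
  have : Nontrivial E := Module.nontrivial_of_finrank_pos (R := ℝ) (by omega)
  obtain ⟨z, hz⟩ : ∃ z : TangentSpace I x, z ≠ 0 := exists_ne (α := E) 0
  have hz' : inner ℝ z z ≠ (0 : ℝ) := inner_self_ne_zero.2 hz
  have h (v) := hG.lam_mul_inner hn hE hA hx a (mdiffAt_of_smooth (contMDiffAt_extend z)) v
  simp only [FiberBundle.extend_apply_self] at h
  constructor
  · intro v w
    apply mul_right_cancel₀ hz'
    rw [add_mul, h, h, h, ← inner_add_left]
    congr 1
    simp only [map_add]
    abel
  · intro t v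
    apply mul_right_cancel₀ hz'
    rw [smul_eq_mul, mul_assoc, h, h, ← real_inner_smul_left]
    congr 1
    simp only [map_smul, smul_sub]

theorem IsQuaternionicKahler.contMDiffAt_lam {n : ℕ} (hn : 0 < n)
    (hE : Module.finrank ℝ E = 4 * n) (hG : IsQuaternionicKahler I G)
    (hA : IsLocalAdaptedBasis I G U A) (hx : x ∈ U) (a : Fin 3) {V : Π y : M, TangentSpace I y}
    (hV : CMDiffAt ∞ (T% V) x) : CMDiffAt ∞ (fun y ↦ lam I n A a y (V y)) x := by
  have : Nontrivial E := Module.nontrivial_of_finrank_pos (R := ℝ) (by omega)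
  obtain ⟨z, hz⟩ : ∃ z : TangentSpace I x, z ≠ 0 := exists_ne (α := E) 0
  let Z : Π y : M, TangentSpace I y := FiberBundle.extend E z
  have hZ : CMDiffAt ∞ (T% Z) x := contMDiffAt_extend z
  have hZx : inner ℝ (Z x) (Z x) ≠ (0 : ℝ) := by
    simp only [Z, FiberBundle.extend_apply_self]
    exact inner_self_ne_zero.2 hz
  have h : (fun y ↦ lam I n A a y (V y)) =ᶠ[𝓝 x] fun y ↦
      inner ℝ (leviCivita I (fun y ↦ A (a + 1) y (Z y)) y (V y)
        - A (a + 1) y (leviCivita I Z y (V y))) (A (a + 2) y (Z y)) / inner ℝ (Z y) (Z y) := by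
    filter_upwards [hA.mem_nhds hx, mdifferentiableAt_section_of_smooth hZ,
      (contMDiffAt_inner hZ hZ).continuousAt.eventually_ne hZx] with y hy hZy hyZ
    rw [eq_div_iff hyZ, hG.lam_mul_inner hn hE hA hy a hZy]
  refine ContMDiffAt.congr_of_eventuallyEq ?_ h
  refine (contMDiffAt_inner ?_ ((hA.smoothAt hx _).apply hZ)).div₀ (contMDiffAt_inner hZ hZ) hZx
  exact (contMDiffAt_leviCivita hV ((hA.smoothAt hx _).apply hZ)).sub_section
    ((hA.smoothAt hx _).apply (contMDiffAt_leviCivita hV hZ))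

end Connection

end AQH

namespace AQH

/-! ### The curvature of a quaternionic Kähler structure -/

section QuaternionicCurvature

variable {E : Type*} [NormedAddCommGroup E] [NormedSpace ℝ E] [FiniteDimensional ℝ E]
  {H : Type*} [TopologicalSpace H] {I : ModelWithCorners ℝ E H}
  {M : Type*} [TopologicalSpace M] [ChartedSpace H M] [IsManifold I ∞ M]
  [RiemannianBundle (fun x : M ↦ TangentSpace I x)]
  [IsContMDiffRiemannianBundle I ∞ E (fun x : M ↦ TangentSpace I x)]
  {G : Π x : M, Submodule ℝ (TangentSpace I x →L[ℝ] TangentSpace I x)}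
  {U : Set M} {A : Fin 3 → Π x : M, TangentSpace I x →L[ℝ] TangentSpace I x} {x : M} {n : ℕ}

/-- The value of the two-form `γ_a` on two vector fields, with the exterior derivative of `λ_a`
computed on these fields. -/
noncomputable def gamField (n : ℕ)
    (A : Fin 3 → Π x : M, TangentSpace I x →L[ℝ] TangentSpace I x) (a : Fin 3)
    (V W : Π y : M, TangentSpace I y) (x : M) : ℝ :=
  mvfderiv I (fun y ↦ lam I n A a y (W y)) x (V x)
    - mvfderiv I (fun y ↦ lam I n A a y (V y)) x (W x) - lam I n A a x (mlieBracket I V W x)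
    + (lam I n A (a + 1) x (V x) * lam I n A (a + 2) x (W x)
      - lam I n A (a + 1) x (W x) * lam I n A (a + 2) x (V x))

theorem gam_eq_gamField (a : Fin 3) (v w : TangentSpace I x) :
    gam I n A a x v w = gamField n A a (FiberBundle.extend E v : Π y : M, TangentSpace I y)
      (FiberBundle.extend E w) x := by
  simp [gam, gamField, extDeriv₁]

/-- The second derivative `∇_V ∇_W (A_a Z)`, with `A_a` moved to the front by the formula for
`∇A_a`. -/
theorem IsQuaternionicKahler.leviCivita_leviCivita (hn : 0 < n)
    (hE : Module.finrank ℝ E = 4 * n) (hG : IsQuaternionicKahler I G)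
    (hA : IsLocalAdaptedBasis I G U A) (hx : x ∈ U) (a : Fin 3)
    {V W Z : Π y : M, TangentSpace I y} (hV : CMDiffAt ∞ (T% V) x)
    (hW : CMDiffAt ∞ (T% W) x) (hZ : CMDiffAt ∞ (T% Z) x) :
    leviCivita I (fun y ↦ leviCivita I (fun y ↦ A a y (Z y)) y (W y)) x (V x) =
      A a x (leviCivita I (fun y ↦ leviCivita I Z y (W y)) x (V x))
      + (lam I n A (a + 2) x (V x) • A (a + 1) x (leviCivita I Z x (W x))
        - lam I n A (a + 1) x (V x) • A (a + 2) x (leviCivita I Z x (W x)))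
      + (mvfderiv I (fun y ↦ lam I n A (a + 2) y (W y)) x (V x) • A (a + 1) x (Z x)
        + lam I n A (a + 2) x (W x) • (A (a + 1) x (leviCivita I Z x (V x))
          + (lam I n A a x (V x) • A (a + 2) x (Z x)
            - lam I n A (a + 2) x (V x) • A a x (Z x))))
      - (mvfderiv I (fun y ↦ lam I n A (a + 1) y (W y)) x (V x) • A (a + 2) x (Z x)
        + lam I n A (a + 1) x (W x) • (A (a + 2) x (leviCivita I Z x (V x))
          + (lam I n A (a + 1) x (V x) • A a x (Z x)
            - lam I n A a x (V x) • A (a + 1) x (Z x)))) := by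
  have hWZ := contMDiffAt_leviCivita hW hZ
  have hl (b) := hG.contMDiffAt_lam hn hE hA hx b hW
  have hAZ (b) := (hA.smoothAt hx b).apply hZ
  have h1 := leviCivita_congr (x := x) (contMDiffAt_leviCivita hW (hAZ a))
    (((hA.smoothAt hx a).apply hWZ).add_section
      (((hl (a + 2)).smul_section (hAZ (a + 1))).sub_section
        ((hl (a + 1)).smul_section (hAZ (a + 2))))) (by
      filter_upwards [hA.mem_nhds hx, mdifferentiableAt_section_of_smooth hZ] with y hy hZy
      exact hG.leviCivita_apply hn hE hA hy a hZy (W y))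
  have hs (b c) := mdiffAt_of_smooth ((hl b).smul_section (hAZ c))
  have h2 := leviCivita_add (mdiffAt_of_smooth ((hA.smoothAt hx a).apply hWZ))
    (mdifferentiableAt_sub_section (hs (a + 2) (a + 1)) (hs (a + 1) (a + 2)))
  have h3 := leviCivita_sub (hs (a + 2) (a + 1)) (hs (a + 1) (a + 2))
  have h4 (b c) := (leviCivita I).isCovariantDerivativeOnUniv.leibniz (mdiffAt_of_smooth (hAZ c))
    (mdifferentiableAt_of_smooth (hl b)).self_of_nhds
  have h5 := hG.leviCivita_apply hn hE hA hx a (mdiffAt_of_smooth hWZ) (V x)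
  have h6 (b) := hG.leviCivita_apply hn hE hA hx b (mdiffAt_of_smooth hZ) (V x)
  have h7 := h6 (a + 1)
  have h8 := h6 (a + 2)
  rw [fin3_add_one_add_two, fin3_add_one_add_one] at h7
  rw [fin3_add_two_add_one, fin3_add_two_add_two] at h8
  rw [h1, h2, add_apply, h3, sub_apply, h4, h4, h5]
  simp only [add_apply, smul_apply, ContinuousLinearMap.smulRight_apply]
  rw [h7, h8]
  module

/-- The commutator `[R(V, W), A_a]`. -/
theorem IsQuaternionicKahler.curvatureField_apply (hn : 0 < n)
    (hE : Module.finrank ℝ E = 4 * n) (hG : IsQuaternionicKahler I G)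
    (hA : IsLocalAdaptedBasis I G U A) (hx : x ∈ U) (a : Fin 3)
    {V W Z : Π y : M, TangentSpace I y} (hV : CMDiffAt ∞ (T% V) x)
    (hW : CMDiffAt ∞ (T% W) x) (hZ : CMDiffAt ∞ (T% Z) x) :
    curvatureField V W (fun y ↦ A a y (Z y)) x = A a x (curvatureField V W Z x)
      + (gamField n A (a + 1) V W x • A (a + 2) x (Z x)
        - gamField n A (a + 2) V W x • A (a + 1) x (Z x)) := by
  rw [curvatureField, curvatureField, hG.leviCivita_leviCivita hn hE hA hx a hV hW hZ,
    hG.leviCivita_leviCivita hn hE hA hx a hW hV hZ,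
    hG.leviCivita_apply hn hE hA hx a (mdiffAt_of_smooth hZ), gamField, gamField,
    fin3_add_one_add_two, fin3_add_one_add_one, fin3_add_two_add_one, fin3_add_two_add_two]
  simp only [map_add, map_sub]
  module

variable [I.Boundaryless]

theorem IsQuaternionicKahler.curvature_comm (hn : 0 < n)
    (hE : Module.finrank ℝ E = 4 * n) (hG : IsQuaternionicKahler I G)
    (hA : IsLocalAdaptedBasis I G U A) (hx : x ∈ U) (a : Fin 3)
    {V W : Π y : M, TangentSpace I y} (hV : CMDiffAt ∞ (T% V) x)
    (hW : CMDiffAt ∞ (T% W) x) (z u : TangentSpace I x) :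
    curvature I x (V x) (W x) (A a x z) u + curvature I x (V x) (W x) z (A a x u) =
      inner ℝ (gamField n A (a + 1) V W x • A (a + 2) x z
        - gamField n A (a + 2) V W x • A (a + 1) x z) u := by
  let Z : Π y : M, TangentSpace I y := FiberBundle.extend E z
  have hZ : CMDiffAt ∞ (T% Z) x := contMDiffAt_extend z
  have hZx : Z x = z := by simp [Z]
  rw [← hZx, curvature_apply (Z := fun y ↦ A a y (Z y)) hV hW ((hA.smoothAt hx a).apply hZ),
    curvature_apply hV hW hZ, hG.curvatureField_apply hn hE hA hx a hV hW hZ, inner_add_left,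
    (hA.adapted x hx).inner_left]
  ring

theorem IsQuaternionicKahler.curvature_apply_apply (hn : 0 < n)
    (hE : Module.finrank ℝ E = 4 * n) (hG : IsQuaternionicKahler I G)
    (hA : IsLocalAdaptedBasis I G U A) (hx : x ∈ U) (a : Fin 3)
    {V W : Π y : M, TangentSpace I y} (hV : CMDiffAt ∞ (T% V) x)
    (hW : CMDiffAt ∞ (T% W) x) (z u : TangentSpace I x) :
    curvature I x (V x) (W x) (A a x z) (A a x u) = curvature I x (V x) (W x) z u
      - gamField n A (a + 1) V W x * kahlerForm (A (a + 1) x) z u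
      - gamField n A (a + 2) V W x * kahlerForm (A (a + 2) x) z u := by
  have hAx := hA.adapted x hx
  have h := hG.curvature_comm hn hE hA hx a hV hW z (A a x u)
  rw [hAx.apply_self, curv_neg₄ (curvature_mem x), inner_sub_left, real_inner_smul_left,
    real_inner_smul_left, hAx.inner_left, hAx.inner_left, hAx.add_two_apply, hAx.succ_apply,
    inner_neg_right] at h
  simp only [kahlerForm]
  linarith

/-- The curvature tensor at a point is of quaternionic Kähler type, with the two-forms
`γ_I = dλ_I + λ_J ∧ λ_K`, and cyclically. -/
theorem IsQuaternionicKahler.isQKType (hn : 0 < n)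
    (hE : Module.finrank ℝ E = 4 * n) (hG : IsQuaternionicKahler I G)
    (hA : IsLocalAdaptedBasis I G U A) (hx : x ∈ U) :
    IsQKType (fun a ↦ A a x) (curvature I x) (fun a ↦ gam I n A a x) := by
  intro a v w z u
  have h := hG.curvature_apply_apply hn hE hA hx a (contMDiffAt_extend v) (contMDiffAt_extend w)
    z u
  simpa [gam_eq_gamField] using h

/-- The two-forms `γ_a` may be computed with any smooth extensions of the two vectors, because they
are determined by the curvature tensor. -/
theorem IsQuaternionicKahler.gamField_eq (hn : 0 < n)
    (hE : Module.finrank ℝ E = 4 * n) (hG : IsQuaternionicKahler I G)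
    (hA : IsLocalAdaptedBasis I G U A) (hx : x ∈ U) (a : Fin 3)
    {V W : Π y : M, TangentSpace I y} (hV : CMDiffAt ∞ (T% V) x)
    (hW : CMDiffAt ∞ (T% W) x) : gamField n A a V W x = gam I n A a x (V x) (W x) := by
  have : Nontrivial E := Module.nontrivial_of_finrank_pos (R := ℝ) (by omega)
  obtain ⟨z, hz⟩ : ∃ z : TangentSpace I x, z ≠ 0 := exists_ne (α := E) 0
  have hz' : inner ℝ z z ≠ (0 : ℝ) := inner_self_ne_zero.2 hz
  have hAx := hA.adapted x hx
  have h1 := hG.curvature_apply_apply hn hE hA hx (a + 2) hV hW (A a x z) z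
  have h2 := hG.isQKType hn hE hA hx (a + 2) (V x) (W x) (A a x z) z
  have hne : a ≠ a + 1 := by fin_cases a <;> simp
  simp only [fin3_add_two_add_one, fin3_add_two_add_two, kahlerForm, hAx.inner_apply_apply,
    if_pos, if_neg hne] at h1 h2
  apply mul_right_cancel₀ hz'
  linarith

/-- A form of `IsQuaternionicKahler.isQKType` free of bases. It also applies to an adapted basis
given at the point `x` only. -/
theorem IsQuaternionicKahler.preservesEnd (hn : 0 < n)
    (hE : Module.finrank ℝ E = 4 * n) (hG : IsQuaternionicKahler I G) (x : M) :
    PreservesEnd (G x) (curvature I x) := by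
  obtain ⟨U, A, hx, hA⟩ := hG.1 x
  have hAx := hA.adapted x hx
  refine preservesEnd_of_basis hAx (curvature_mem x) fun a v w ↦ ?_
  refine ⟨_, Submodule.sub_mem _ (Submodule.smul_mem _ (gam I n A (a + 1) x v w) (hAx.mem (a + 2)))
    (Submodule.smul_mem _ (gam I n A (a + 2) x v w) (hAx.mem (a + 1))), fun z u ↦ ?_⟩
  have h := hG.curvature_comm hn hE hA hx a (contMDiffAt_extend v) (contMDiffAt_extend w) z u
  simpa [gam_eq_gamField] using h

end QuaternionicCurvature

end AQH

namespace AQH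

/-! ### Local constancy of the scalar curvature -/

section LocallyConstant

variable {E : Type*} [NormedAddCommGroup E] [NormedSpace ℝ E] [FiniteDimensional ℝ E]
  {H : Type*} [TopologicalSpace H] {I : ModelWithCorners ℝ E H} [I.Boundaryless]
  {M : Type*} [TopologicalSpace M] [ChartedSpace H M] [IsManifold I ∞ M]

theorem eventually_contMDiffAt_extend {x : M} (v : TangentSpace I x) :
    ∀ᶠ y in 𝓝 x, CMDiffAt ∞ (T% (FiberBundle.extend E v : Π y : M, TangentSpace I y)) y := by
  obtain ⟨s, hs, hsv⟩ := FiberBundle.exists_contMDiffOn_extend (k := ∞) I E v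
  filter_upwards [eventually_mem_nhds_iff.2 hs] with y hy
  exact hsv.contMDiffAt hy

theorem isLocallyConstant_of_mvfderiv_eq_zero {f : M → ℝ} (hf : ∀ x, MDiffAt f x)
    (h : ∀ x, mvfderiv I f x = 0) : IsLocallyConstant f := by
  rw [IsLocallyConstant.iff_eventually_eq]
  intro x
  set φ := extChartAt I x
  obtain ⟨r, hr, hball⟩ := Metric.mem_nhds_iff.1 (extChartAt_target_mem_nhds (I := I) x)
  have hd : ∀ u ∈ φ.target, MDiffAt φ.symm u := fun u hu ↦ by
    have := mdifferentiableWithinAt_extChartAt_symm hu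
    rwa [I.range_eq_univ, mdifferentiableWithinAt_univ] at this
  have hconst : ∀ u ∈ Metric.ball (φ x) r, (f ∘ φ.symm) u = (f ∘ φ.symm) (φ x) := by
    intro u hu
    refine (convex_ball _ r).is_const_of_fderivWithin_eq_zero (𝕜 := ℝ) (fun p hp ↦ ?_)
      (fun p hp ↦ ?_) hu (Metric.mem_ball_self hr)
    · exact ((hf _).comp p (hd p (hball hp))).differentiableAt.differentiableWithinAt
    · rw [fderivWithin_of_isOpen Metric.isOpen_ball hp, ← mfderiv_eq_fderiv,
        mfderiv_comp p (hf _) (hd p (hball hp))]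
      ext v
      exact DFunLike.congr_fun (h (φ.symm p)) _
  have hmem : ∀ᶠ y in 𝓝 x, φ y ∈ Metric.ball (φ x) r :=
    (continuousAt_extChartAt x).eventually (Metric.ball_mem_nhds _ hr)
  filter_upwards [hmem, extChartAt_source_mem_nhds (I := I) x] with y hy hys
  have := hconst _ hy
  simpa only [Function.comp_apply, φ.left_inv hys, extChartAt_to_inv, φ] using this

variable [RiemannianBundle (fun x : M ↦ TangentSpace I x)]
  [IsContMDiffRiemannianBundle I ∞ E (fun x : M ↦ TangentSpace I x)]
  {G : Π x : M, Submodule ℝ (TangentSpace I x →L[ℝ] TangentSpace I x)}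
  {U : Set M} {A : Fin 3 → Π x : M, TangentSpace I x →L[ℝ] TangentSpace I x} {x : M} {n : ℕ}
  {c : M → ℝ}

/-- The factor `c` in `γ_a = c ω_a` is smooth, being the quotient of `-γ_I(Z, IZ)` by `⟨Z, Z⟩`. -/
theorem IsQuaternionicKahler.contMDiffAt_of_gam_eq (hn : 0 < n)
    (hE : Module.finrank ℝ E = 4 * n) (hG : IsQuaternionicKahler I G)
    (hA : IsLocalAdaptedBasis I G U A) (hx : x ∈ U)
    (hc : ∀ y ∈ U, ∀ a v w, gam I n A a y v w = c y * kahlerForm (A a y) v w) :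
    CMDiffAt ∞ c x := by
  have : Nontrivial E := Module.nontrivial_of_finrank_pos (R := ℝ) (by omega)
  obtain ⟨z, hz⟩ : ∃ z : TangentSpace I x, z ≠ 0 := exists_ne (α := E) 0
  let Z : Π y : M, TangentSpace I y := FiberBundle.extend E z
  have hZ : CMDiffAt ∞ (T% Z) x := contMDiffAt_extend z
  have hZx : inner ℝ (Z x) (Z x) ≠ (0 : ℝ) := by
    simp only [Z, FiberBundle.extend_apply_self]
    exact inner_self_ne_zero.2 hz
  have hAZ := (hA.smoothAt hx 0).apply hZ
  have hl {W : Π y : M, TangentSpace I y} (hW : CMDiffAt ∞ (T% W) x) (b) :=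
    hG.contMDiffAt_lam hn hE hA hx b hW
  have h : c =ᶠ[𝓝 x] fun y ↦
      -gamField n A 0 Z (fun y ↦ A 0 y (Z y)) y / inner ℝ (Z y) (Z y) := by
    filter_upwards [hA.mem_nhds hx, eventually_contMDiffAt_extend z,
      (contMDiffAt_inner hZ hZ).continuousAt.eventually_ne hZx] with y hy hZy hyZ
    rw [eq_div_iff hyZ, hG.gamField_eq hn hE hA hy 0 hZy ((hA.smoothAt hy 0).apply hZy), hc y hy,
      kahlerForm, (hA.adapted y hy).apply_self, inner_neg_right]
    ring
  refine ContMDiffAt.congr_of_eventuallyEq ?_ h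
  refine ContMDiffAt.div₀ (ContMDiffAt.neg ?_) (contMDiffAt_inner hZ hZ) hZx
  exact (((contMDiffAt_mvfderiv_apply (hl hAZ 0) hZ).sub
    (contMDiffAt_mvfderiv_apply (hl hZ 0) hAZ)).sub (hl (contMDiffAt_mlieBracket hZ hAZ) 0)).add
    (((hl hZ 1).mul (hl hAZ 2)).sub ((hl hAZ 1).mul (hl hZ 2)))

/-- The exterior derivative of `γ_a = c ω_a`: the terms from `dγ_a` and `c dω_a` cancel and leave
`dc ∧ ω_a = 0`. It is computed on extensions of `v, w, z` that commute near `x`, so that no brackets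
occur. -/
theorem IsQuaternionicKahler.cyclic_mvfderiv_eq_zero (hn : 0 < n)
    (hE : Module.finrank ℝ E = 4 * n) (hG : IsQuaternionicKahler I G)
    (hA : IsLocalAdaptedBasis I G U A) (hx : x ∈ U)
    (hc : ∀ y ∈ U, ∀ a v w, gam I n A a y v w = c y * kahlerForm (A a y) v w) (a : Fin 3)
    (v w z : TangentSpace I x) :
    mvfderiv I c x z * kahlerForm (A a x) v w + mvfderiv I c x v * kahlerForm (A a x) w z
      + mvfderiv I c x w * kahlerForm (A a x) z v = 0 := by
  let V : Π y : M, TangentSpace I y := FiberBundle.extend E v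
  let W : Π y : M, TangentSpace I y := FiberBundle.extend E w
  let Z : Π y : M, TangentSpace I y := FiberBundle.extend E z
  have hV : CMDiffAt ∞ (T% V) x := contMDiffAt_extend v
  have hW : CMDiffAt ∞ (T% W) x := contMDiffAt_extend w
  have hZ : CMDiffAt ∞ (T% Z) x := contMDiffAt_extend z
  have hAx := hA.adapted x hx
  have hcs := hG.contMDiffAt_of_gam_eq hn hE hA hx hc
  -- the defining equation of `γ_b` on commuting vector fields
  have eqn {X Y : Π y : M, TangentSpace I y}
      (hX : ∀ᶠ y in 𝓝 x, CMDiffAt ∞ (T% X) y) (hY : ∀ᶠ y in 𝓝 x, CMDiffAt ∞ (T% Y) y)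
      (hXY : ∀ᶠ y in 𝓝 x, mlieBracket I X Y y = 0) (b : Fin 3) :
      (c * fun y ↦ inner ℝ (X y) (A b y (Y y))) =ᶠ[𝓝 x]
        (fun y ↦ mvfderiv I (fun y ↦ lam I n A b y (Y y)) y (X y))
        - (fun y ↦ mvfderiv I (fun y ↦ lam I n A b y (X y)) y (Y y))
        + ((fun y ↦ lam I n A (b + 1) y (X y)) * (fun y ↦ lam I n A (b + 2) y (Y y))
          - (fun y ↦ lam I n A (b + 1) y (Y y)) * (fun y ↦ lam I n A (b + 2) y (X y))) := by
    filter_upwards [hX, hY, hXY, hA.mem_nhds hx] with y h1 h2 h3 hy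
    have h := hc y hy b (X y) (Y y)
    rw [← hG.gamField_eq hn hE hA hy b h1 h2, gamField, h3,
      (hG.isLinearMap_lam hn hE hA hy b).map_zero, sub_zero] at h
    exact h.symm
  have hl {W : Π y : M, TangentSpace I y} (hW : CMDiffAt ∞ (T% W) x) (b) :=
    hG.contMDiffAt_lam hn hE hA hx b hW
  have md {f : M → ℝ} (hf : CMDiffAt ∞ f x) : MDiffAt f x :=
    (mdifferentiableAt_of_smooth hf).self_of_nhds
  -- its derivative in a third direction
  have key {X Y Z : Π y : M, TangentSpace I y}
      (hX : ∀ᶠ y in 𝓝 x, CMDiffAt ∞ (T% X) y) (hY : ∀ᶠ y in 𝓝 x, CMDiffAt ∞ (T% Y) y)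
      (hZ : CMDiffAt ∞ (T% Z) x) (hXY : ∀ᶠ y in 𝓝 x, mlieBracket I X Y y = 0) :
      mvfderiv I c x (Z x) * inner ℝ (X x) (A a x (Y x))
        + c x * (inner ℝ (leviCivita I X x (Z x)) (A a x (Y x))
          - inner ℝ (leviCivita I Y x (Z x)) (A a x (X x))
          + lam I n A (a + 2) x (Z x) * inner ℝ (X x) (A (a + 1) x (Y x))
          - lam I n A (a + 1) x (Z x) * inner ℝ (X x) (A (a + 2) x (Y x))) =
      mvfderiv I (fun y ↦ mvfderiv I (fun y ↦ lam I n A a y (Y y)) y (X y)) x (Z x)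
        - mvfderiv I (fun y ↦ mvfderiv I (fun y ↦ lam I n A a y (X y)) y (Y y)) x (Z x)
        + (mvfderiv I (fun y ↦ lam I n A (a + 1) y (X y)) x (Z x) * lam I n A (a + 2) x (Y x)
          + lam I n A (a + 1) x (X x) * mvfderiv I (fun y ↦ lam I n A (a + 2) y (Y y)) x (Z x)
          - mvfderiv I (fun y ↦ lam I n A (a + 1) y (Y y)) x (Z x) * lam I n A (a + 2) x (X x)
          - lam I n A (a + 1) x (Y x)
            * mvfderiv I (fun y ↦ lam I n A (a + 2) y (X y)) x (Z x)) := by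
    have hX' := hX.self_of_nhds
    have hY' := hY.self_of_nhds
    have hAY := (hA.smoothAt hx a).apply hY'
    have h := DFunLike.congr_fun (mvfderiv_congr (eqn hX hY hXY a)) (Z x)
    have d1 := contMDiffAt_mvfderiv_apply (hl hY' a) hX'
    have d2 := contMDiffAt_mvfderiv_apply (hl hX' a) hY'
    have m1 := (hl hX' (a + 1)).mul (hl hY' (a + 2))
    have m2 := (hl hY' (a + 1)).mul (hl hX' (a + 2))
    rw [mvfderiv_mul (md hcs) (md (contMDiffAt_inner hX' hAY)),
      mvfderiv_add ((md d1).sub (md d2)) ((md m1).sub (md m2)), mvfderiv_sub (md d1) (md d2),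
      mvfderiv_sub (md m1) (md m2), mvfderiv_mul (md (hl hX' _)) (md (hl hY' _)),
      mvfderiv_mul (md (hl hY' _)) (md (hl hX' _))] at h
    simp only [add_apply, sub_apply, smul_apply, smul_eq_mul] at h
    rw [leviCivita_metric I (mdiffAt_of_smooth hZ) (mdiffAt_of_smooth hX')
      (mdiffAt_of_smooth hAY), hG.leviCivita_apply hn hE hA hx a (mdiffAt_of_smooth hY'),
      inner_add_right, inner_sub_right, real_inner_smul_right, real_inner_smul_right,
      real_inner_comm _ (X x), hAx.inner_left] at h
    linarith
  -- second derivatives along commuting fields may be interchanged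
  have comm {X Y Z : Π y : M, TangentSpace I y} (hX : CMDiffAt ∞ (T% X) x)
      (hZ : CMDiffAt ∞ (T% Z) x) (hY : CMDiffAt ∞ (T% Y) x)
      (hXZ : ∀ᶠ y in 𝓝 x, mlieBracket I X Z y = 0) :
      mvfderiv I (fun y ↦ mvfderiv I (fun y ↦ lam I n A a y (Y y)) y (X y)) x (Z x) =
      mvfderiv I (fun y ↦ mvfderiv I (fun y ↦ lam I n A a y (Y y)) y (Z y)) x (X x) := by
    have h := mvfderiv_mlieBracket (hl hY a) hX hZ
    rw [hXZ.self_of_nhds, map_zero] at h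
    linarith
  -- the torsion of the connection vanishes
  have tor {X Y : Π y : M, TangentSpace I y} (hX : CMDiffAt ∞ (T% X) x)
      (hY : CMDiffAt ∞ (T% Y) x) (hXY : ∀ᶠ y in 𝓝 x, mlieBracket I X Y y = 0) :
      leviCivita I Y x (X x) = leviCivita I X x (Y x) := by
    have h := leviCivita_sub_comm (mdiffAt_of_smooth hX) (mdiffAt_of_smooth hY)
    rwa [hXY.self_of_nhds, sub_eq_zero] at h
  have eV : ∀ᶠ y in 𝓝 x, CMDiffAt ∞ (T% V) y := eventually_contMDiffAt_extend v
  have eW : ∀ᶠ y in 𝓝 x, CMDiffAt ∞ (T% W) y := eventually_contMDiffAt_extend w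
  have eZ : ∀ᶠ y in 𝓝 x, CMDiffAt ∞ (T% Z) y := eventually_contMDiffAt_extend z
  have bVW : ∀ᶠ y in 𝓝 x, mlieBracket I V W y = 0 := mlieBracket_extend v w
  have bWZ : ∀ᶠ y in 𝓝 x, mlieBracket I W Z y = 0 := mlieBracket_extend w z
  have bZV : ∀ᶠ y in 𝓝 x, mlieBracket I Z V y = 0 := mlieBracket_extend z v
  have k1 := key eV eW hZ bVW
  have k2 := key eW eZ hV bWZ
  have k3 := key eZ eV hW bZV
  have s1 := comm hV hZ hW (mlieBracket_extend v z)
  have s2 := comm hW hV hZ (mlieBracket_extend w v)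
  have s3 := comm hZ hW hV (mlieBracket_extend z w)
  rw [tor hZ hV bZV, tor hZ hW (mlieBracket_extend z w)] at k1
  rw [tor hV hW bVW] at k2
  have i1 := (eqn eV eW bVW (a + 1)).self_of_nhds
  have i2 := (eqn eW eZ bWZ (a + 1)).self_of_nhds
  have i3 := (eqn eZ eV bZV (a + 1)).self_of_nhds
  have j1 := (eqn eV eW bVW (a + 2)).self_of_nhds
  have j2 := (eqn eW eZ bWZ (a + 2)).self_of_nhds
  have j3 := (eqn eZ eV bZV (a + 2)).self_of_nhds
  simp only [Pi.mul_apply, Pi.add_apply, Pi.sub_apply, fin3_add_one_add_one, fin3_add_one_add_two,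
    fin3_add_two_add_one, fin3_add_two_add_two] at i1 i2 i3 j1 j2 j3
  have hVx : V x = v := by simp [V]
  have hWx : W x = w := by simp [W]
  have hZx : Z x = z := by simp [Z]
  simp only [kahlerForm, ← hVx, ← hWx, ← hZx]
  linear_combination k1 + k2 + k3 + s1 + s2 + s3
    - lam I n A (a + 2) x (W x) * i3 - lam I n A (a + 2) x (Z x) * i1
    - lam I n A (a + 2) x (V x) * i2 + lam I n A (a + 1) x (W x) * j3
    + lam I n A (a + 1) x (Z x) * j1 + lam I n A (a + 1) x (V x) * j2

/-- The one-form `dc` satisfies `dc ∧ ω_a = 0`, hence vanishes in dimension greater than two. -/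
theorem IsQuaternionicKahler.mvfderiv_eq_zero (hn : 0 < n)
    (hE : Module.finrank ℝ E = 4 * n) (hG : IsQuaternionicKahler I G)
    (hA : IsLocalAdaptedBasis I G U A) (hx : x ∈ U)
    (hc : ∀ y ∈ U, ∀ a v w, gam I n A a y v w = c y * kahlerForm (A a y) v w) :
    mvfderiv I c x = 0 := by
  ext z
  -- Evaluate `dc ∧ ω_I` on `v, I v, z` with `v` orthogonal to `z` and `I z`.
  have hAx := hA.adapted x hx
  obtain ⟨v, hv, hv0⟩ : ∃ v ∈ (Submodule.span ℝ (Set.range ![z, A 0 x z]))ᗮ, v ≠ 0 := by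
    refine Submodule.exists_mem_ne_zero_of_ne_bot fun h ↦ ?_
    have h1 := Submodule.finrank_add_finrank_orthogonal (Submodule.span ℝ (Set.range ![z, A 0 x z]))
    rw [h, finrank_bot, show Module.finrank ℝ (TangentSpace I x) = 4 * n from hE] at h1
    have h2 := finrank_range_le_card (R := ℝ) ![z, A 0 x z]
    rw [Set.finrank, Fintype.card_fin] at h2
    omega
  have h1 : inner ℝ z v = (0 : ℝ) := hv z (Submodule.subset_span ⟨0, rfl⟩)
  have h2 : inner ℝ (A 0 x z) v = (0 : ℝ) := hv _ (Submodule.subset_span ⟨1, rfl⟩)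
  rw [hAx.inner_left, neg_eq_zero] at h2
  have h := hG.cyclic_mvfderiv_eq_zero hn hE hA hx hc 0 v (A 0 x v) z
  rw [kahlerForm, kahlerForm, kahlerForm, hAx.apply_self, hAx.isometry, real_inner_comm z v, h1,
    h2, inner_neg_right] at h
  have h3 : inner ℝ v v ≠ (0 : ℝ) := inner_self_ne_zero.2 hv0
  have h4 : mvfderiv I c x z * inner ℝ v v = 0 := by linarith
  exact (mul_eq_zero.1 h4).resolve_right h3

theorem IsQuaternionicKahler.isLocallyConstant (hn : 0 < n)
    (hE : Module.finrank ℝ E = 4 * n) (hG : IsQuaternionicKahler I G)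
    (hc : ∀ U A, IsLocalAdaptedBasis I G U A → ∀ y ∈ U, ∀ a v w,
      gam I n A a y v w = c y * kahlerForm (A a y) v w) : IsLocallyConstant c := by
  refine isLocallyConstant_of_mvfderiv_eq_zero (I := I) (fun x ↦ ?_) fun x ↦ ?_
  · obtain ⟨U, A, hx, hA⟩ := hG.1 x
    exact (mdifferentiableAt_of_smooth
      (hG.contMDiffAt_of_gam_eq hn hE hA hx (hc U A hA))).self_of_nhds
  · obtain ⟨U, A, hx, hA⟩ := hG.1 x
    exact hG.mvfderiv_eq_zero hn hE hA hx (hc U A hA)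

end LocallyConstant

end AQH

namespace AQH

/-! ### The Einstein constant -/

section ScalarCurvature

variable {E : Type*} [NormedAddCommGroup E] [NormedSpace ℝ E] [FiniteDimensional ℝ E]
  {H : Type*} [TopologicalSpace H] {I : ModelWithCorners ℝ E H} [I.Boundaryless]
  {M : Type*} [TopologicalSpace M] [ChartedSpace H M] [IsManifold I ∞ M]
  [RiemannianBundle (fun x : M ↦ TangentSpace I x)]
  [IsContMDiffRiemannianBundle I ∞ E (fun x : M ↦ TangentSpace I x)]
  {G : Π x : M, Submodule ℝ (TangentSpace I x →L[ℝ] TangentSpace I x)} {n : ℕ} {c : M → ℝ}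

theorem IsQuaternionicKahler.exists_ricci_eq (hn : 1 < n) (hE : Module.finrank ℝ E = 4 * n)
    (hG : IsQuaternionicKahler I G) : ∃ c : M → ℝ, ∀ (x : M) (v w : TangentSpace I x),
      ricci (curvature I x) v w = (n + 2) * c x * inner ℝ v w := by
  refine Classical.axiomOfChoice (r := fun (x : M) (c : ℝ) ↦ ∀ v w : TangentSpace I x,
    ricci (curvature I x) v w = (n + 2) * c * inner ℝ v w) fun x ↦ ?_
  obtain ⟨U, A, hx, hA⟩ := hG.1 x
  obtain ⟨c, -, hc⟩ := IsQKType.exists_const (hA.adapted x hx) (curvature_mem x)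
    (hG.isQKType (by omega) hE hA hx) hE hn
  exact ⟨c, hc⟩

/-- The factor of the Einstein equation is also the factor between the two-forms `γ_a` and the
Kähler forms. -/
theorem eq_mul_kahlerForm_of_ricci_eq (hn : 1 < n) (hE : Module.finrank ℝ E = 4 * n) {x : M}
    {A : Fin 3 → TangentSpace I x →L[ℝ] TangentSpace I x} (hA : IsAdaptedBasis (G x) A)
    {γ : Fin 3 → TangentSpace I x → TangentSpace I x → ℝ} (h : IsQKType A (curvature I x) γ)
    (hc : ∀ v w, ricci (curvature I x) v w = (n + 2) * c x * inner ℝ v w) (a : Fin 3)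
    (v w : TangentSpace I x) : γ a v w = c x * kahlerForm (A a) v w := by
  have : Nontrivial E := Module.nontrivial_of_finrank_pos (R := ℝ) (by omega)
  obtain ⟨z, hz⟩ : ∃ z : TangentSpace I x, z ≠ 0 := exists_ne (α := E) 0
  have hz' : inner ℝ z z ≠ (0 : ℝ) := inner_self_ne_zero.2 hz
  obtain ⟨c', hγ, hc'⟩ := IsQKType.exists_const hA (curvature_mem x) h hE hn
  have h1 := (hc z z).symm.trans (hc' z z)
  have h2 : ((n : ℝ) + 2) ≠ 0 := by positivity
  have h3 : c x = c' := mul_left_cancel₀ h2 (mul_right_cancel₀ hz' h1)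
  rw [h3, hγ]

end ScalarCurvature

end AQH

open AQH
theorem mainTheorem4 (n : ℕ) (hn : 1 < n)
    {M : Type*} [TopologicalSpace M] [ChartedSpace (EuclideanSpace ℝ (Fin (4 * n))) M]
    [IsManifold (𝓡 (4 * n)) ∞ M]
    [RiemannianBundle (fun x : M ↦ TangentSpace (𝓡 (4 * n)) x)]
    [IsContMDiffRiemannianBundle (𝓡 (4 * n)) ∞ (EuclideanSpace ℝ (Fin (4 * n)))
      (fun x : M ↦ TangentSpace (𝓡 (4 * n)) x)]
    (G : Π x : M, Submodule ℝ (TangentSpace (𝓡 (4 * n)) x →L[ℝ] TangentSpace (𝓡 (4 * n)) x))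
    (hG : IsQuaternionicKahler (𝓡 (4 * n)) G) :
    -- Einstein
    IsEinsteinOn (𝓡 (4 * n)) (fun x : M ↦ ricci (curvature (𝓡 (4 * n)) x)) Set.univ ∧
    -- q-Einstein
    (∀ A : Fin 3 → Π x : M, TangentSpace (𝓡 (4 * n)) x →L[ℝ] TangentSpace (𝓡 (4 * n)) x,
      (∀ x, IsAdaptedBasis (G x) (fun a ↦ A a x)) →
      IsEinsteinOn (𝓡 (4 * n))
        (fun x : M ↦ qRicci (fun a ↦ A a x) (curvature (𝓡 (4 * n)) x)) Set.univ) ∧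
    -- locally `Ric*_A`-Einstein
    (∀ U A, IsLocalAdaptedBasis (𝓡 (4 * n)) G U A → ∀ a,
      IsEinsteinOn (𝓡 (4 * n))
        (fun x : M ↦ starRicci (A a x) (curvature (𝓡 (4 * n)) x)) U) ∧
    -- the explicit constants
    ∃ c : M → ℝ, IsLocallyConstant c ∧ (PreconnectedSpace M → ∃ c₀ : ℝ, ∀ x, c x = c₀) ∧
      (∀ U A, IsLocalAdaptedBasis (𝓡 (4 * n)) G U A → ∀ x ∈ U, ∀ a,
        formInner (gam (𝓡 (4 * n)) n A a x) (kahlerForm (A a x)) = 2 * n * c x) ∧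
      (∀ (x : M) (X Y : TangentSpace (𝓡 (4 * n)) x),
        ricci (curvature (𝓡 (4 * n)) x) X Y = (n + 2) * c x * inner ℝ X Y) ∧
      ∀ (x : M) (A : Fin 3 → TangentSpace (𝓡 (4 * n)) x →L[ℝ] TangentSpace (𝓡 (4 * n)) x),
        IsAdaptedBasis (G x) A →
        (∀ a X Y, starRicci (A a) (curvature (𝓡 (4 * n)) x) X Y = n * c x * inner ℝ X Y) ∧
        (∀ X Y, qRicci A (curvature (𝓡 (4 * n)) x) X Y = 3 * n * c x * inner ℝ X Y) ∧
        IsOrthogonalProjection (Ra A ⊔ Rb A) (curvature (𝓡 (4 * n)) x)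
          ((c x / 8) • (pi₂ A + (2 : ℝ) • pi₁ (TangentSpace (𝓡 (4 * n)) x))) ∧
        curvature (𝓡 (4 * n)) x ∈
          S4E A ⊔ Submodule.span ℝ {pi₂ A + (2 : ℝ) • pi₁ (TangentSpace (𝓡 (4 * n)) x)} ∧
        Disjoint (S4E A)
          (Submodule.span ℝ {pi₂ A + (2 : ℝ) • pi₁ (TangentSpace (𝓡 (4 * n)) x)}) ∧
        S4E A ⊔ Submodule.span ℝ {pi₂ A + (2 : ℝ) • pi₁ (TangentSpace (𝓡 (4 * n)) x)} = QK n A := by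

  have hE : Module.finrank ℝ (EuclideanSpace ℝ (Fin (4 * n))) = 4 * n := finrank_euclideanSpace_fin
  have hn' : 0 < n := by omega
  obtain ⟨c, hc⟩ := hG.exists_ricci_eq hn hE
  have hgam : ∀ U A, IsLocalAdaptedBasis (𝓡 (4 * n)) G U A → ∀ x ∈ U, ∀ a v w,
      gam (𝓡 (4 * n)) n A a x v w = c x * kahlerForm (A a x) v w := fun U A hA x hx a v w ↦
    eq_mul_kahlerForm_of_ricci_eq hn hE (hA.adapted x hx) (hG.isQKType hn' hE hA hx) (hc x) a v w
  have hloc : IsLocallyConstant c := hG.isLocallyConstant hn' hE hgam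
  have hQ (x : M) {A : Fin 3 → TangentSpace (𝓡 (4 * n)) x →L[ℝ] TangentSpace (𝓡 (4 * n)) x}
      (hA : IsAdaptedBasis (G x) A) : ∃ γ, IsQKType A (curvature (𝓡 (4 * n)) x) γ ∧
        ∀ a v w, γ a v w = c x * kahlerForm (A a) v w := by
    obtain ⟨γ, h⟩ := (hG.preservesEnd hn' hE x).exists_isQKType hA (curvature_mem x)
    exact ⟨γ, h, eq_mul_kahlerForm_of_ricci_eq hn hE hA h (hc x)⟩
  have hstar (x : M) {A : Fin 3 → TangentSpace (𝓡 (4 * n)) x →L[ℝ] TangentSpace (𝓡 (4 * n)) x}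
      (hA : IsAdaptedBasis (G x) A) (a : Fin 3) (X Y : TangentSpace (𝓡 (4 * n)) x) :
      starRicci (A a) (curvature (𝓡 (4 * n)) x) X Y = n * c x * inner ℝ X Y := by
    obtain ⟨γ, h, hγ⟩ := hQ x hA
    exact h.starRicci_eq hA hγ (hc x) a X Y
  have hq (x : M) {A : Fin 3 → TangentSpace (𝓡 (4 * n)) x →L[ℝ] TangentSpace (𝓡 (4 * n)) x}
      (hA : IsAdaptedBasis (G x) A) (X Y : TangentSpace (𝓡 (4 * n)) x) :
      qRicci A (curvature (𝓡 (4 * n)) x) X Y = 3 * n * c x * inner ℝ X Y := by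
    simp only [qRicci, hstar x hA, Fin.sum_univ_three]
    ring
  have hres (U : Set M) (t : ℝ) : IsLocallyConstant (U.domRestrict fun x ↦ t * c x) :=
    (hloc.comp fun s ↦ t * s).comp_continuous continuous_subtype_val
  refine ⟨⟨fun x ↦ (n + 2) * c x, hres _ _, fun x _ ↦ hc x⟩,
    fun A hA ↦ ⟨fun x ↦ 3 * n * c x, hres _ _, fun x _ ↦ hq x (hA x)⟩,
    fun U A hA a ↦ ⟨fun x ↦ n * c x, hres _ _, fun x hx ↦ hstar x (hA.adapted x hx) a⟩,
    c, hloc, fun _ ↦ ?_, fun U A hA x hx a ↦ ?_, hc, fun x A hA ↦ ?_⟩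
  · rcases isEmpty_or_nonempty M with hM | ⟨⟨x₀⟩⟩
    · exact ⟨0, fun x ↦ isEmptyElim x⟩
    · exact ⟨c x₀, fun x ↦ hloc.apply_eq_of_preconnectedSpace x x₀⟩
  · have h : gam (𝓡 (4 * n)) n A a x = fun v w ↦ c x * kahlerForm (A a x) v w := by
      ext v w
      exact hgam U A hA x hx a v w
    rw [h]
    exact formInner_smul_kahlerForm (hA.adapted x hx) hE (c x) a
  · obtain ⟨γ, h, hγ⟩ := hQ x hA
    exact ⟨hstar x hA, hq x hA, h.isOrthogonalProjection hA (curvature_mem x) hE hn hγ,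
      h.mem_sup hA (curvature_mem x) hγ, disjoint_S4E_model hA hE hn, S4E_sup_model_eq_QK hA hE hn⟩
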